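/- **Setting.** Let $I:\mathbb{R}\to[0,\infty]$ be a good convex rate function (convex, lower semicontinuous, with compact sublevel sets $\{I\le c\}$, $c<\infty$). Let $\bar r=\sup\{r: I(r)<\infty\}\in(-\infty,\infty]$, and let $\theta^{\uparrow}=\sup\{\theta>0:\Lambda(\theta)<\infty\}$, $\theta^{\downarrow}=\sup\{\theta>0:\Lambda(-\theta)<\infty\}$, where $\Lambda(\theta)=\sup_y(\theta y-I(y))$ is the cumulant generating function of which $I$ is the Legendre transform. Let $\delta>0$ be such that $I(-\delta)=0$ and $I(y)>0$ for all $y>-\delta$, and assume that $I$ is finite near, and differentiable at, every point of $[-\delta,\bar r)$. Call $I$ non-coercive if $\bar r<\infty$ and $\lim_{r\uparrow\bar r}I(r)<\infty$, and coercive otherwise. Let $L^+[0,1]$ be the set of non-negative càdlàg functions of finite variation on $[0,1]$. With the convention $\psi(0-)=0$, so that a value $\psi(0)>0$ is a jump at time $0$, write $\dot\psi^{(a)}$ for the density of the absolutely continuous part of $d\psi$, and $\psi^{\uparrow}(t),\psi^{\downarrow}(t)$ for the masses on $[0,t]$ of the positive and negative parts of the singular part of $d\psi$. With $\infty\cdot0=0$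 put $$J(\psi)=\int_0^1\Bigl(I(\dot\psi^{(a)}(s))1_{\{\psi(s)>0\}}+\inf_{y\le0}I(y)\,1_{\{\psi(s)=0\}}\Bigr)ds+\theta^{\downarrow}\psi^{\downarrow}(1)+\theta^{\uparrow}\psi^{\uparrow}(1).$$ For $z>0$ the *main problem* is to minimize $J(\psi)$ over $\psi\in L^+[0,1]$ with $\int_0^1\psi(s)\,ds=z$. **Potential solutions.** Let $S_z$ be the set of $\psi\in L^+[0,1]$ such that, for some $0\le T_0<T_1\le1$, $T_0^0\in[T_0,T_1]$ and $\lambda^*>0$: 1. $\psi(t)=0$ for $t\in[0,T_0)\cup(T_1,1]$; 2. if $T_1<1$ then $\psi(T_1)=0$; 3. $\int_{T_0}^{T_1}\psi(t)\,dt=z$; 4. if $T_0^0<T_1$ then the left derivative of $\psi$ at $T_1$ is $-\delta$; 5. $\nabla I(\dot\psi(t))=\lambda^*(T_1-t)$ for all $t\in(T_0^0,T_1)$, in the sense that both one-sided derivatives of $\psi$ at $t$ exist and satisfy this equation (so it holds for the ordinary derivative wherever $\psi$ is differentiable, which is for every such $t$ if $\nabla I$ is injective); 6. if $I$ is coercive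 and $\theta^{\uparrow}=\infty$: $T_0^0=T_0$ and $\psi$ has no discontinuities; 7. if $I$ is coercive and $\theta^{\uparrow}<\infty$: $T_0^0=T_0$, and any discontinuity of $\psi$ is at $T_0$; 8. if $I$ is non-coercive: $\dot\psi(t)=\bar r$ for $t\in[T_0,T_0^0)$ (a right derivative at $T_0$), and $\psi$ has no discontinuities. The *reduced problem* is to minimize $$I(\bar r)(T_0^0-T_0)+\int_{T_0^0}^{T_1}I(\dot\psi(s))\,ds+\psi^{\uparrow}(T_0)\,\theta^{\uparrow}$$ over $\psi\in S_z$ (with its times $T_0,T_0^0,T_1$), where the first term is $0$ when $T_0^0=T_0$. **Proposition.** For every $z>0$ the main problem and the reduced problem are equivalent: every $\psi\in S_z$ is feasible for the main problem, and $J(\psi)$ equals its reduced cost; the two problems have the same infimum in $[0,\infty]$; and $\psi$ is an optimal solution, of finite cost, of the main problem if and only if $\psi\in S_z$ and $\psi$ is an optimal solution of the reduced problem. -/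

import Mathlib

open Set Filter Topology MeasureTheory
open scoped ENNReal NNReal

noncomputable section

namespace RRW

/-! ### The local rate function `I : ℝ → [0, ∞]` -/

/-- Good convex rate function: convex, lower semicontinuous, compact sublevel sets. -/
structure IsGoodConvexRate (I : ℝ → ℝ≥0∞) : Prop where
  convex : ConvexOn ℝ≥0 univ I
  lsc : LowerSemicontinuous I
  good : ∀ c : ℝ≥0∞, c < ⊤ → IsCompact {y : ℝ | I y ≤ c}

/-- The (scaled) cumulant generating function dual to `I`:
`Λ(θ) = sup_y (θ y - I(y))`, with values in `[-∞, ∞]`. -/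
def cgf (I : ℝ → ℝ≥0∞) (θ : ℝ) : EReal :=
  ⨆ y : ℝ, ((θ * y : ℝ) : EReal) - (I y : EReal)

/-- `θ↑ = sup {θ > 0 : Λ(θ) < ∞}`. -/
def thetaUp (I : ℝ → ℝ≥0∞) : ℝ≥0∞ :=
  ⨆ θ : {θ : ℝ // 0 < θ ∧ cgf I θ < ⊤}, ENNReal.ofReal θ

/-- `θ↓ = sup {θ > 0 : Λ(-θ) < ∞}`. -/
def thetaDown (I : ℝ → ℝ≥0∞) : ℝ≥0∞ :=
  ⨆ θ : {θ : ℝ // 0 < θ ∧ cgf I (-θ) < ⊤}, ENNReal.ofReal θ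

/-- `r̄ = sup {r : I(r) < ∞}`, in the extended reals. -/
def rbar (I : ℝ → ℝ≥0∞) : EReal :=
  sSup ((fun r : ℝ => (r : EReal)) '' {r : ℝ | I r < ⊤})

/-- `I` is non-coercive: `r̄ < ∞` and `lim_{r ↑ r̄} I(r) < ∞`. -/
def NonCoercive (I : ℝ → ℝ≥0∞) : Prop :=
  ∃ r : ℝ, rbar I = (r : EReal) ∧ ∃ c : ℝ≥0∞, c < ⊤ ∧ Tendsto I (𝓝[<] r) (𝓝 c)

/-- `I` is coercive when it is not non-coercive. -/
def Coercive (I : ℝ → ℝ≥0∞) : Prop := ¬ NonCoercive I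

/-- `∇I(r) = g`: `I` is finite around `r` and differentiable at `r` with derivative `g`. -/
def HasGradAt (I : ℝ → ℝ≥0∞) (r g : ℝ) : Prop :=
  (∀ᶠ y in 𝓝 r, I y < ⊤) ∧ HasDerivAt (fun y => (I y).toReal) g r

/-! ### Paths on `[0,1]`

A path is a function `ψ : ℝ → ℝ` of which only the values on `[0,1]` matter. As usual for
`ψ(t) = ∫₀ᵗ ψ̇⁽ᵃ⁾ ds + ψ⁽ˢ⁾(t)`, a value `ψ(0) ≠ 0` is a jump of `ψ` at time `0`. -/

/-- The path extended by `0` before time `0` and by `ψ(1)` after time `1`. -/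
def extendPath (ψ : ℝ → ℝ) (t : ℝ) : ℝ := if t < 0 then 0 else ψ (min t 1)

/-- `ψ` is càdlàg on `[0,1]`. -/
def IsCadlag (ψ : ℝ → ℝ) : Prop :=
  (∀ t ∈ Ico (0 : ℝ) 1, ContinuousWithinAt ψ (Ici t) t) ∧
    ∀ t ∈ Ioc (0 : ℝ) 1, ∃ l : ℝ, Tendsto ψ (𝓝[<] t) (𝓝 l)

/-- `L⁺[0,1]`: non-negative càdlàg paths of finite variation. -/
structure IsPath (ψ : ℝ → ℝ) : Prop where
  cadlag : IsCadlag ψ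
  finiteVariation : BoundedVariationOn ψ (Icc 0 1)
  nonneg : ∀ t ∈ Icc (0 : ℝ) 1, 0 ≤ ψ t

open Classical in
/-- The signed Lebesgue-Stieltjes measure `dψ`, with an atom `ψ(0)` at `0`
(the zero measure if `ψ` is not of finite variation). -/
def pathMeasure (ψ : ℝ → ℝ) : SignedMeasure ℝ :=
  if h : BoundedVariationOn (extendPath ψ) univ then h.vectorMeasure else 0

/-- `ψ̇⁽ᵃ⁾`: the density of the absolutely continuous part of `ψ`. -/
def acSlope (ψ : ℝ → ℝ) : ℝ → ℝ := (pathMeasure ψ).rnDeriv volume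

/-- `ψ↑(t)`: the positive part (Hahn decomposition) of the singular part of `ψ`, on `[0,t]`. -/
def upPart (ψ : ℝ → ℝ) (t : ℝ) : ℝ≥0∞ :=
  ((pathMeasure ψ).singularPart volume).toJordanDecomposition.posPart (Icc 0 t)

/-- `ψ↓(t)`: the negative part (Hahn decomposition) of the singular part of `ψ`, on `[0,t]`. -/
def downPart (ψ : ℝ → ℝ) (t : ℝ) : ℝ≥0∞ :=
  ((pathMeasure ψ).singularPart volume).toJordanDecomposition.negPart (Icc 0 t)

/-- `t` is a discontinuity of the path `ψ` on `[0,1]` (with left limit `0` at time `0`). -/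
def IsDiscontinuity (ψ : ℝ → ℝ) (t : ℝ) : Prop :=
  t ∈ Icc (0 : ℝ) 1 ∧ ¬ ContinuousAt (extendPath ψ) t

/-! ### The infinite-dimensional problem -/

/-- The objective `J`. Products in `[0,∞]` use `∞ · 0 = 0`. -/
def J (I : ℝ → ℝ≥0∞) (ψ : ℝ → ℝ) : ℝ≥0∞ :=
  (∫⁻ s in Icc (0 : ℝ) 1,
      ({s | 0 < ψ s}.indicator (fun s => I (acSlope ψ s)) s
        + {s | ψ s = 0}.indicator (fun _ => ⨅ y : ℝ, ⨅ _ : y ≤ 0, I y) s))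
    + thetaDown I * downPart ψ 1 + thetaUp I * upPart ψ 1

/-- The constraint set: `ψ ∈ L⁺[0,1]` and `∫₀¹ ψ = z`. -/
def Feasible (z : ℝ) (ψ : ℝ → ℝ) : Prop :=
  IsPath ψ ∧ ∫ s in (0 : ℝ)..1, ψ s = z

/-- `ψ` is an optimal solution (of finite cost) of the infinite-dimensional problem. -/
def IsOptimal (I : ℝ → ℝ≥0∞) (z : ℝ) (ψ : ℝ → ℝ) : Prop :=
  Feasible z ψ ∧ J I ψ < ⊤ ∧ ∀ φ : ℝ → ℝ, Feasible z φ → J I ψ ≤ J I φ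

/-! ### The reduced problem -/

/-- `ψ ∈ S_z`, witnessed by the times `T₀ ≤ T₀⁰ ≤ T₁`. -/
structure IsPotentialSolution (I : ℝ → ℝ≥0∞) (δ z : ℝ) (ψ : ℝ → ℝ) (T₀ T₀₀ T₁ : ℝ) : Prop where
  path : IsPath ψ
  T₀_nonneg : 0 ≤ T₀
  T₀_lt_T₁ : T₀ < T₁
  T₁_le_one : T₁ ≤ 1
  T₀₀_mem : T₀₀ ∈ Icc T₀ T₁
  support : ∀ t ∈ Ico 0 T₀ ∪ Ioc T₁ 1, ψ t = 0
  final_value : T₁ < 1 → ψ T₁ = 0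
  area : ∫ t in T₀..T₁, ψ t = z
  final_slope : T₀₀ < T₁ → HasDerivWithinAt ψ (-δ) (Iic T₁) T₁
  /-- `∇I(ψ̇(t)) = λ (T₁ - t)`, for both one-sided derivatives of `ψ` at `t`
  (they can differ only where `∇I` takes the same value at both). -/
  gradient : ∃ lam : ℝ, 0 < lam ∧ ∀ t ∈ Ioo T₀₀ T₁, ∃ v w : ℝ,
    HasDerivWithinAt ψ v (Iic t) t ∧ HasDerivWithinAt ψ w (Ici t) t ∧
    HasGradAt I v (lam * (T₁ - t)) ∧ HasGradAt I w (lam * (T₁ - t))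
  coercive_noJump : Coercive I → thetaUp I = ⊤ →
    T₀₀ = T₀ ∧ ∀ t, ¬ IsDiscontinuity ψ t
  coercive_jump : Coercive I → thetaUp I < ⊤ →
    T₀₀ = T₀ ∧ ∀ t, IsDiscontinuity ψ t → t = T₀
  nonCoercive : NonCoercive I →
    (∀ t ∈ Ico T₀ T₀₀, HasDerivWithinAt ψ (rbar I).toReal (Icc T₀ T₀₀) t) ∧
      ∀ t, ¬ IsDiscontinuity ψ t

/-- The objective of the reduced problem. The first term only matters for non-coercive `I`,
where `r̄` is finite; for coercive `I` it is multiplied by `T₀⁰ - T₀ = 0`. -/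
def reducedCost (I : ℝ → ℝ≥0∞) (ψ : ℝ → ℝ) (T₀ T₀₀ T₁ : ℝ) : ℝ≥0∞ :=
  I (rbar I).toReal * ENNReal.ofReal (T₀₀ - T₀)
    + (∫⁻ s in Ioc T₀₀ T₁, I (deriv ψ s))
    + upPart ψ T₀ * thetaUp I

/-- `ψ`, with the times `T₀ ≤ T₀⁰ ≤ T₁`, is an optimal solution of the reduced problem. -/
def IsReducedOptimal (I : ℝ → ℝ≥0∞) (δ z : ℝ) (ψ : ℝ → ℝ) (T₀ T₀₀ T₁ : ℝ) : Prop :=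
  IsPotentialSolution I δ z ψ T₀ T₀₀ T₁ ∧
    ∀ (φ : ℝ → ℝ) (S₀ S₀₀ S₁ : ℝ), IsPotentialSolution I δ z φ S₀ S₀₀ S₁ →
      reducedCost I ψ T₀ T₀₀ T₁ ≤ reducedCost I φ S₀ S₀₀ S₁

end RRW

end

/-! The proof is Lagrangian duality. For a feasible path φ of finite cost let E be the set of times
where φ is positive, L its measure, and m(u) the measure of E ∩ [u,1]. The density of dφ vanishes
almost everywhere on the zero set of φ, so Fubini writes the area as z = ∫_E φ̇ m + ∫ m dφ↑ − ∫ m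
dφ↓. Take 0 < Θ ≤ θ↑ and price area at λ = Θ/L. Young's inequality I(y) ≥ λm·y − Λ(λm), together
with λm ≤ θ↑ and −λm ≤ θ↓, gives J(φ) ≥ λz − ∫_E Λ(λm). Since m carries Lebesgue measure on E to
Lebesgue measure on [0,L], the right side depends on φ only through L: it is D(L) = Θz/L − (L/Θ)∫₀^Θ
Λ (`Feasible.dual_bound`).

A candidate is a triple (Θ,T,j) for which the path that jumps by j at time 0 and then has slope
∇Λ(Θ(T−s)/T) until time T has area z, does not end below 0, ends at 0 if T < 1, and jumps only if Θ
= θ↑. Its cost equals D(T). The end condition is exactly what makes T minimise the convex function D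
over (0,1], so the path is optimal (`IsCandidate.exists_optimal`). If φ is optimal too, then L = T
and Young's inequality is an equality almost everywhere: the slope at s maximises y ↦ λm(s)y − I(y),
there is no downward singular part, and upward singular mass sits only where m = L. As the maximiser
is monotone in m, slopes decrease along the path, so it cannot return to 0 and rise again. Hence E
is a single interval up to its endpoints, and φ is a potential solution
(`Feasible.exists_profile_of_slackness`, `IsProfile.exists_isPotentialSolution`).

A candidate is found by following Θ upwards and using intermediate values (`exists_isCandidate`).
This can fail only when θ↑ = ∞ and no finite-cost slope exceeds 2z. Then a path of area z and finite
cost must be t ↦ 2zt, up to a downward jump at time 1, and that case is settled directly.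

Conversely a potential solution is a concave path of known density, hence feasible, with finite cost
equal to its reduced cost (`IsPotentialSolution.feasible_and_cost`). A finite-cost optimum therefore
exists as soon as any finite-cost path does, it lies in S_z, and the two problems agree. -/

noncomputable section

/-! ### Supporting lines of the rate function -/

namespace RRW

/-- The line of slope `θ` through `(y, I y)` lies below the graph of `I`. -/
def Supports (I : ℝ → ℝ≥0∞) (θ y : ℝ) : Prop :=
  I y < ⊤ ∧ ∀ x, I x < ⊤ → (I y).toReal + θ * (x - y) ≤ (I x).toReal

variable {I : ℝ → ℝ≥0∞} {δ θ θ' y y' : ℝ}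

lemma IsGoodConvexRate.convex_comb (hI : IsGoodConvexRate I) {a b : ℝ} (ha : 0 ≤ a) (hb : 0 ≤ b)
    (hab : a + b = 1) (x y : ℝ) :
    I (a * x + b * y) ≤ ENNReal.ofReal a * I x + ENNReal.ofReal b * I y := by
  lift a to ℝ≥0 using ha
  lift b to ℝ≥0 using hb
  have := hI.convex.2 (mem_univ x) (mem_univ y) (zero_le : 0 ≤ a) (zero_le : 0 ≤ b)
    (by exact_mod_cast hab)
  simpa [NNReal.smul_def, ENNReal.smul_def] using this

lemma IsGoodConvexRate.convex_comb_toReal (hI : IsGoodConvexRate I) {a b : ℝ} (ha : 0 ≤ a)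
    (hb : 0 ≤ b) (hab : a + b = 1) {x y : ℝ} (hx : I x < ⊤) (hy : I y < ⊤) :
    I (a * x + b * y) < ⊤ ∧
      (I (a * x + b * y)).toReal ≤ a * (I x).toReal + b * (I y).toReal := by
  have h := hI.convex_comb ha hb hab x y
  have h1 : ENNReal.ofReal a * I x < ⊤ := ENNReal.mul_lt_top ENNReal.ofReal_lt_top hx
  have h2 : ENNReal.ofReal b * I y < ⊤ := ENNReal.mul_lt_top ENNReal.ofReal_lt_top hy
  have h3 := ENNReal.add_lt_top.2 ⟨h1, h2⟩
  refine ⟨h.trans_lt h3, ?_⟩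
  have := ENNReal.toReal_mono h3.ne h
  rwa [ENNReal.toReal_add h1.ne h2.ne, ENNReal.toReal_mul, ENNReal.toReal_mul,
    ENNReal.toReal_ofReal ha, ENNReal.toReal_ofReal hb] at this

/-- The sublevel set {I ≤ 1} is bounded, so I exceeds 1 at distance R from its zero −δ, and
convexity along rays from −δ extends this linearly. This makes both θ↑ and θ↓ positive. -/
lemma IsGoodConvexRate.linear_growth (hI : IsGoodConvexRate I) (hzero : I (-δ) = 0) :
    ∃ R : ℝ, 0 < R ∧ ∀ y, I y < ⊤ → |y + δ| / R - 1 ≤ (I y).toReal := by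
  obtain ⟨R, hR⟩ := (hI.good 1 ENNReal.one_lt_top).isBounded.exists_norm_le
  have hR0 : 0 ≤ R := (norm_nonneg _).trans (hR (-δ) (by simp [hzero]))
  have hR' : ∀ x, R + |δ| + 1 ≤ |x + δ| → 1 < I x := by
    intro x hx
    by_contra! h
    have h1 := hR x h
    rw [Real.norm_eq_abs] at h1
    have := abs_add_le x δ
    linarith
  have hS : 0 < R + |δ| + 1 := by positivity
  refine ⟨R + |δ| + 1, hS, fun y hy => ?_⟩
  set S := R + |δ| + 1
  by_cases hyS : |y + δ| < S
  · have : |y + δ| / S ≤ 1 := by rw [div_le_one hS]; exact hyS.le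
    linarith [ENNReal.toReal_nonneg (a := I y)]
  push Not at hyS
  have hpos : 0 < |y + δ| := hS.trans_le hyS
  have ha1 : S / |y + δ| ≤ 1 := by rw [div_le_one hpos]; exact hyS
  have ha0 : 0 < S / |y + δ| := by positivity
  obtain ⟨h1, h2⟩ := hI.convex_comb_toReal ha0.le (sub_nonneg.2 ha1) (by ring) hy
    (show I (-δ) < ⊤ by simp [hzero])
  have h3 : 1 < I (S / |y + δ| * y + (1 - S / |y + δ|) * -δ) := by
    apply hR'
    have : S / |y + δ| * y + (1 - S / |y + δ|) * -δ + δ = S / |y + δ| * (y + δ) := by ring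
    rw [this, abs_mul, abs_of_pos ha0, div_mul_cancel₀ _ hpos.ne']
  have h4 : 1 < (I (S / |y + δ| * y + (1 - S / |y + δ|) * -δ)).toReal := by
    rw [← ENNReal.toReal_one]
    exact (ENNReal.toReal_lt_toReal ENNReal.one_ne_top h1.ne).2 h3
  rw [hzero] at h2
  have h5 : 1 < S / |y + δ| * (I y).toReal := by simpa using h4.trans_le h2
  rw [div_mul_eq_mul_div, lt_div_iff₀ hpos] at h5
  have : |y + δ| / S ≤ (I y).toReal := by rw [div_le_iff₀ hS]; linarith
  linarith

lemma cgf_lt_top_iff : cgf I θ < ⊤ ↔ ∃ C : ℝ, ∀ y, I y < ⊤ → θ * y - (I y).toReal ≤ C := by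
  have key : ∀ y, I y < ⊤ →
      ((θ * y : ℝ) : EReal) - (I y : EReal) = ((θ * y - (I y).toReal : ℝ) : EReal) := by
    intro y hy
    rw [EReal.coe_sub, EReal.coe_ennreal_toReal hy.ne]
  constructor
  · intro h
    obtain ⟨C, hC, -⟩ := EReal.lt_iff_exists_real_btwn.1 h
    refine ⟨C, fun y hy => ?_⟩
    have h1 : ((θ * y : ℝ) : EReal) - (I y : EReal) ≤ cgf I θ :=
      le_iSup (fun y : ℝ => ((θ * y : ℝ) : EReal) - (I y : EReal)) y
    rw [key y hy] at h1
    exact_mod_cast h1.trans hC.le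
  · rintro ⟨C, hC⟩
    refine (iSup_le fun y => ?_ : cgf I θ ≤ (C : EReal)).trans_lt (EReal.coe_lt_top C)
    by_cases hy : I y < ⊤
    · rw [key y hy]
      exact_mod_cast hC y hy
    · rw [not_lt_top_iff] at hy
      simp [hy]

lemma le_thetaUp (hθ : 0 < θ) (C : ℝ) (h : ∀ y, I y < ⊤ → θ * y - (I y).toReal ≤ C) :
    ENNReal.ofReal θ ≤ thetaUp I :=
  le_iSup (fun θ : {θ : ℝ // 0 < θ ∧ cgf I θ < ⊤} => ENNReal.ofReal θ)
    ⟨θ, hθ, cgf_lt_top_iff.2 ⟨C, h⟩⟩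

lemma IsGoodConvexRate.thetaUp_pos (hI : IsGoodConvexRate I) (hzero : I (-δ) = 0) :
    0 < thetaUp I := by
  obtain ⟨R, hR, h⟩ := hI.linear_growth hzero
  refine (ENNReal.ofReal_pos.2 (one_div_pos.2 hR)).trans_le
    (le_thetaUp (one_div_pos.2 hR) (1 - δ / R) fun y hy => ?_)
  have h1 := h y hy
  have h2 : (y + δ) / R ≤ |y + δ| / R := by gcongr; exact le_abs_self _
  have h3 : (y + δ) / R = 1 / R * y + δ / R := by ring
  linarith

lemma IsGoodConvexRate.thetaDown_pos (hI : IsGoodConvexRate I) (hzero : I (-δ) = 0) :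
    0 < thetaDown I := by
  obtain ⟨R, hR, h⟩ := hI.linear_growth hzero
  have hR' := one_div_pos.2 hR
  refine (ENNReal.ofReal_pos.2 hR').trans_le
    (le_iSup (fun θ : {θ : ℝ // 0 < θ ∧ cgf I (-θ) < ⊤} => ENNReal.ofReal θ)
      ⟨1 / R, hR', cgf_lt_top_iff.2 ⟨1 + δ / R, fun y hy => ?_⟩⟩)
  have h1 := h y hy
  have h2 : -(y + δ) / R ≤ |y + δ| / R := by gcongr; exact neg_le_abs _
  have h3 : -(y + δ) / R = -(1 / R) * y - δ / R := by ring
  linarith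

lemma exists_bound_of_lt_thetaUp (h : ENNReal.ofReal θ < thetaUp I) :
    ∃ θ' > θ, ∃ C : ℝ, ∀ y, I y < ⊤ → θ' * y - (I y).toReal ≤ C := by
  obtain ⟨⟨θ', h0, hc⟩, h1⟩ := lt_iSup_iff.1 h
  exact ⟨θ', (ENNReal.ofReal_lt_ofReal_iff h0).1 h1, cgf_lt_top_iff.1 hc⟩

/-- Since I ≥ 0, a bound r on the finite slopes bounds Λ(θ) by θr for every θ > 0. -/
lemma thetaUp_eq_top_of_forall_le (r : ℝ) (h : ∀ y, I y < ⊤ → y ≤ r) : thetaUp I = ⊤ := by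
  refine ENNReal.eq_top_of_forall_nnreal_le fun x => ?_
  have hx : (0 : ℝ) < x + 1 := by positivity
  refine le_trans ?_ (le_thetaUp hx ((x + 1) * r) fun y hy => ?_)
  · rw [← ENNReal.ofReal_coe_nnreal]
    exact ENNReal.ofReal_le_ofReal (by linarith)
  · have := mul_le_mul_of_nonneg_left (h y hy) hx.le
    linarith [ENNReal.toReal_nonneg (a := I y)]

lemma Supports.le_of_lt (h : Supports I θ y) (h' : Supports I θ' y') (hθ : θ < θ') : y ≤ y' := by
  have h1 := h.2 y' h'.1
  have h2 := h'.2 y h.1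
  by_contra! hlt
  nlinarith

lemma Supports.toReal_le (h : Supports I θ y) (hzero : I (-δ) = 0) :
    (I y).toReal ≤ θ * (y + δ) := by
  have := h.2 (-δ) (by simp [hzero])
  rw [hzero, ENNReal.toReal_zero] at this
  linarith

lemma Supports.neg_le (h : Supports I θ y) (hzero : I (-δ) = 0) (hθ : 0 < θ) : -δ ≤ y := by
  have h1 := h.toReal_le hzero
  have h2 := ENNReal.toReal_nonneg (a := I y)
  by_contra! h3
  nlinarith

lemma supports_zero (hzero : I (-δ) = 0) : Supports I 0 (-δ) :=
  ⟨by simp [hzero], fun x _ => by simp [hzero]⟩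

/-- Below θ↑ the function I(y) − θy still grows at +∞, so its minimum over a large compact interval
is global. -/
lemma IsGoodConvexRate.exists_supports (hI : IsGoodConvexRate I) (hzero : I (-δ) = 0)
    (hθ : 0 < θ) (h : ENNReal.ofReal θ < thetaUp I) : ∃ y, Supports I θ y := by
  obtain ⟨θ', hθ', C, hC⟩ := exists_bound_of_lt_thetaUp h
  -- Beyond this R the bound I(x) ≥ θ'x − C already gives I(x) ≥ θ(x + δ), which is at least the
  -- value at x of the line through the minimiser. Adding θR to I(y) − θy keeps the minimised
  -- function in `ℝ≥0∞`.
  set R := max (|δ|) ((C + θ * δ) / (θ' - θ))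
  have hd : 0 < θ' - θ := sub_pos.2 hθ'
  have hR : -δ ∈ Icc (-R) R := by
    rw [mem_Icc, neg_le_neg_iff]
    exact ⟨(le_abs_self _).trans (le_max_left _ _), (neg_le_abs _).trans (le_max_left _ _)⟩
  have hlsc : LowerSemicontinuous fun y => I y + ENNReal.ofReal (θ * (R - y)) := by
    refine hI.lsc.add (Continuous.lowerSemicontinuous ?_)
    exact ENNReal.continuous_ofReal.comp (by fun_prop)
  obtain ⟨y, hy, hmin⟩ := (hlsc.lowerSemicontinuousOn (Icc (-R) R)).exists_isMinOn
    ⟨-δ, hR⟩ isCompact_Icc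
  have hfin : I y < ⊤ := by
    have h1 : I y + ENNReal.ofReal (θ * (R - y)) ≤ I (-δ) + ENNReal.ofReal (θ * (R - -δ)) :=
      hmin hR
    rw [hzero, zero_add] at h1
    exact (le_self_add.trans h1).trans_lt ENNReal.ofReal_lt_top
  have hin : ∀ x ∈ Icc (-R) R, I x < ⊤ → (I y).toReal + θ * (x - y) ≤ (I x).toReal := by
    intro x hx hxt
    have h1 : I y + ENNReal.ofReal (θ * (R - y)) ≤ I x + ENNReal.ofReal (θ * (R - x)) := hmin hx
    have h2 := ENNReal.toReal_mono
      (ENNReal.add_lt_top.2 ⟨hxt, ENNReal.ofReal_lt_top⟩).ne h1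
    rw [ENNReal.toReal_add hfin.ne ENNReal.ofReal_ne_top,
      ENNReal.toReal_add hxt.ne ENNReal.ofReal_ne_top,
      ENNReal.toReal_ofReal (mul_nonneg hθ.le (sub_nonneg.2 hy.2)),
      ENNReal.toReal_ofReal (mul_nonneg hθ.le (sub_nonneg.2 hx.2))] at h2
    linarith
  refine ⟨y, hfin, fun x hxt => ?_⟩
  by_cases hx : x ∈ Icc (-R) R
  · exact hin x hx hxt
  have h0 := hin (-δ) hR (by simp [hzero])
  rw [hzero, ENNReal.toReal_zero] at h0
  rcases not_and_or.1 hx with hx | hx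
  · push Not at hx
    have h1 : δ ≤ R := (le_abs_self _).trans (le_max_left _ _)
    nlinarith [ENNReal.toReal_nonneg (a := I x)]
  · push Not at hx
    have h1 : (C + θ * δ) / (θ' - θ) ≤ x := (le_max_right _ _).trans hx.le
    rw [div_le_iff₀ hd] at h1
    have h2 := hC x hxt
    linarith

/-- Closedness of the subdifferential: lower semicontinuity bounds I at the limit point, and
finiteness there follows by testing the inequality at −δ. -/
lemma Supports.of_tendsto (hlsc : LowerSemicontinuous I) (hzero : I (-δ) = 0) {ι : Type*}
    {l : Filter ι} [NeBot l] {f g : ι → ℝ} (hf : Tendsto f l (𝓝 θ)) (hg : Tendsto g l (𝓝 y))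
    (h : ∀ᶠ i in l, Supports I (f i) (g i)) : Supports I θ y := by
  have key : ∀ x, I x < ⊤ → ∀ r : ℝ, 0 ≤ r → ENNReal.ofReal r < I y →
      r + θ * (x - y) ≤ (I x).toReal := by
    intro x hx r hr hry
    have h1 : Tendsto (fun i => r + f i * (x - g i)) l (𝓝 (r + θ * (x - y))) :=
      tendsto_const_nhds.add (hf.mul (tendsto_const_nhds.sub hg))
    refine le_of_tendsto h1 ?_
    filter_upwards [h, hg.eventually (hlsc y _ hry)] with i hi h2
    have h3 := hi.2 x hx
    have h4 : r < (I (g i)).toReal := (ENNReal.ofReal_lt_iff_lt_toReal hr hi.1.ne).1 h2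
    linarith
  have hfin : I y < ⊤ := by
    by_contra htop
    rw [not_lt_top_iff] at htop
    have := key (-δ) (by simp [hzero]) (|θ * (-δ - y)| + 1) (by positivity) (by simp [htop])
    rw [hzero, ENNReal.toReal_zero] at this
    linarith [neg_abs_le (θ * (-δ - y))]
  refine ⟨hfin, fun x hx => ?_⟩
  by_contra! hlt
  rcases (ENNReal.toReal_nonneg (a := I y)).eq_or_lt with h0 | h0
  · rw [← h0, zero_add] at hlt
    have h1 : Tendsto (fun i => f i * (x - g i)) l (𝓝 (θ * (x - y))) :=
      hf.mul (tendsto_const_nhds.sub hg)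
    refine absurd (le_of_tendsto h1 ?_) (not_le.2 hlt)
    filter_upwards [h] with i hi
    linarith [hi.2 x hx, ENNReal.toReal_nonneg (a := I (g i))]
  · obtain ⟨r, hr1, hr2⟩ := exists_between
      (max_lt h0 (show (I x).toReal - θ * (x - y) < (I y).toReal by linarith))
    have hr0 : 0 < r := (le_max_left _ _).trans_lt hr1
    have := key x hx r hr0.le ((ENNReal.ofReal_lt_iff_lt_toReal hr0.le hfin.ne).2 hr2)
    linarith [le_max_right 0 ((I x).toReal - θ * (x - y))]

/-- Fermat's rule: y minimises I(x) − θx, so its derivative g − θ vanishes. -/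
lemma Supports.hasGradAt (h : Supports I θ y) {g : ℝ} (hg : HasGradAt I y g) :
    HasGradAt I y θ := by
  have h1 : IsLocalMin (fun x => (I x).toReal - θ * x) y := by
    filter_upwards [hg.1] with x hx
    linarith [h.2 x hx]
  have h2 := h1.hasDerivAt_eq_zero (hg.2.sub ((hasDerivAt_id y).const_mul θ))
  have h3 : g = θ := by linarith
  exact h3 ▸ hg

/-- By convexity the chord slope from y towards x bounds the difference quotients at y, hence their
limit. -/
lemma HasGradAt.supports (h : HasGradAt I y θ) (hI : IsGoodConvexRate I) : Supports I θ y := by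
  have hy : I y < ⊤ := h.1.self_of_nhds
  refine ⟨hy, fun x hx => ?_⟩
  have h1 : HasDerivAt (fun t : ℝ => (I (y + t * (x - y))).toReal) (θ * (x - y)) 0 := by
    have h2 : HasDerivAt (fun t : ℝ => y + t * (x - y)) (x - y) 0 := by
      simpa using ((hasDerivAt_id (0 : ℝ)).mul_const (x - y)).const_add y
    have h3 : HasDerivAt (fun z => (I z).toReal) θ (y + 0 * (x - y)) := by simpa using h.2
    exact h3.comp 0 h2
  have h4 := h1.tendsto_slope_zero_right
  have h5 : ∀ᶠ t in 𝓝[>] (0 : ℝ), t⁻¹ • ((I (y + (0 + t) * (x - y))).toReal -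
      (I (y + 0 * (x - y))).toReal) ≤ (I x).toReal - (I y).toReal := by
    filter_upwards [Ioo_mem_nhdsGT (zero_lt_one (α := ℝ))] with t ht
    have h6 := (hI.convex_comb_toReal (sub_nonneg.2 ht.2.le) ht.1.le (by ring) hy hx).2
    have h7 : (1 - t) * y + t * x = y + (0 + t) * (x - y) := by ring
    rw [h7] at h6
    rw [smul_eq_mul, inv_mul_le_iff₀ ht.1, zero_mul, add_zero]
    linarith
  have := le_of_tendsto h4 h5
  linarith

lemma coe_le_rbar (h : I y < ⊤) : (y : EReal) ≤ rbar I :=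
  le_sSup ⟨y, h, rfl⟩

/-- Lower semicontinuity bounds the limit from below, the chord from x to y from above. Consequently
a finite value at r̄, when −δ < r̄, already means non-coercivity. -/
lemma IsGoodConvexRate.tendsto_left (hI : IsGoodConvexRate I) {x y : ℝ} (hxy : x < y)
    (hx : I x < ⊤) (hy : I y < ⊤) : Tendsto I (𝓝[<] y) (𝓝 (I y)) := by
  refine tendsto_order.2 ⟨fun c hc => nhdsWithin_le_nhds (hI.lsc y c hc), fun c hc => ?_⟩
  have hd : 0 < y - x := sub_pos.2 hxy
  have h1 : Tendsto (fun w : ℝ => ENNReal.ofReal ((y - w) / (y - x)) * I x +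
      ENNReal.ofReal ((w - x) / (y - x)) * I y) (𝓝[<] y) (𝓝 (I y)) := by
    have h2 : Tendsto (fun w : ℝ => ENNReal.ofReal ((y - w) / (y - x))) (𝓝[<] y) (𝓝 0) := by
      have : Continuous fun w : ℝ => ENNReal.ofReal ((y - w) / (y - x)) :=
        ENNReal.continuous_ofReal.comp (by fun_prop)
      simpa using (this.tendsto y).mono_left nhdsWithin_le_nhds
    have h3 : Tendsto (fun w : ℝ => ENNReal.ofReal ((w - x) / (y - x))) (𝓝[<] y) (𝓝 1) := by
      have : Continuous fun w : ℝ => ENNReal.ofReal ((w - x) / (y - x)) :=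
        ENNReal.continuous_ofReal.comp (by fun_prop)
      have h4 := (this.tendsto y).mono_left (nhdsWithin_le_nhds (s := Iio y))
      rwa [div_self hd.ne', ENNReal.ofReal_one] at h4
    simpa using (ENNReal.Tendsto.mul_const h2 (Or.inr hx.ne)).add
      (ENNReal.Tendsto.mul_const h3 (Or.inr hy.ne))
  filter_upwards [h1.eventually (gt_mem_nhds hc), Ioo_mem_nhdsLT hxy] with w hw hw'
  refine lt_of_le_of_lt ?_ hw
  have := hI.convex_comb (div_nonneg (sub_nonneg.2 hw'.2.le) hd.le)
    (div_nonneg (sub_nonneg.2 hw'.1.le) hd.le) (by field_simp; ring) x y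
  have heq : (y - w) / (y - x) * x + (w - x) / (y - x) * y = w := by
    rw [div_mul_eq_mul_div, div_mul_eq_mul_div, ← add_div, div_eq_iff hd.ne']
    ring
  rwa [heq] at this

lemma Coercive.lt_rbar (hc : Coercive I) (hI : IsGoodConvexRate I) (hzero : I (-δ) = 0)
    (hr : ((-δ : ℝ) : EReal) < rbar I) (hy : I y < ⊤) : (y : EReal) < rbar I := by
  refine (coe_le_rbar hy).lt_of_ne fun heq => ?_
  have hlt : -δ < y := by
    rw [← heq] at hr
    exact_mod_cast hr
  exact hc ⟨y, heq.symm, I y, hy, hI.tendsto_left hlt (by simp [hzero]) hy⟩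

lemma NonCoercive.exists_rbar (h : NonCoercive I) (hI : IsGoodConvexRate I) :
    ∃ r : ℝ, rbar I = r ∧ I r < ⊤ := by
  obtain ⟨r, hr, c, hc, ht⟩ := h
  refine ⟨r, hr, ?_⟩
  by_contra htop
  rw [not_lt_top_iff] at htop
  obtain ⟨d, hd1, hd2⟩ := exists_between hc
  have h1 : ∀ᶠ x in 𝓝[<] r, d < I x := nhdsWithin_le_nhds (hI.lsc r d (show d < I r by rw [htop]; exact hd2))
  obtain ⟨x, hx1, hx2⟩ := (h1.and (ht.eventually (gt_mem_nhds hd1))).exists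
  exact lt_asymm hx1 hx2

lemma NonCoercive.thetaUp_eq_top (h : NonCoercive I) : thetaUp I = ⊤ := by
  obtain ⟨r, hr, -⟩ := h
  exact thetaUp_eq_top_of_forall_le r fun y hy => by
    have := coe_le_rbar hy
    rw [hr] at this
    exact_mod_cast this

end RRW

/-! ### The cumulant generating function and its subgradient -/

namespace RRW

variable {I : ℝ → ℝ≥0∞} {δ θ θ' y y' Θ : ℝ}

open Classical in
/-- A selection of the maximisers of `y ↦ θ y - I y`, equal to `-δ` at `θ = 0`. -/
def tilt (I : ℝ → ℝ≥0∞) (δ θ : ℝ) : ℝ :=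
  if h : 0 < θ ∧ ∃ y, Supports I θ y then h.2.choose else -δ

/-- The interval `[0, θ↑)`. -/
def tiltDomain (I : ℝ → ℝ≥0∞) : Set ℝ := {θ | 0 ≤ θ ∧ ENNReal.ofReal θ < thetaUp I}

/-- The value `Λ(θ)` of the cumulant generating function on `[0, θ↑)`, as a real number. -/
def legendre (I : ℝ → ℝ≥0∞) (δ θ : ℝ) : ℝ := θ * tilt I δ θ - (I (tilt I δ θ)).toReal

lemma tilt_zero : tilt I δ 0 = -δ := by simp [tilt]

lemma legendre_zero (hzero : I (-δ) = 0) : legendre I δ 0 = 0 := by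
  simp [legendre, tilt_zero, hzero]

lemma neg_le_tilt (hzero : I (-δ) = 0) : -δ ≤ tilt I δ θ := by
  unfold tilt
  split_ifs with h
  · exact h.2.choose_spec.neg_le hzero h.1
  · exact le_rfl

lemma IsGoodConvexRate.supports_tilt (hI : IsGoodConvexRate I) (hzero : I (-δ) = 0)
    (hθ : θ ∈ tiltDomain I) : Supports I θ (tilt I δ θ) := by
  rcases hθ.1.eq_or_lt with h | h
  · rw [← h, tilt_zero]
    exact supports_zero hzero
  · have h1 : 0 < θ ∧ ∃ y, Supports I θ y := ⟨h, hI.exists_supports hzero h hθ.2⟩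
    rw [tilt, dif_pos h1]
    exact h1.2.choose_spec

lemma zero_mem_tiltDomain (hI : IsGoodConvexRate I) (hzero : I (-δ) = 0) :
    (0 : ℝ) ∈ tiltDomain I := ⟨le_rfl, by simpa using hI.thetaUp_pos hzero⟩

lemma mem_tiltDomain_of_le (h : θ ∈ tiltDomain I) (h0 : 0 ≤ θ') (hle : θ' ≤ θ) :
    θ' ∈ tiltDomain I :=
  ⟨h0, (ENNReal.ofReal_le_ofReal hle).trans_lt h.2⟩

lemma mem_tiltDomain_of_lt (h : ENNReal.ofReal θ ≤ thetaUp I) (h0 : 0 ≤ θ') (hlt : θ' < θ) :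
    θ' ∈ tiltDomain I :=
  ⟨h0, ((ENNReal.ofReal_lt_ofReal_iff (h0.trans_lt hlt)).2 hlt).trans_le h⟩

lemma isOpen_ofReal_lt_thetaUp : IsOpen {θ | ENNReal.ofReal θ < thetaUp I} :=
  isOpen_lt ENNReal.continuous_ofReal continuous_const

lemma tiltDomain_mem_nhds (h : θ ∈ tiltDomain I) (h0 : 0 < θ) : tiltDomain I ∈ 𝓝 θ :=
  inter_mem (Ici_mem_nhds h0) (isOpen_ofReal_lt_thetaUp.mem_nhds h.2)

lemma exists_gt_mem_tiltDomain (h : θ ∈ tiltDomain I) : ∃ θ' ∈ tiltDomain I, θ < θ' := by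
  have h1 : ∀ᶠ x in 𝓝[>] θ, ENNReal.ofReal x < thetaUp I :=
    nhdsWithin_le_nhds (isOpen_ofReal_lt_thetaUp.mem_nhds h.2)
  obtain ⟨x, hx, hx'⟩ := (h1.and self_mem_nhdsWithin).exists
  exact ⟨x, ⟨h.1.trans (le_of_lt hx'), hx⟩, hx'⟩

lemma IsGoodConvexRate.monotoneOn_tilt (hI : IsGoodConvexRate I) (hzero : I (-δ) = 0) :
    MonotoneOn (tilt I δ) (tiltDomain I) := by
  intro a ha b hb hab
  rcases hab.eq_or_lt with rfl | h
  · exact le_rfl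
  · exact (hI.supports_tilt hzero ha).le_of_lt (hI.supports_tilt hzero hb) h

lemma IsGoodConvexRate.legendre_subgradient (hI : IsGoodConvexRate I) (hzero : I (-δ) = 0)
    (hθ : θ ∈ tiltDomain I) (hθ' : θ' ∈ tiltDomain I) :
    legendre I δ θ + (θ' - θ) * tilt I δ θ ≤ legendre I δ θ' := by
  have h1 := hI.supports_tilt hzero hθ
  have h2 := (hI.supports_tilt hzero hθ').2 _ h1.1
  unfold legendre
  linarith

lemma IsGoodConvexRate.young (hI : IsGoodConvexRate I) (hzero : I (-δ) = 0)
    (hθ : θ ∈ tiltDomain I) (hy : I y < ⊤) : 0 ≤ (I y).toReal - θ * y + legendre I δ θ := by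
  have h1 := (hI.supports_tilt hzero hθ).2 y hy
  unfold legendre
  linarith

lemma IsGoodConvexRate.supports_of_young_eq (hI : IsGoodConvexRate I) (hzero : I (-δ) = 0)
    (hθ : θ ∈ tiltDomain I) (hy : I y < ⊤) (h : (I y).toReal - θ * y + legendre I δ θ = 0) :
    Supports I θ y := by
  refine ⟨hy, fun x hx => ?_⟩
  have := hI.young hzero hθ hx
  linarith

/-- The subgradient inequalities at θ and at x trap the first-order error between 0 and (x − θ)
times the change of the subgradient. -/
lemma IsGoodConvexRate.hasDerivAt_legendre (hI : IsGoodConvexRate I) (hzero : I (-δ) = 0)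
    (hθ : θ ∈ tiltDomain I) (h0 : 0 < θ) (hc : ContinuousAt (tilt I δ) θ) :
    HasDerivAt (legendre I δ) (tilt I δ θ) θ := by
  rw [hasDerivAt_iff_isLittleO, Asymptotics.isLittleO_iff]
  intro c hc0
  filter_upwards [tiltDomain_mem_nhds hθ h0, Metric.continuousAt_iff'.1 hc c hc0] with x hx hd
  have h1 := hI.legendre_subgradient hzero hθ hx
  have h2 := hI.legendre_subgradient hzero hx hθ
  rw [Real.dist_eq] at hd
  rw [smul_eq_mul, Real.norm_eq_abs, Real.norm_eq_abs, abs_of_nonneg (by linarith)]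
  calc legendre I δ x - legendre I δ θ - (x - θ) * tilt I δ θ
      ≤ (tilt I δ x - tilt I δ θ) * (x - θ) := by linarith
    _ ≤ |(tilt I δ x - tilt I δ θ) * (x - θ)| := le_abs_self _
    _ ≤ c * |x - θ| := by
      rw [abs_mul]
      gcongr

lemma IsGoodConvexRate.continuousOn_legendre (hI : IsGoodConvexRate I) (hzero : I (-δ) = 0)
    (hΘ : Θ ∈ tiltDomain I) : ContinuousOn (legendre I δ) (Icc 0 Θ) := by
  have hD : ∀ x ∈ Icc 0 Θ, x ∈ tiltDomain I := fun x hx => mem_tiltDomain_of_le hΘ hx.1 hx.2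
  have habs : ∀ x ∈ Icc 0 Θ, |tilt I δ x| ≤ |δ| + |tilt I δ Θ| := by
    intro x hx
    rw [abs_le]
    constructor
    · linarith [neg_le_tilt hzero (θ := x), le_abs_self δ, abs_nonneg (tilt I δ Θ)]
    · linarith [hI.monotoneOn_tilt hzero (hD x hx) hΘ hx.2, abs_nonneg δ,
        le_abs_self (tilt I δ Θ)]
  refine (LipschitzOnWith.of_dist_le_mul (K := NNReal.mk (|δ| + |tilt I δ Θ|) (by positivity))
    fun x hx y hy => ?_).continuousOn
  have h1 := hI.legendre_subgradient hzero (hD x hx) (hD y hy)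
  have h2 := hI.legendre_subgradient hzero (hD y hy) (hD x hx)
  rw [Real.dist_eq, Real.dist_eq, NNReal.coe_mk]
  have h3 : |(x - y) * tilt I δ x| ≤ (|δ| + |tilt I δ Θ|) * |x - y| := by
    rw [abs_mul, mul_comm]; gcongr; exact habs x hx
  have h4 : |(x - y) * tilt I δ y| ≤ (|δ| + |tilt I δ Θ|) * |x - y| := by
    rw [abs_mul, mul_comm]; gcongr; exact habs y hy
  rw [abs_le] at h3 h4 ⊢
  constructor <;> linarith [h3.1, h3.2, h4.1, h4.2]

lemma IsGoodConvexRate.intervalIntegrable_tilt (hI : IsGoodConvexRate I) (hzero : I (-δ) = 0)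
    (hΘ : Θ ∈ tiltDomain I) : IntervalIntegrable (tilt I δ) volume 0 Θ := by
  refine MonotoneOn.intervalIntegrable ((hI.monotoneOn_tilt hzero).mono ?_)
  rw [uIcc_of_le hΘ.1]
  exact fun x hx => mem_tiltDomain_of_le hΘ hx.1 hx.2

lemma IsGoodConvexRate.countable_not_continuousAt_tilt (hI : IsGoodConvexRate I)
    (hzero : I (-δ) = 0) :
    {θ | θ ∈ tiltDomain I ∧ 0 < θ ∧ ¬ ContinuousAt (tilt I δ) θ}.Countable := by
  refine (hI.monotoneOn_tilt hzero).countable_not_continuousWithinAt.mono ?_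
  rintro θ ⟨h, h0, hc⟩
  exact ⟨h, fun h1 => hc (h1.continuousAt (tiltDomain_mem_nhds h h0))⟩

/-- A convex function is the integral of its subgradient: the selection is monotone, hence
continuous off a countable set, which the fundamental theorem of calculus tolerates. -/
lemma IsGoodConvexRate.integral_tilt (hI : IsGoodConvexRate I) (hzero : I (-δ) = 0)
    (hΘ : Θ ∈ tiltDomain I) : ∫ θ in (0 : ℝ)..Θ, tilt I δ θ = legendre I δ Θ := by
  have := MeasureTheory.integral_eq_of_hasDerivAt_off_countable_of_le (legendre I δ) (tilt I δ)
    hΘ.1 (hI.countable_not_continuousAt_tilt hzero) (hI.continuousOn_legendre hzero hΘ)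
    (fun x hx => by
      have hxD := mem_tiltDomain_of_le hΘ hx.1.1.le hx.1.2.le
      refine hI.hasDerivAt_legendre hzero hxD hx.1.1 ?_
      by_contra hc
      exact hx.2 ⟨hxD, hx.1.1, hc⟩)
    (hI.intervalIntegrable_tilt hzero hΘ)
  rw [this, legendre_zero hzero, sub_zero]

lemma IsGoodConvexRate.exists_tendsto_tilt_right (hI : IsGoodConvexRate I)
    (hzero : I (-δ) = 0) (hθ : θ ∈ tiltDomain I) :
    ∃ v, Tendsto (tilt I δ) (𝓝[>] θ) (𝓝 v) ∧ Supports I θ v := by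
  obtain ⟨b, hb, hlt⟩ := exists_gt_mem_tiltDomain hθ
  have hD : ∀ x ∈ Ioo θ b, x ∈ tiltDomain I := fun x hx =>
    mem_tiltDomain_of_le hb (hθ.1.trans hx.1.le) hx.2.le
  have h1 : Tendsto (tilt I δ) (𝓝[>] θ) (𝓝 (sInf (tilt I δ '' Ioo θ b))) :=
    MonotoneOn.tendsto_nhdsWithin_Ioo_right (nonempty_Ioo.2 hlt)
      ((hI.monotoneOn_tilt hzero).mono hD)
      ⟨-δ, by rintro _ ⟨x, -, rfl⟩; exact neg_le_tilt hzero⟩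
  refine ⟨_, h1, Supports.of_tendsto hI.lsc hzero (f := id) (l := 𝓝[>] θ)
    nhdsWithin_le_nhds h1 ?_⟩
  filter_upwards [Ioo_mem_nhdsGT hlt] with x hx using hI.supports_tilt hzero (hD x hx)

lemma IsGoodConvexRate.exists_tendsto_tilt_left (hI : IsGoodConvexRate I)
    (hzero : I (-δ) = 0) (hθ : θ ∈ tiltDomain I) (h0 : 0 < θ) :
    ∃ v, Tendsto (tilt I δ) (𝓝[<] θ) (𝓝 v) ∧ Supports I θ v := by
  have hD : ∀ x ∈ Ioo 0 θ, x ∈ tiltDomain I := fun x hx =>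
    mem_tiltDomain_of_le hθ hx.1.le hx.2.le
  have h1 : Tendsto (tilt I δ) (𝓝[<] θ) (𝓝 (sSup (tilt I δ '' Ioo 0 θ))) :=
    MonotoneOn.tendsto_nhdsWithin_Ioo_left (nonempty_Ioo.2 h0)
      ((hI.monotoneOn_tilt hzero).mono hD)
      ⟨tilt I δ θ, by
        rintro _ ⟨x, hx, rfl⟩
        exact hI.monotoneOn_tilt hzero (hD x hx) hθ hx.2.le⟩
  refine ⟨_, h1, Supports.of_tendsto hI.lsc hzero (f := id) (l := 𝓝[<] θ)
    nhdsWithin_le_nhds h1 ?_⟩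
  filter_upwards [Ioo_mem_nhdsLT h0] with x hx using hI.supports_tilt hzero (hD x hx)

/-- The right limit v at 0 maximises −I, so I(v) = 0; as v ≥ −δ and −δ is the largest zero, v = −δ.
This is the source of the final slope −δ. -/
lemma IsGoodConvexRate.tendsto_tilt_zero (hI : IsGoodConvexRate I)
    (hzero : I (-δ) = 0) (hpos : ∀ y : ℝ, -δ < y → 0 < I y) :
    Tendsto (tilt I δ) (𝓝[>] 0) (𝓝 (-δ)) := by
  obtain ⟨v, hv, hs⟩ := hI.exists_tendsto_tilt_right hzero (zero_mem_tiltDomain hI hzero)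
  have h1 := hs.toReal_le hzero
  rw [zero_mul] at h1
  have h2 : I v = 0 := by
    rcases (ENNReal.toReal_eq_zero_iff _).1 (le_antisymm h1 ENNReal.toReal_nonneg) with h | h
    · exact h
    · exact absurd h hs.1.ne
  have h3 : -δ ≤ v := ge_of_tendsto' hv fun _ => neg_le_tilt hzero
  rcases h3.eq_or_lt with h | h
  · rwa [h]
  · exact absurd h2 (hpos v h).ne'

lemma Supports.eq_tilt_of_continuousAt (hs : Supports I θ y) (hI : IsGoodConvexRate I)
    (hzero : I (-δ) = 0) (hθ : θ ∈ tiltDomain I) (h0 : 0 < θ)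
    (hc : ContinuousAt (tilt I δ) θ) : y = tilt I δ θ := by
  apply le_antisymm
  · refine ge_of_tendsto (hc.mono_left (nhdsWithin_le_nhds (s := Ioi θ))) ?_
    filter_upwards [nhdsWithin_le_nhds (tiltDomain_mem_nhds hθ h0), self_mem_nhdsWithin]
      with x hx hlt using hs.le_of_lt (hI.supports_tilt hzero hx) hlt
  · refine le_of_tendsto (hc.mono_left (nhdsWithin_le_nhds (s := Iio θ))) ?_
    filter_upwards [nhdsWithin_le_nhds (tiltDomain_mem_nhds hθ h0), self_mem_nhdsWithin]
      with x hx hlt using (hI.supports_tilt hzero hx).le_of_lt hs hlt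

/-- Wherever the monotone selection is continuous the maximiser is unique, so optimal slopes are
determined for almost every time. -/
lemma Supports.eq_tilt_ae (hI : IsGoodConvexRate I) (hzero : I (-δ) = 0) :
    {θ | θ ∈ tiltDomain I ∧ 0 < θ ∧ ∃ y, Supports I θ y ∧ y ≠ tilt I δ θ}.Countable := by
  refine (hI.countable_not_continuousAt_tilt hzero).mono ?_
  rintro θ ⟨h, h0, y, hy, hne⟩
  exact ⟨h, h0, fun hc => hne (hy.eq_tilt_of_continuousAt hI hzero h h0 hc)⟩

end RRW

/-! ### The Lebesgue decomposition of a path -/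

namespace RRW

variable {ψ : ℝ → ℝ} {t : ℝ}

/-- The positive part of the singular part of `dψ`. -/
def upMeasure (ψ : ℝ → ℝ) : Measure ℝ :=
  ((pathMeasure ψ).singularPart volume).toJordanDecomposition.posPart

/-- The negative part of the singular part of `dψ`. -/
def downMeasure (ψ : ℝ → ℝ) : Measure ℝ :=
  ((pathMeasure ψ).singularPart volume).toJordanDecomposition.negPart

instance : IsFiniteMeasure (upMeasure ψ) := by unfold upMeasure; infer_instance

instance : IsFiniteMeasure (downMeasure ψ) := by unfold downMeasure; infer_instance

lemma upPart_eq : upPart ψ t = upMeasure ψ (Icc 0 t) := rfl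

lemma downPart_eq : downPart ψ t = downMeasure ψ (Icc 0 t) := rfl

lemma integrable_acSlope : Integrable (acSlope ψ) volume :=
  SignedMeasure.integrable_rnDeriv _ _

lemma measurable_acSlope : Measurable (acSlope ψ) := SignedMeasure.measurable_rnDeriv _ _

lemma extendPath_of_mem (ht : t ∈ Icc (0 : ℝ) 1) : extendPath ψ t = ψ t := by
  simp [extendPath, not_lt.2 ht.1, ht.2]

lemma extendPath_of_neg (ht : t < 0) : extendPath ψ t = 0 := by simp [extendPath, ht]

lemma extendPath_of_one_le (ht : 1 ≤ t) : extendPath ψ t = ψ 1 := by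
  simp [extendPath, not_lt.2 (zero_le_one.trans ht), ht]

lemma boundedVariationOn_step (T : ℝ) :
    BoundedVariationOn (fun t : ℝ => if t < T then (0 : ℝ) else 1) univ := by
  refine MonotoneOn.boundedVariationOn (C := 1) (fun x _ y _ hxy => ?_) fun x _ => ?_
  · split_ifs with h1 h2 <;> linarith
  · split_ifs <;> simp

lemma boundedVariationOn_extendPath (h : BoundedVariationOn ψ (Icc 0 1)) :
    BoundedVariationOn (extendPath ψ) univ := by
  have h1 : BoundedVariationOn (fun t : ℝ => ψ (max 0 (min t 1))) univ := by
    refine ne_top_of_le_ne_top h (eVariationOn.comp_le_of_monotoneOn ψ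
      (fun t : ℝ => max 0 (min t 1)) (t := univ) ?_ ?_)
    · intro x _ y _ hxy
      exact max_le_max le_rfl (min_le_min hxy le_rfl)
    · intro x _
      exact ⟨le_max_left _ _, max_le zero_le_one (min_le_right _ _)⟩
  -- The extended path is a unit step at 0 times the path clamped to [0,1].
  convert! (boundedVariationOn_step 0).mul h1 using 1
  ext t
  simp only [extendPath, Pi.mul_apply]
  split_ifs with ht
  · simp
  · rw [one_mul, max_eq_right (le_min (not_lt.1 ht) zero_le_one)]

namespace IsPath

lemma bv (h : IsPath ψ) : BoundedVariationOn (extendPath ψ) univ :=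
  boundedVariationOn_extendPath h.finiteVariation

lemma measurable (h : IsPath ψ) : Measurable (extendPath ψ) := by
  obtain ⟨p, q, hp, hq, hpq⟩ :=
    h.bv.locallyBoundedVariationOn.exists_monotoneOn_sub_monotoneOn
  rw [hpq]
  exact (monotoneOn_univ.1 hp).measurable.sub (monotoneOn_univ.1 hq).measurable

lemma continuousWithinAt_Ici (h : IsPath ψ) (t : ℝ) :
    ContinuousWithinAt (extendPath ψ) (Ici t) t := by
  rcases lt_or_ge t 0 with ht | ht
  · refine ContinuousAt.continuousWithinAt ?_
    refine (continuousAt_const (y := (0 : ℝ))).congr ?_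
    filter_upwards [Iio_mem_nhds ht] with x hx using (extendPath_of_neg hx).symm
  rcases lt_or_ge t 1 with ht1 | ht1
  · refine (h.cadlag.1 t ⟨ht, ht1⟩).congr_of_eventuallyEq ?_ (extendPath_of_mem ⟨ht, ht1.le⟩)
    filter_upwards [Icc_mem_nhdsGE ht1] with x hx
    exact extendPath_of_mem ⟨ht.trans hx.1, hx.2⟩
  · refine (continuousWithinAt_const (b := ψ 1)).congr (fun x hx => ?_) ?_
    · exact extendPath_of_one_le (ht1.trans hx)
    · exact extendPath_of_one_le ht1

lemma rightLim_eq (h : IsPath ψ) (t : ℝ) :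
    Function.rightLim (extendPath ψ) t = extendPath ψ t :=
  ContinuousWithinAt.rightLim_eq (h.continuousWithinAt_Ici t)

lemma nonneg_extendPath (h : IsPath ψ) (t : ℝ) : 0 ≤ extendPath ψ t := by
  unfold extendPath
  split_ifs with ht
  · exact le_rfl
  · exact h.nonneg _ ⟨le_min (not_lt.1 ht) zero_le_one, min_le_right _ _⟩

lemma leftLim_nonneg (h : IsPath ψ) (t : ℝ) : 0 ≤ (extendPath ψ).leftLim t :=
  ge_of_tendsto' (h.bv.tendsto_leftLim t) h.nonneg_extendPath

lemma leftLim_zero (h : IsPath ψ) : (extendPath ψ).leftLim 0 = 0 := by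
  refine tendsto_nhds_unique (h.bv.tendsto_leftLim 0)
    ((tendsto_const_nhds (x := (0 : ℝ))).congr' ?_)
  filter_upwards [self_mem_nhdsWithin] with x hx using (extendPath_of_neg hx).symm

lemma pathMeasure_eq (h : IsPath ψ) : pathMeasure ψ = h.bv.vectorMeasure := dif_pos h.bv

lemma pathMeasure_Icc (h : IsPath ψ) {s t : ℝ} (hst : s ≤ t) :
    pathMeasure ψ (Icc s t) = extendPath ψ t - (extendPath ψ).leftLim s := by
  rw [h.pathMeasure_eq, h.bv.vectorMeasure_Icc hst, h.rightLim_eq]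

lemma pathMeasure_Ioc (h : IsPath ψ) {s t : ℝ} (hst : s ≤ t) :
    pathMeasure ψ (Ioc s t) = extendPath ψ t - extendPath ψ s := by
  rw [h.pathMeasure_eq, h.bv.vectorMeasure_Ioc hst, h.rightLim_eq, h.rightLim_eq]

end IsPath

lemma pathMeasure_apply {A : Set ℝ} (hA : MeasurableSet A) :
    pathMeasure ψ A = (∫ s in A, acSlope ψ s) + (upMeasure ψ).real A - (downMeasure ψ).real A := by
  conv_lhs =>
    rw [← SignedMeasure.singularPart_add_withDensity_rnDeriv_eq (s := pathMeasure ψ) (μ := volume),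
      ← SignedMeasure.toSignedMeasure_toJordanDecomposition
        ((pathMeasure ψ).singularPart volume)]
  rw [_root_.add_apply, withDensityᵥ_apply (SignedMeasure.integrable_rnDeriv _ _) hA,
    JordanDecomposition.toSignedMeasure, _root_.sub_apply,
    Measure.toSignedMeasure_apply_measurable hA, Measure.toSignedMeasure_apply_measurable hA]
  change (upMeasure ψ).real A - (downMeasure ψ).real A + ∫ s in A, acSlope ψ s = _
  ring

lemma IsPath.eq_integral_add (h : IsPath ψ) (ht : t ∈ Icc (0 : ℝ) 1) :
    ψ t = (∫ s in Icc 0 t, acSlope ψ s) + (upMeasure ψ).real (Icc 0 t) -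
      (downMeasure ψ).real (Icc 0 t) := by
  rw [← pathMeasure_apply measurableSet_Icc, h.pathMeasure_Icc ht.1, h.leftLim_zero, sub_zero,
    extendPath_of_mem ht]

lemma IsPath.sub_eq_integral_add (h : IsPath ψ) {s : ℝ} (hs : 0 ≤ s) (hst : s ≤ t) (ht : t ≤ 1) :
    ψ t - ψ s = (∫ s in Ioc s t, acSlope ψ s) + (upMeasure ψ).real (Ioc s t) -
      (downMeasure ψ).real (Ioc s t) := by
  rw [← pathMeasure_apply measurableSet_Ioc, h.pathMeasure_Ioc hst,
    extendPath_of_mem ⟨hs.trans hst, ht⟩, extendPath_of_mem ⟨hs, hst.trans ht⟩]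

/-- The density of a signed measure is its derivative along a differentiation basis. -/
lemma ae_tendsto_div_volume (μ : SignedMeasure ℝ) :
    ∀ᵐ x, (Tendsto (fun y => μ (Icc x y) / (y - x)) (𝓝[>] x) (𝓝 (μ.rnDeriv volume x))) ∧
      Tendsto (fun y => μ (Icc y x) / (x - y)) (𝓝[<] x) (𝓝 (μ.rnDeriv volume x)) := by
  set P := μ.toJordanDecomposition.posPart
  set N := μ.toJordanDecomposition.negPart
  have hPN : ∀ a b : ℝ, μ (Icc a b) = P.real (Icc a b) - N.real (Icc a b) := by
    intro a b
    conv_lhs => rw [← SignedMeasure.toSignedMeasure_toJordanDecomposition μ]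
    rw [JordanDecomposition.toSignedMeasure, _root_.sub_apply,
      Measure.toSignedMeasure_apply_measurable measurableSet_Icc,
      Measure.toSignedMeasure_apply_measurable measurableSet_Icc]
  filter_upwards [VitaliFamily.ae_tendsto_rnDeriv (IsUnifLocDoublingMeasure.vitaliFamily volume 1) P,
    VitaliFamily.ae_tendsto_rnDeriv (IsUnifLocDoublingMeasure.vitaliFamily volume 1) N,
    Measure.rnDeriv_lt_top P volume, Measure.rnDeriv_lt_top N volume] with x hP hN hP' hN'
  rw [SignedMeasure.rnDeriv_def]
  constructor
  · have h1 := ((ENNReal.tendsto_toReal hP'.ne).comp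
      (hP.comp (Real.tendsto_Icc_vitaliFamily_right x))).sub ((ENNReal.tendsto_toReal hN'.ne).comp
      (hN.comp (Real.tendsto_Icc_vitaliFamily_right x)))
    refine h1.congr' ?_
    filter_upwards [self_mem_nhdsWithin] with y hy
    have hy : x < y := hy
    simp only [Function.comp_apply, ENNReal.toReal_div, Real.volume_Icc,
      ENNReal.toReal_ofReal (sub_pos.2 hy).le, hPN, Measure.real]
    ring
  · have h1 := ((ENNReal.tendsto_toReal hP'.ne).comp
      (hP.comp (Real.tendsto_Icc_vitaliFamily_left x))).sub ((ENNReal.tendsto_toReal hN'.ne).comp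
      (hN.comp (Real.tendsto_Icc_vitaliFamily_left x)))
    refine h1.congr' ?_
    filter_upwards [self_mem_nhdsWithin] with y hy
    have hy : y < x := hy
    simp only [Function.comp_apply, ENNReal.toReal_div, Real.volume_Icc,
      ENNReal.toReal_ofReal (sub_pos.2 hy).le, hPN, Measure.real]
    ring

/-- At a zero of a non-negative path the left difference quotients are ≤ 0 and the right ones ≥ 0,
and almost everywhere both converge to the density. -/
lemma IsPath.acSlope_eq_zero (h : IsPath ψ) :
    ∀ᵐ t, t ∈ Ioo (0 : ℝ) 1 → ψ t = 0 → acSlope ψ t = 0 := by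
  filter_upwards [ae_tendsto_div_volume (pathMeasure ψ),
    h.bv.locallyBoundedVariationOn.ae_differentiableAt] with t ht hd h01 h0
  have he : extendPath ψ t = 0 := by rw [extendPath_of_mem ⟨h01.1.le, h01.2.le⟩, h0]
  have hl : (extendPath ψ).leftLim t = 0 := by
    rw [hd.continuousAt.continuousWithinAt.leftLim_eq, he]
  apply le_antisymm
  · refine le_of_tendsto ht.2 ?_
    filter_upwards [self_mem_nhdsWithin] with y hy
    have hy : y < t := hy
    rw [h.pathMeasure_Icc hy.le, he]
    exact div_nonpos_of_nonpos_of_nonneg (by linarith [h.leftLim_nonneg y]) (sub_pos.2 hy).le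
  · refine ge_of_tendsto ht.1 ?_
    filter_upwards [self_mem_nhdsWithin] with y hy
    have hy : t < y := hy
    rw [h.pathMeasure_Icc hy.le, hl, sub_zero]
    exact div_nonneg (h.nonneg_extendPath y) (sub_pos.2 hy).le

/-! ### The time remaining in a set -/

/-- The measure of the part of `E` lying in `[u, 1]`. -/
def remaining (E : Set ℝ) (u : ℝ) : ℝ := volume.real (E ∩ Icc u 1)

variable {E : Set ℝ}

lemma remaining_nonneg {u : ℝ} : 0 ≤ remaining E u := measureReal_nonneg

lemma volume_inter_Icc_ne_top {u : ℝ} : volume (E ∩ Icc u 1) ≠ ⊤ :=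
  measure_ne_top_of_subset inter_subset_right measure_Icc_lt_top.ne

lemma remaining_antitone : Antitone (remaining E) := fun _ _ hab =>
  measureReal_mono (inter_subset_inter_right _ (Icc_subset_Icc_left hab)) volume_inter_Icc_ne_top

lemma remaining_sub_le {a b : ℝ} (hab : a ≤ b) : remaining E a - remaining E b ≤ b - a := by
  have h1 : E ∩ Icc a 1 ⊆ (E ∩ Icc b 1) ∪ Ico a b := by
    rintro x ⟨hx, hx1, hx2⟩
    rcases lt_or_ge x b with h | h
    · exact Or.inr ⟨hx1, h⟩
    · exact Or.inl ⟨hx, h, hx2⟩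
  have h2 := (measureReal_mono h1 (measure_union_ne_top volume_inter_Icc_ne_top
    measure_Ico_lt_top.ne) : remaining E a ≤ _).trans (measureReal_union_le (μ := volume) _ _)
  rw [Real.volume_real_Ico_of_le hab] at h2
  unfold remaining at *
  linarith

lemma continuous_remaining : Continuous (remaining E) := by
  refine (LipschitzWith.of_dist_le_mul (K := 1) fun x y => ?_).continuous
  rw [NNReal.coe_one, one_mul, Real.dist_eq, Real.dist_eq]
  rcases le_total x y with h | h
  · rw [abs_of_nonneg (sub_nonneg.2 (remaining_antitone h)), abs_sub_comm,
      abs_of_nonneg (sub_nonneg.2 h)]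
    exact remaining_sub_le h
  · rw [abs_sub_comm, abs_of_nonneg (sub_nonneg.2 (remaining_antitone h)),
      abs_of_nonneg (sub_nonneg.2 h)]
    exact remaining_sub_le h

lemma remaining_le (hE : E ⊆ Icc 0 1) {u : ℝ} : remaining E u ≤ volume.real E :=
  measureReal_mono inter_subset_left (measure_ne_top_of_subset hE measure_Icc_lt_top.ne)

lemma remaining_zero (hE : E ⊆ Icc 0 1) : remaining E 0 = volume.real E := by
  rw [remaining, inter_eq_left.2 hE]

lemma remaining_one : remaining E 1 = 0 := by
  rw [remaining, Icc_self, measureReal_def,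
    measure_mono_null inter_subset_right (by simp : volume ({1} : Set ℝ) = 0), ENNReal.toReal_zero]

/-- Run the clock only while in E, backwards from time 1: the time remaining is then uniform on
[0,|E|]. Half-lines suffice: for 0 ≤ c < |E|, the points of E with at most c remaining are E ∩
[s,1], where s is the first time with that property, and by continuity exactly c remains at s. -/
lemma map_remaining (hE : E ⊆ Icc 0 1) :
    (volume.restrict E).map (remaining E) = volume.restrict (Icc 0 (volume.real E)) := by
  have hEfin : volume E ≠ ⊤ := measure_ne_top_of_subset hE measure_Icc_lt_top.ne
  have : IsFiniteMeasure (volume.restrict E) := ⟨by simpa using hEfin.lt_top⟩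
  have hm : Measurable (remaining E) := continuous_remaining.measurable
  refine Measure.ext_of_Iic _ _ fun c => ?_
  rw [Measure.map_apply hm measurableSet_Iic, Measure.restrict_apply (hm measurableSet_Iic),
    Measure.restrict_apply measurableSet_Iic]
  rcases lt_or_ge c 0 with hc | hc
  · have h1 : remaining E ⁻¹' Iic c ∩ E = ∅ := by
      ext x
      simp only [mem_inter_iff, mem_preimage, mem_Iic, mem_empty_iff_false, iff_false, not_and]
      intro h
      linarith [remaining_nonneg (E := E) (u := x)]
    have h2 : Iic c ∩ Icc 0 (volume.real E) = ∅ := by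
      ext x
      simp only [mem_inter_iff, mem_Iic, mem_Icc, mem_empty_iff_false, iff_false, not_and]
      intro h h0
      linarith
    rw [h1, h2]
  rcases le_or_gt (volume.real E) c with hcL | hcL
  · have h1 : remaining E ⁻¹' Iic c ∩ E = E :=
      inter_eq_right.2 fun x _ => (remaining_le hE).trans hcL
    have h2 : Iic c ∩ Icc 0 (volume.real E) = Icc 0 (volume.real E) :=
      inter_eq_right.2 fun x hx => hx.2.trans hcL
    rw [h1, h2, Real.volume_Icc, sub_zero, ofReal_measureReal hEfin]
  · obtain ⟨s, hs⟩ : ∃ s, IsLeast (Icc 0 1 ∩ remaining E ⁻¹' Iic c) s := by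
      refine IsCompact.exists_isLeast (isCompact_Icc.inter_right
        (isClosed_Iic.preimage continuous_remaining)) ⟨1, by simp, ?_⟩
      simpa [remaining_one] using hc
    have hs0 : 0 < s := by
      refine hs.1.1.1.lt_of_ne fun h => ?_
      have := hs.1.2
      rw [← h, mem_preimage, remaining_zero hE] at this
      exact absurd this (not_le.2 hcL)
    have hsc : remaining E s = c := by
      refine le_antisymm hs.1.2 (ge_of_tendsto
        (continuous_remaining.continuousAt.tendsto.mono_left (nhdsWithin_le_nhds (s := Iio s))) ?_)
      filter_upwards [Ioo_mem_nhdsLT hs0] with x hx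
      by_contra! hlt
      exact absurd (hs.2 ⟨⟨hx.1.le, hx.2.le.trans hs.1.1.2⟩, hlt.le⟩) (not_le.2 hx.2)
    have h1 : remaining E ⁻¹' Iic c ∩ E = E ∩ Icc s 1 := by
      ext x
      constructor
      · rintro ⟨h1, h2⟩
        exact ⟨h2, hs.2 ⟨hE h2, h1⟩, (hE h2).2⟩
      · rintro ⟨h1, h2, h3⟩
        exact ⟨(remaining_antitone h2).trans hs.1.2, h1⟩
    have h2 : Iic c ∩ Icc 0 (volume.real E) = Icc 0 c := by
      ext x
      simp only [mem_inter_iff, mem_Iic, mem_Icc]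
      constructor
      · rintro ⟨h1, h2, -⟩
        exact ⟨h2, h1⟩
      · rintro ⟨h1, h2⟩
        exact ⟨h2, h1, h2.trans hcL.le⟩
    rw [h1, h2, Real.volume_Icc, sub_zero, ← hsc, remaining, ofReal_measureReal
      volume_inter_Icc_ne_top]

/-- Fubini on the triangle u ≤ s: an increment made at time u contributes to the path for the part
of E after u. -/
lemma integral_integral_Icc {Q : Measure ℝ} [SigmaFinite Q] {f : ℝ → ℝ}
    (hf : IntegrableOn f (Icc 0 1) Q) (hE : E ⊆ Icc 0 1) (hEm : MeasurableSet E) :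
    IntegrableOn (fun s => ∫ u in Icc 0 s, f u ∂Q) E ∧
    IntegrableOn (fun u => f u * remaining E u) (Icc 0 1) Q ∧
    ∫ s in E, (∫ u in Icc 0 s, f u ∂Q) = ∫ u in Icc 0 1, f u * remaining E u ∂Q := by
  have hEfin : volume E ≠ ⊤ := measure_ne_top_of_subset hE measure_Icc_lt_top.ne
  have : IsFiniteMeasure (volume.restrict E) := ⟨by simpa using hEfin.lt_top⟩
  set S : Set (ℝ × ℝ) := {p | p.2 ≤ p.1}
  have hS : MeasurableSet S := measurableSet_le measurable_snd measurable_fst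
  have hint : Integrable (S.indicator fun p : ℝ × ℝ => f p.2)
      ((volume.restrict E).prod (Q.restrict (Icc 0 1))) :=
    (Integrable.comp_snd hf (volume.restrict E)).indicator hS
  have h1 : ∀ s ∈ E, ∫ u in Icc 0 1, S.indicator (fun p : ℝ × ℝ => f p.2) (s, u) ∂Q =
      ∫ u in Icc 0 s, f u ∂Q := by
    intro s hs
    have h2 : (fun u => S.indicator (fun p : ℝ × ℝ => f p.2) (s, u)) = (Iic s).indicator f := by
      ext u
      simp [indicator, S]
    rw [h2, setIntegral_indicator measurableSet_Iic]
    congr 2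
    ext u
    simp only [mem_inter_iff, mem_Icc, mem_Iic]
    constructor
    · rintro ⟨⟨h1, -⟩, h2⟩
      exact ⟨h1, h2⟩
    · rintro ⟨h1, h2⟩
      exact ⟨⟨h1, h2.trans (hE hs).2⟩, h2⟩
  have h3 : ∀ u, ∫ s in E, S.indicator (fun p : ℝ × ℝ => f p.2) (s, u) =
      f u * remaining E u := by
    intro u
    have h2 : (fun s => S.indicator (fun p : ℝ × ℝ => f p.2) (s, u)) =
        (Ici u).indicator fun _ => f u := by
      ext s
      simp [indicator, S]
    rw [h2, setIntegral_indicator measurableSet_Ici, setIntegral_const, smul_eq_mul, mul_comm]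
    congr 2
    ext s
    simp only [mem_inter_iff, mem_Icc, mem_Ici]
    constructor
    · rintro ⟨h1, h2⟩
      exact ⟨h1, h2, (hE h1).2⟩
    · rintro ⟨h1, h2, -⟩
      exact ⟨h1, h2⟩
  refine ⟨hint.integral_prod_left.congr ?_, ?_, ?_⟩
  · filter_upwards [ae_restrict_mem hEm] with s hs using h1 s hs
  · refine hint.integral_prod_right.congr (Eventually.of_forall fun u => h3 u)
  · rw [← setIntegral_congr_fun hEm h1, integral_integral_swap (f := fun s u => S.indicator (fun p : ℝ × ℝ => f p.2) (s, u)) hint]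
    simp_rw [h3]

end RRW

/-! ### Area formula and weak duality -/

namespace RRW

variable {I : ℝ → ℝ≥0∞} {δ z Θ : ℝ} {ψ : ℝ → ℝ}

/-- The times at which the path is positive. -/
def positiveSet (ψ : ℝ → ℝ) : Set ℝ := {s | s ∈ Icc (0 : ℝ) 1 ∧ 0 < ψ s}

lemma positiveSet_subset : positiveSet ψ ⊆ Icc 0 1 := fun _ h => h.1

lemma IsPath.measurableSet_positiveSet (h : IsPath ψ) : MeasurableSet (positiveSet ψ) := by
  have : positiveSet ψ = Icc 0 1 ∩ extendPath ψ ⁻¹' Ioi 0 := by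
    ext s
    simp only [positiveSet, mem_ofPred_eq, mem_inter_iff, mem_preimage, mem_Ioi]
    exact and_congr_right fun hs => by rw [extendPath_of_mem hs]
  rw [this]
  exact measurableSet_Icc.inter (h.measurable measurableSet_Ioi)

lemma IsGoodConvexRate.measurable (hI : IsGoodConvexRate I) : Measurable I := hI.lsc.measurable

lemma IsPath.J_eq (h : IsPath ψ) (hδ : 0 < δ) (hzero : I (-δ) = 0) :
    J I ψ = (∫⁻ s in positiveSet ψ, I (acSlope ψ s)) + thetaDown I * downMeasure ψ (Icc 0 1) +
      thetaUp I * upMeasure ψ (Icc 0 1) := by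
  have hinf : (⨅ y : ℝ, ⨅ _ : y ≤ 0, I y) = 0 :=
    le_antisymm ((iInf₂_le (-δ) (by linarith)).trans hzero.le) zero_le
  have h1 : (∫⁻ s in Icc (0 : ℝ) 1,
      ({s | 0 < ψ s}.indicator (fun s => I (acSlope ψ s)) s
        + {s | ψ s = 0}.indicator (fun _ => ⨅ y : ℝ, ⨅ _ : y ≤ 0, I y) s)) =
      ∫⁻ s in positiveSet ψ, I (acSlope ψ s) := by
    rw [hinf, ← lintegral_indicator measurableSet_Icc,
      ← lintegral_indicator h.measurableSet_positiveSet]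
    congr 1
    ext s
    by_cases hs : s ∈ Icc (0 : ℝ) 1
    · by_cases h0 : 0 < ψ s
      · rw [indicator_of_mem hs, indicator_of_mem (show s ∈ positiveSet ψ from ⟨hs, h0⟩)]
        simp [h0]
      · rw [indicator_of_mem hs, indicator_of_notMem (show s ∉ positiveSet ψ from fun h => h0 h.2)]
        simp [indicator, h0]
    · rw [indicator_of_notMem hs, indicator_of_notMem (show s ∉ positiveSet ψ from fun h => hs h.1)]
  rw [J, h1, upPart_eq, downPart_eq]

/-- Only times in E contribute to the area, and Fubini is applied separately to the density and to
the two singular parts. The density integral may be cut down to E because the density vanishes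
almost everywhere on the zero set. -/
lemma Feasible.area_eq (h : Feasible z ψ) :
    z = (∫ s in positiveSet ψ, acSlope ψ s * remaining (positiveSet ψ) s) +
      (∫ u in Icc 0 1, remaining (positiveSet ψ) u ∂(upMeasure ψ)) -
      ∫ u in Icc 0 1, remaining (positiveSet ψ) u ∂(downMeasure ψ) := by
  obtain ⟨hψ, hz⟩ := h
  have hE := hψ.measurableSet_positiveSet
  have h1 : z = ∫ s in positiveSet ψ, ψ s := by
    rw [← hz, intervalIntegral.integral_of_le zero_le_one, ← integral_Icc_eq_integral_Ioc]
    refine (setIntegral_eq_of_subset_of_forall_sdiff_eq_zero measurableSet_Icc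
      positiveSet_subset fun s hs => ?_)
    by_contra hne
    exact hs.2 ⟨hs.1, (hψ.nonneg s hs.1).lt_of_ne' hne⟩
  obtain ⟨a1, a2, a3⟩ := integral_integral_Icc (Q := volume) (f := acSlope ψ)
    integrable_acSlope.integrableOn positiveSet_subset hE
  obtain ⟨b1, b2, b3⟩ := integral_integral_Icc (Q := upMeasure ψ) (f := fun _ => 1)
    (integrable_const _) positiveSet_subset hE
  obtain ⟨c1, c2, c3⟩ := integral_integral_Icc (Q := downMeasure ψ) (f := fun _ => 1)
    (integrable_const _) positiveSet_subset hE
  have h2 : ∀ s ∈ positiveSet ψ, ψ s = (∫ u in Icc 0 s, acSlope ψ u) +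
      (∫ u in Icc 0 s, (1 : ℝ) ∂(upMeasure ψ)) - ∫ u in Icc 0 s, (1 : ℝ) ∂(downMeasure ψ) := by
    intro s hs
    rw [hψ.eq_integral_add hs.1]
    simp
  have h3 : ∫ u in Icc 0 1, acSlope ψ u * remaining (positiveSet ψ) u =
      ∫ s in positiveSet ψ, acSlope ψ s * remaining (positiveSet ψ) s := by
    refine setIntegral_eq_of_subset_of_ae_sdiff_eq_zero measurableSet_Icc.nullMeasurableSet
      positiveSet_subset ?_
    have hne : ∀ c : ℝ, ∀ᵐ x : ℝ, x ≠ c := fun c => by simp [ae_iff]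
    filter_upwards [hψ.acSlope_eq_zero, hne 0, hne 1] with s hs hs0 hs1 hd
    have h4 : ψ s = 0 := by
      by_contra hne
      exact hd.2 ⟨hd.1, (hψ.nonneg s hd.1).lt_of_ne' hne⟩
    rw [hs ⟨hd.1.1.lt_of_ne' hs0, hd.1.2.lt_of_ne hs1⟩ h4, zero_mul]
  have hab : IntegrableOn (fun s => (∫ u in Icc 0 s, acSlope ψ u) +
      ∫ u in Icc 0 s, (1 : ℝ) ∂(upMeasure ψ)) (positiveSet ψ) := a1.add b1
  rw [h1, setIntegral_congr_fun hE h2, integral_sub hab c1, integral_add a1 b1, a3, b3, c3,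
    h3]
  simp

lemma Feasible.volume_positiveSet_pos (h : Feasible z ψ) (hz : 0 < z) :
    0 < volume.real (positiveSet ψ) := by
  refine measureReal_nonneg.lt_of_ne fun h0 => ?_
  have h1 := h.area_eq
  have h2 : ∀ u, remaining (positiveSet ψ) u = 0 := fun u =>
    le_antisymm (h0 ▸ remaining_le positiveSet_subset) remaining_nonneg
  simp only [h2, mul_zero, integral_zero, add_zero, sub_zero] at h1
  exact hz.ne' h1

lemma volume_positiveSet_ne_top : volume (positiveSet ψ) ≠ ⊤ :=
  measure_ne_top_of_subset positiveSet_subset measure_Icc_lt_top.ne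

lemma volume_positiveSet_le_one : volume.real (positiveSet ψ) ≤ 1 := by
  have := measureReal_mono (μ := volume) (positiveSet_subset (ψ := ψ)) measure_Icc_lt_top.ne
  simpa using this

/-- Keeps the multiplier strictly below Θ for almost every time, hence inside [0, θ↑) even when Θ =
θ↑. -/
lemma ae_remaining_lt {E : Set ℝ} (hE : E ⊆ Icc 0 1) :
    ∀ᵐ s ∂(volume.restrict E), remaining E s < volume.real E := by
  have h1 : ∀ᵐ u ∂((volume.restrict E).map (remaining E)), u ≠ volume.real E := by
    rw [map_remaining hE]
    exact ae_restrict_of_ae (by simp [ae_iff])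
  filter_upwards [ae_of_ae_map continuous_remaining.measurable.aemeasurable h1] with s hs
  exact (remaining_le hE).lt_of_ne hs

/-- Weak duality for the main problem, with the conditions for equality. -/
theorem Feasible.dual_bound (hI : IsGoodConvexRate I) (hδ : 0 < δ) (hzero : I (-δ) = 0)
    (hz : 0 < z) (hΘ : 0 < Θ) (hΘup : ENNReal.ofReal Θ ≤ thetaUp I)
    (hint : IntervalIntegrable (legendre I δ) volume 0 Θ)
    (h : Feasible z ψ) (hJ : J I ψ < ⊤) :
    Θ / volume.real (positiveSet ψ) * z -
        volume.real (positiveSet ψ) / Θ * ∫ θ in (0 : ℝ)..Θ, legendre I δ θ ≤ (J I ψ).toReal ∧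
    ((J I ψ).toReal = Θ / volume.real (positiveSet ψ) * z -
        volume.real (positiveSet ψ) / Θ * ∫ θ in (0 : ℝ)..Θ, legendre I δ θ →
      (∀ᵐ s ∂(volume.restrict (positiveSet ψ)),
        Supports I (Θ / volume.real (positiveSet ψ) * remaining (positiveSet ψ) s)
          (acSlope ψ s)) ∧
      upMeasure ψ (Icc 0 1 ∩ {s | remaining (positiveSet ψ) s < volume.real (positiveSet ψ)}) = 0 ∧
      downMeasure ψ (Icc 0 1) = 0) := by
  have hL := h.volume_positiveSet_pos hz
  have harea := h.area_eq
  set E := positiveSet ψ with hEdef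
  set L := volume.real E with hLdef
  set m := remaining E with hmdef
  set lam := Θ / L with hlamdef
  have hlam : 0 < lam := div_pos hΘ hL
  have hEm : MeasurableSet E := h.1.measurableSet_positiveSet
  have hEfin : IsFiniteMeasure (volume.restrict E) :=
    ⟨by simpa using (volume_positiveSet_ne_top (ψ := ψ)).lt_top⟩
  have hmL : ∀ u, m u ≤ L := fun u => remaining_le positiveSet_subset
  have hm0 : ∀ u, 0 ≤ m u := fun u => remaining_nonneg
  have hmm : Measurable m := continuous_remaining.measurable
  have hmint : ∀ (Q : Measure ℝ) [IsFiniteMeasure Q], Integrable m Q := fun Q _ =>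
    Integrable.of_bound hmm.aestronglyMeasurable L
      (Eventually.of_forall fun u => by rw [Real.norm_of_nonneg (hm0 u)]; exact hmL u)
  rw [h.1.J_eq hδ hzero] at hJ ⊢
  obtain ⟨hJ12, hJ3⟩ := ENNReal.add_lt_top.1 hJ
  obtain ⟨hJ1, hJ2⟩ := ENNReal.add_lt_top.1 hJ12
  have hImeas : AEMeasurable (fun s => I (acSlope ψ s)) (volume.restrict E) :=
    (hI.measurable.comp measurable_acSlope).aemeasurable
  have hIfin : ∀ᵐ s ∂(volume.restrict E), I (acSlope ψ s) < ⊤ :=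
    ae_lt_top' hImeas hJ1.ne
  have hIint : Integrable (fun s => (I (acSlope ψ s)).toReal) (volume.restrict E) :=
    integrable_toReal_of_lintegral_ne_top hImeas hJ1.ne
  have hI1 : (∫⁻ s in E, I (acSlope ψ s)).toReal = ∫ s in E, (I (acSlope ψ s)).toReal :=
    (integral_toReal hImeas hIfin).symm
  have hmap := map_remaining (E := E) positiveSet_subset
  have hscale : IntervalIntegrable (fun u => legendre I δ (lam * u)) volume 0 L := by
    have := hint.comp_mul_left (c := lam)
    rwa [zero_div, hlamdef, div_div_cancel₀ hΘ.ne'] at this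
  have hscale' : IntegrableOn (fun u => legendre I δ (lam * u)) (Icc 0 L) volume := by
    rw [integrableOn_Icc_iff_integrableOn_Ioc]
    exact (intervalIntegrable_iff_integrableOn_Ioc_of_le hL.le).1 hscale
  have hΛint : Integrable (fun s => legendre I δ (lam * m s)) (volume.restrict E) := by
    rw [IntegrableOn, ← hmap] at hscale'
    exact hscale'.comp_measurable hmm
  have hΛ : ∫ s in E, legendre I δ (lam * m s) =
      L / Θ * ∫ θ in (0 : ℝ)..Θ, legendre I δ θ := by
    have h1 : ∫ u, legendre I δ (lam * u) ∂((volume.restrict E).map m) =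
        ∫ s in E, legendre I δ (lam * m s) := by
      refine integral_map hmm.aemeasurable ?_
      rw [hmap]
      exact hscale'.aestronglyMeasurable
    rw [← h1, hmap, integral_Icc_eq_integral_Ioc, ← intervalIntegral.integral_of_le hL.le,
      intervalIntegral.integral_comp_mul_left _ hlam.ne', mul_zero, hlamdef,
      div_mul_cancel₀ _ hL.ne', smul_eq_mul, inv_div]
  have hac : Integrable (fun s => acSlope ψ s * m s) (volume.restrict E) :=
    (integral_integral_Icc (Q := volume) (f := acSlope ψ)
      integrable_acSlope.integrableOn positiveSet_subset hEm).2.1.mono_set positiveSet_subset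
  -- The duality gap is the sum of three non-negative terms: the Young defect of the density, and
  -- the defects λm ≤ θ↑ and −λm ≤ θ↓ on the two singular parts. Equality forces each to vanish
  -- almost everywhere for its own measure.
  set G1 := fun s => (I (acSlope ψ s)).toReal - lam * m s * acSlope ψ s + legendre I δ (lam * m s)
    with hG1
  set G2 := fun u => (thetaUp I).toReal - lam * m u with hG2
  set G3 := fun u => (thetaDown I).toReal + lam * m u with hG3
  set P := (upMeasure ψ).restrict (Icc 0 1) with hP
  set N := (downMeasure ψ).restrict (Icc 0 1) with hN
  have hdom : ∀ u, m u < L → lam * m u ∈ tiltDomain I := fun u hu =>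
    mem_tiltDomain_of_lt hΘup (mul_nonneg hlam.le (hm0 u)) (by
      rw [hlamdef, div_mul_eq_mul_div, div_lt_iff₀ hL]
      exact mul_lt_mul_of_pos_left hu hΘ)
  have hG1pos : ∀ᵐ s ∂(volume.restrict E), 0 ≤ G1 s := by
    filter_upwards [hIfin, ae_remaining_lt (E := E) positiveSet_subset] with s h1 h2
    exact hI.young hzero (hdom s h2) h1
  -- An infinite θ has `toReal` equal to 0, so that case is handled by finite cost, which leaves no
  -- mass of the corresponding sign.
  have hup : thetaUp I = ⊤ → upMeasure ψ (Icc 0 1) = 0 := fun htop => by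
    by_contra hne
    rw [htop, ENNReal.top_mul hne] at hJ3
    exact lt_irrefl _ hJ3
  have hdown : thetaDown I = ⊤ → downMeasure ψ (Icc 0 1) = 0 := fun htop => by
    by_contra hne
    rw [htop, ENNReal.top_mul hne] at hJ2
    exact lt_irrefl _ hJ2
  have hΘle : thetaUp I ≠ ⊤ → Θ ≤ (thetaUp I).toReal := fun hne =>
    (ENNReal.ofReal_le_iff_le_toReal hne).1 hΘup
  have hlm : ∀ u, lam * m u ≤ Θ := fun u => by
    rw [hlamdef, div_mul_eq_mul_div, div_le_iff₀ hL]
    exact mul_le_mul_of_nonneg_left (hmL u) hΘ.le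
  have hG2pos : ∀ᵐ u ∂P, 0 ≤ G2 u := by
    by_cases htop : thetaUp I = ⊤
    · rw [hP, Measure.restrict_eq_zero.2 (hup htop)]
      simp
    · exact Eventually.of_forall fun u => by
        have := hΘle htop
        have := hlm u
        simp only [hG2]
        linarith
  have hG3pos : ∀ u, 0 ≤ G3 u := fun u =>
    add_nonneg ENNReal.toReal_nonneg (mul_nonneg hlam.le (hm0 u))
  have hG1int : Integrable G1 (volume.restrict E) := by
    refine (hIint.sub ?_).add hΛint
    refine (hac.const_mul lam).congr (Eventually.of_forall fun s => ?_)
    dsimp only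
    ring
  have hG2int : Integrable G2 P := (integrable_const _).sub ((hmint P).const_mul lam)
  have hG3int : Integrable G3 N := (integrable_const _).add ((hmint N).const_mul lam)
  have hi1 : ∫ s in E, G1 s = (∫ s in E, (I (acSlope ψ s)).toReal) -
      lam * (∫ s in E, acSlope ψ s * m s) + L / Θ * ∫ θ in (0 : ℝ)..Θ, legendre I δ θ := by
    have h1 : ∀ s, G1 s = (I (acSlope ψ s)).toReal - lam * (acSlope ψ s * m s) +
      legendre I δ (lam * m s) := fun s => by simp only [hG1]; ring
    have h2 : Integrable (fun s => (I (acSlope ψ s)).toReal - lam * (acSlope ψ s * m s))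
        (volume.restrict E) := hIint.sub (hac.const_mul lam)
    simp_rw [h1]
    rw [integral_add h2 hΛint, integral_sub hIint
      (hac.const_mul lam), integral_const_mul, hΛ]
  have hi2 : ∫ u, G2 u ∂P = (thetaUp I).toReal * (upMeasure ψ).real (Icc 0 1) -
      lam * ∫ u, m u ∂P := by
    rw [hG2, integral_sub (integrable_const _) ((hmint P).const_mul lam), integral_const_mul,
      integral_const, smul_eq_mul, hP, measureReal_restrict_apply_univ, mul_comm]
  have hi3 : ∫ u, G3 u ∂N = (thetaDown I).toReal * (downMeasure ψ).real (Icc 0 1) +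
      lam * ∫ u, m u ∂N := by
    rw [hG3, integral_add (integrable_const _) ((hmint N).const_mul lam), integral_const_mul,
      integral_const, smul_eq_mul, hN, measureReal_restrict_apply_univ, mul_comm]
  have key : ((∫⁻ s in E, I (acSlope ψ s)) + thetaDown I * downMeasure ψ (Icc 0 1) +
      thetaUp I * upMeasure ψ (Icc 0 1)).toReal -
      (lam * z - L / Θ * ∫ θ in (0 : ℝ)..Θ, legendre I δ θ) =
      (∫ s in E, G1 s) + (∫ u, G2 u ∂P) + ∫ u, G3 u ∂N := by
    rw [ENNReal.toReal_add hJ12.ne hJ3.ne, ENNReal.toReal_add hJ1.ne hJ2.ne, ENNReal.toReal_mul,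
      ENNReal.toReal_mul, hI1, hi1, hi2, hi3, harea]
    simp only [Measure.real]
    ring
  have n1 : 0 ≤ ∫ s in E, G1 s := integral_nonneg_of_ae hG1pos
  have n2 : 0 ≤ ∫ u, G2 u ∂P := integral_nonneg_of_ae hG2pos
  have n3 : 0 ≤ ∫ u, G3 u ∂N := integral_nonneg hG3pos
  refine ⟨by linarith, fun heq => ?_⟩
  have e1 : ∫ s in E, G1 s = 0 := by linarith
  have e2 : ∫ u, G2 u ∂P = 0 := by linarith
  have e3 : ∫ u, G3 u ∂N = 0 := by linarith
  refine ⟨?_, ?_, ?_⟩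
  · filter_upwards [(integral_eq_zero_iff_of_nonneg_ae hG1pos hG1int).1 e1, hIfin,
      ae_remaining_lt (E := E) positiveSet_subset] with s h1 h2 h3
    exact hI.supports_of_young_eq hzero (hdom s h3) h2 h1
  · by_cases htop : thetaUp I = ⊤
    · exact measure_mono_null inter_subset_left (hup htop)
    · have h1 := (integral_eq_zero_iff_of_nonneg_ae hG2pos hG2int).1 e2
      rw [hP, EventuallyEq, ae_restrict_iff' measurableSet_Icc, ae_iff] at h1
      refine measure_mono_null ?_ h1
      rintro u ⟨hu, hlt⟩
      simp only [mem_ofPred_eq, not_forall]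
      refine ⟨hu, ne_of_gt ?_⟩
      have hlt' : lam * m u < Θ := by
        rw [hlamdef, div_mul_eq_mul_div, div_lt_iff₀ hL]
        exact mul_lt_mul_of_pos_left hlt hΘ
      simp only [hG2, Pi.zero_apply]
      linarith [hΘle htop]
  · by_cases htop : thetaDown I = ⊤
    · exact hdown htop
    · have h1 := (integral_eq_zero_iff_of_nonneg hG3pos hG3int).1 e3
      -- Because θ↓ > 0, the third defect is strictly positive everywhere, so any downward mass
      -- would open a gap.
      have hpos : 0 < (thetaDown I).toReal :=
        ENNReal.toReal_pos (hI.thetaDown_pos hzero).ne' htop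
      rw [hN, EventuallyEq, ae_restrict_iff' measurableSet_Icc, ae_iff] at h1
      refine measure_mono_null ?_ h1
      intro u hu
      simp only [mem_ofPred_eq, not_forall]
      refine ⟨hu, ne_of_gt ?_⟩
      simp only [hG3, Pi.zero_apply]
      linarith [mul_nonneg hlam.le (hm0 u)]

end RRW

/-! ### Paths with one jump and an integrable density -/

namespace RRW

variable {I : ℝ → ℝ≥0∞} {δ z j T₀ T₁ t : ℝ} {ψ b : ℝ → ℝ}

/-- `ψ` jumps by `j` at `T₀` and is absolutely continuous otherwise, with a density `b` that
vanishes outside `(T₀, T₁]`. -/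
structure IsProfile (ψ b : ℝ → ℝ) (j T₀ T₁ : ℝ) : Prop where
  T₀_nonneg : 0 ≤ T₀
  lt : T₀ < T₁
  T₁_le_one : T₁ ≤ 1
  jump_nonneg : 0 ≤ j
  integrable : Integrable b volume
  eq_zero : ∀ t, t ∉ Ioc T₀ T₁ → b t = 0
  eq_integral : ∀ t, extendPath ψ t = if t < T₀ then 0 else j + ∫ s in T₀..t, b s
  nonneg : ∀ t ∈ Icc (0 : ℝ) 1, 0 ≤ ψ t

namespace IsProfile

lemma integral_of_le (h : IsProfile ψ b j T₀ T₁) (ht : t ≤ T₀) : ∫ s in T₀..t, b s = 0 := by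
  rw [intervalIntegral.integral_symm, intervalIntegral.integral_of_le ht,
    setIntegral_eq_zero_of_forall_eq_zero, neg_zero]
  exact fun s hs => h.eq_zero s fun hs' => not_lt.2 hs.2 hs'.1

lemma integral_of_ge (h : IsProfile ψ b j T₀ T₁) (ht : T₁ ≤ t) :
    ∫ s in T₀..t, b s = ∫ s in T₀..T₁, b s := by
  rw [← intervalIntegral.integral_add_adjacent_intervals (b := T₁) h.integrable.intervalIntegrable
    h.integrable.intervalIntegrable, intervalIntegral.integral_of_le ht,
    setIntegral_eq_zero_of_forall_eq_zero (t := Ioc T₁ t), add_zero]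
  exact fun s hs => h.eq_zero s fun hs' => not_lt.2 hs'.2 hs.1

lemma continuous_integral (h : IsProfile ψ b j T₀ T₁) :
    Continuous fun t => ∫ s in T₀..t, b s :=
  intervalIntegral.continuous_primitive (fun _ _ => h.integrable.intervalIntegrable) T₀

lemma extendPath_of_lt (h : IsProfile ψ b j T₀ T₁) (ht : t < T₀) : extendPath ψ t = 0 := by
  rw [h.eq_integral, if_pos ht]

lemma extendPath_of_ge (h : IsProfile ψ b j T₀ T₁) (ht : T₀ ≤ t) :
    extendPath ψ t = j + ∫ s in T₀..t, b s := by
  rw [h.eq_integral, if_neg (not_lt.2 ht)]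

lemma continuousAt (h : IsProfile ψ b j T₀ T₁) (ht : t ≠ T₀) :
    ContinuousAt (extendPath ψ) t := by
  rcases lt_or_gt_of_ne ht with ht | ht
  · refine (continuousAt_const (y := (0 : ℝ))).congr ?_
    filter_upwards [Iio_mem_nhds ht] with s hs using (h.extendPath_of_lt hs).symm
  · refine (h.continuous_integral.const_add j).continuousAt.congr ?_
    filter_upwards [Ioi_mem_nhds ht] with s hs using (h.extendPath_of_ge (le_of_lt hs)).symm

lemma continuousAt_of_jump_eq_zero (h : IsProfile ψ b j T₀ T₁) (hj : j = 0) :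
    ContinuousAt (extendPath ψ) t := by
  refine h.continuous_integral.continuousAt.congr (Eventually.of_forall fun s => ?_)
  rcases lt_or_ge s T₀ with hs | hs
  · simp only [h.extendPath_of_lt hs, h.integral_of_le hs.le]
  · simp only [h.extendPath_of_ge hs, hj, zero_add]

lemma continuousWithinAt_Ici (h : IsProfile ψ b j T₀ T₁) (t : ℝ) :
    ContinuousWithinAt (extendPath ψ) (Ici t) t := by
  by_cases ht : t = T₀
  · refine (h.continuous_integral.const_add j).continuousWithinAt.congr (fun s hs => ?_) ?_
    · exact h.extendPath_of_ge (ht ▸ hs)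
    · exact h.extendPath_of_ge ht.ge
  · exact (h.continuousAt ht).continuousWithinAt

lemma boundedVariationOn (h : IsProfile ψ b j T₀ T₁) : BoundedVariationOn ψ (Icc 0 1) := by
  have h1 : AbsolutelyContinuousOnInterval (fun t => ∫ s in T₀..t, b s) 0 1 :=
    h.integrable.intervalIntegrable.absolutelyContinuousOnInterval_intervalIntegral
      (c := T₀) ⟨by simpa using h.T₀_nonneg, by simpa using h.lt.le.trans h.T₁_le_one⟩
  have h2 : BoundedVariationOn (fun t => j + ∫ s in T₀..t, b s) (Icc 0 1) := by
    have h3 := h1.boundedVariationOn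
    rw [uIcc_of_le zero_le_one] at h3
    exact (LipschitzWith.comp_boundedVariationOn (C := 1) (f := fun x : ℝ => j + x)
      ((isometry_add_left j).lipschitz) h3)
  refine ne_of_eq_of_ne (eVariationOn.congr fun t (ht : t ∈ Icc (0 : ℝ) 1) => ?_)
    (((boundedVariationOn_step T₀).mono (subset_univ _)).mul h2)
  rw [← extendPath_of_mem (ψ := ψ) ht, h.eq_integral]
  simp only [Pi.mul_apply]
  split_ifs <;> simp

lemma isPath (h : IsProfile ψ b j T₀ T₁) : IsPath ψ where
  nonneg := h.nonneg
  finiteVariation := h.boundedVariationOn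
  cadlag := by
    refine ⟨fun t ht => ?_, fun t ht => ?_⟩
    · refine (h.continuousWithinAt_Ici t).congr_of_eventuallyEq ?_
        (extendPath_of_mem ⟨ht.1, ht.2.le⟩).symm
      filter_upwards [Icc_mem_nhdsGE ht.2] with s hs
      exact (extendPath_of_mem ⟨ht.1.trans hs.1, hs.2⟩).symm
    · have h1 : (extendPath ψ) =ᶠ[𝓝[<] t] ψ := by
        filter_upwards [Ioo_mem_nhdsLT ht.1] with s hs
        exact extendPath_of_mem ⟨hs.1.le, hs.2.le.trans ht.2⟩
      by_cases htT : t = T₀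
      · refine ⟨0, (tendsto_const_nhds.congr' ?_).congr' h1⟩
        filter_upwards [self_mem_nhdsWithin] with s hs
        exact (h.extendPath_of_lt (htT ▸ hs)).symm
      · exact ⟨_, (((h.continuousAt htT).tendsto).mono_left nhdsWithin_le_nhds).congr' h1⟩

lemma integral_Iic (h : IsProfile ψ b j T₀ T₁) :
    ∫ s in Iic t, b s = ∫ s in T₀..t, b s := by
  rcases le_total t T₀ with ht | ht
  · rw [h.integral_of_le ht, setIntegral_eq_zero_of_forall_eq_zero]
    exact fun s hs => h.eq_zero s fun hs' => not_lt.2 (le_trans hs ht) hs'.1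
  · rw [intervalIntegral.integral_of_le ht]
    refine setIntegral_eq_of_subset_of_forall_sdiff_eq_zero measurableSet_Iic
      (fun s hs => hs.2) fun s hs => h.eq_zero s fun hs' => hs.2 ⟨hs'.1, hs.1⟩

/-- Both sides agree on half-lines, which form a generating π-system. Uniqueness of the Lebesgue
decomposition then identifies the density as b and the singular part as an atom j at T₀. -/
lemma pathMeasure_eq (h : IsProfile ψ b j T₀ T₁) :
    pathMeasure ψ = (j.toNNReal • Measure.dirac T₀).toSignedMeasure +
      volume.withDensityᵥ b := by
  have hbv := h.isPath.bv
  have hbot : limUnder atBot (extendPath ψ) = 0 := by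
    refine Tendsto.limUnder_eq (tendsto_const_nhds.congr' ?_)
    filter_upwards [Iio_mem_atBot T₀] with s hs using (h.extendPath_of_lt hs).symm
  have htop : limUnder atTop (extendPath ψ) = j + ∫ s in T₀..T₁, b s := by
    refine Tendsto.limUnder_eq (tendsto_const_nhds.congr' ?_)
    filter_upwards [Ici_mem_atTop T₁] with s hs
    rw [h.extendPath_of_ge (h.lt.le.trans hs), h.integral_of_ge hs]
  have hreal : ∀ A : Set ℝ, MeasurableSet A → (j.toNNReal • Measure.dirac T₀).real A =
      A.indicator (fun _ => j) T₀ := by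
    intro A hA
    rw [measureReal_nnreal_smul_apply, Real.coe_toNNReal _ h.jump_nonneg, measureReal_def,
      Measure.dirac_apply' _ hA]
    by_cases hT : T₀ ∈ A <;> simp [hT]
  refine VectorMeasure.ext_of_generateFrom (range Iic) ?_ ?_ isPiSystem_Iic ?_
  · rintro _ ⟨a, rfl⟩
    rw [h.isPath.pathMeasure_eq, hbv.vectorMeasure_Iic, h.isPath.rightLim_eq, hbot, sub_zero,
      _root_.add_apply, Measure.toSignedMeasure_apply_measurable measurableSet_Iic,
      withDensityᵥ_apply h.integrable measurableSet_Iic, h.integral_Iic, hreal _ measurableSet_Iic]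
    rcases lt_or_ge a T₀ with ha | ha
    · rw [h.extendPath_of_lt ha, h.integral_of_le ha.le]
      simp [ha]
    · rw [h.extendPath_of_ge ha]
      simp [ha]
  · rw [BorelSpace.measurable_eq (α := ℝ), borel_eq_generateFrom_Iic]
  · rw [h.isPath.pathMeasure_eq, hbv.vectorMeasure_univ, hbot, htop, sub_zero,
      _root_.add_apply, Measure.toSignedMeasure_apply_measurable MeasurableSet.univ,
      withDensityᵥ_apply h.integrable MeasurableSet.univ, hreal _ MeasurableSet.univ,
      intervalIntegral.integral_of_le h.lt.le,
      setIntegral_eq_of_subset_of_forall_sdiff_eq_zero MeasurableSet.univ (subset_univ _)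
        fun s hs => h.eq_zero s hs.2]
    simp

lemma mutuallySingular_dirac {j T₀ : ℝ} :
    (j.toNNReal • Measure.dirac T₀).toSignedMeasure ⟂ᵥ
      (volume : Measure ℝ).toENNRealVectorMeasure := by
  refine VectorMeasure.MutuallySingular.mk {T₀}ᶜ (measurableSet_singleton T₀).compl ?_ ?_
  · intro A hA hAm
    rw [Measure.toSignedMeasure_apply_measurable hAm, measureReal_nnreal_smul_apply,
      measureReal_def, Measure.dirac_apply' _ hAm]
    have : T₀ ∉ A := fun h => hA h rfl
    simp [this]
  · intro A hA hAm
    rw [Measure.toENNRealVectorMeasure_apply_measurable hAm]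
    exact measure_mono_null (by simpa using hA) (measure_singleton T₀)

lemma acSlope_ae_eq (h : IsProfile ψ b j T₀ T₁) : acSlope ψ =ᵐ[volume] b :=
  (SignedMeasure.eq_rnDeriv _ b h.integrable mutuallySingular_dirac h.pathMeasure_eq).symm

lemma jordan (h : IsProfile ψ b j T₀ T₁) :
    ((pathMeasure ψ).singularPart volume).toJordanDecomposition =
      ⟨j.toNNReal • Measure.dirac T₀, 0, Measure.MutuallySingular.zero_right⟩ := by
  rw [← SignedMeasure.eq_singularPart _ b mutuallySingular_dirac h.pathMeasure_eq]
  refine SignedMeasure.toJordanDecomposition_eq ?_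
  simp [JordanDecomposition.toSignedMeasure]

lemma upMeasure_eq (h : IsProfile ψ b j T₀ T₁) :
    upMeasure ψ = j.toNNReal • Measure.dirac T₀ := by
  rw [upMeasure, h.jordan]

lemma downMeasure_eq (h : IsProfile ψ b j T₀ T₁) : downMeasure ψ = 0 := by
  rw [downMeasure, h.jordan]

lemma upMeasure_Icc (h : IsProfile ψ b j T₀ T₁) (ht : T₀ ≤ t) :
    upMeasure ψ (Icc 0 t) = ENNReal.ofReal j := by
  rw [h.upMeasure_eq, Measure.smul_apply, Measure.dirac_apply' _ measurableSet_Icc]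
  simp [h.T₀_nonneg, ht, ENNReal.smul_def, ENNReal.ofReal]

lemma deriv_ae_eq (h : IsProfile ψ b j T₀ T₁) :
    ∀ᵐ t, t ∈ Ioo T₀ T₁ → deriv ψ t = b t := by
  filter_upwards [LocallyIntegrable.ae_hasDerivAt_integral h.integrable.locallyIntegrable] with t ht hmem
  refine HasDerivAt.deriv (((ht T₀).const_add j).congr_of_eventuallyEq ?_)
  filter_upwards [Ioo_mem_nhds hmem.1 hmem.2] with s hs
  rw [← h.extendPath_of_ge hs.1.le,
    extendPath_of_mem ⟨h.T₀_nonneg.trans hs.1.le, hs.2.le.trans h.T₁_le_one⟩]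

lemma discontinuity (h : IsProfile ψ b j T₀ T₁) (ht : IsDiscontinuity ψ t) :
    t = T₀ ∧ j ≠ 0 := by
  refine ⟨?_, fun hj => ht.2 (h.continuousAt_of_jump_eq_zero hj)⟩
  by_contra hne
  exact ht.2 (h.continuousAt hne)

lemma apply_of_mem (h : IsProfile ψ b j T₀ T₁) (ht : t ∈ Icc T₀ 1) :
    ψ t = j + ∫ s in T₀..t, b s := by
  rw [← h.extendPath_of_ge ht.1, extendPath_of_mem ⟨h.T₀_nonneg.trans ht.1, ht.2⟩]

lemma apply_of_lt (h : IsProfile ψ b j T₀ T₁) (ht : t ∈ Ico 0 T₀) : ψ t = 0 := by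
  rw [← h.extendPath_of_lt ht.2,
    extendPath_of_mem ⟨ht.1, (ht.2.le.trans h.lt.le).trans h.T₁_le_one⟩]

lemma apply_of_gt (h : IsProfile ψ b j T₀ T₁) (hend : T₁ < 1 → ψ T₁ = 0) (ht : t ∈ Ioc T₁ 1) :
    ψ t = 0 := by
  rw [h.apply_of_mem ⟨h.lt.le.trans ht.1.le, ht.2⟩, h.integral_of_ge ht.1.le,
    ← h.apply_of_mem ⟨h.lt.le, h.T₁_le_one⟩, hend (ht.1.trans_le ht.2)]

lemma integral_eq (h : IsProfile ψ b j T₀ T₁) (hend : T₁ < 1 → ψ T₁ = 0) :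
    ∫ s in (0 : ℝ)..1, ψ s = ∫ s in T₀..T₁, ψ s := by
  rw [intervalIntegral.integral_of_le zero_le_one, intervalIntegral.integral_of_le h.lt.le,
    ← integral_Icc_eq_integral_Ioc, ← integral_Icc_eq_integral_Ioc]
  refine setIntegral_eq_of_subset_of_forall_sdiff_eq_zero measurableSet_Icc
    (Icc_subset_Icc h.T₀_nonneg h.T₁_le_one) fun s hs => ?_
  rcases lt_or_ge s T₀ with h1 | h1
  · exact h.apply_of_lt ⟨hs.1.1, h1⟩
  · exact h.apply_of_gt hend ⟨by by_contra! h2; exact hs.2 ⟨h1, h2⟩, hs.1.2⟩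

lemma J_eq (h : IsProfile ψ b j T₀ T₁) (hδ : 0 < δ) (hzero : I (-δ) = 0)
    (hend : T₁ < 1 → ψ T₁ = 0) (hpos : ∀ t ∈ Ioo T₀ T₁, 0 < ψ t) :
    J I ψ = (∫⁻ s in Ioc T₀ T₁, I (b s)) + thetaUp I * ENNReal.ofReal j := by
  have hset : positiveSet ψ =ᵐ[volume] Ioc T₀ T₁ := by
    have hne : ∀ c : ℝ, ∀ᵐ x : ℝ, x ≠ c := fun c => by simp [ae_iff]
    refine eventuallyEq_set.2 ?_
    filter_upwards [hne T₀, hne T₁] with s h0 h1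
    constructor
    · intro hs
      refine ⟨lt_of_not_ge fun h2 => ?_, le_of_not_gt fun h2 => ?_⟩
      · exact hs.2.ne' (h.apply_of_lt ⟨hs.1.1, h2.lt_of_ne h0⟩)
      · exact hs.2.ne' (h.apply_of_gt hend ⟨h2, hs.1.2⟩)
    · intro hs
      exact ⟨⟨h.T₀_nonneg.trans hs.1.le, hs.2.trans h.T₁_le_one⟩,
        hpos s ⟨hs.1, hs.2.lt_of_ne h1⟩⟩
  rw [h.isPath.J_eq hδ hzero, h.downMeasure_eq,
    h.upMeasure_Icc (h.lt.le.trans h.T₁_le_one), setLIntegral_congr hset]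
  have h1 : ∀ᵐ s ∂(volume.restrict (Ioc T₀ T₁)), I (acSlope ψ s) = I (b s) := by
    filter_upwards [ae_restrict_of_ae h.acSlope_ae_eq] with s hs
    rw [hs]
  rw [lintegral_congr_ae h1]
  simp

end IsProfile

end RRW

/-! ### Potential solutions are feasible concave profiles -/

namespace RRW

variable {I : ℝ → ℝ≥0∞} {δ z j T₀ T₀₀ T₁ t lam : ℝ} {ψ b : ℝ → ℝ}

lemma IsProfile.sub_eq_integral (h : IsProfile ψ b j T₀ T₁) {s t : ℝ} (hs : T₀ ≤ s) (hst : s ≤ t)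
    (ht : t ≤ 1) : ψ t - ψ s = ∫ u in s..t, b u := by
  rw [h.apply_of_mem ⟨hs.trans hst, ht⟩, h.apply_of_mem ⟨hs, hst.trans ht⟩,
    ← intervalIntegral.integral_add_adjacent_intervals (b := s) h.integrable.intervalIntegrable
      h.integrable.intervalIntegrable]
  ring

lemma IsProfile.le_sub (h : IsProfile ψ b j T₀ T₁) {s t c : ℝ} (hs : T₀ ≤ s) (hst : s ≤ t)
    (ht : t ≤ 1) (hc : ∀ u ∈ Ioo s t, c ≤ b u) : c * (t - s) ≤ ψ t - ψ s := by
  rw [h.sub_eq_integral hs hst ht]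
  have h1 : ∫ u in s..t, c ≤ ∫ u in s..t, b u :=
    intervalIntegral.integral_mono_on_of_le_Ioo hst intervalIntegrable_const
      h.integrable.intervalIntegrable hc
  simpa [mul_comm] using h1

lemma IsProfile.sub_le (h : IsProfile ψ b j T₀ T₁) {s t c : ℝ} (hs : T₀ ≤ s) (hst : s ≤ t)
    (ht : t ≤ 1) (hc : ∀ u ∈ Ioo s t, b u ≤ c) : ψ t - ψ s ≤ c * (t - s) := by
  rw [h.sub_eq_integral hs hst ht]
  have h1 : ∫ u in s..t, b u ≤ ∫ u in s..t, c :=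
    intervalIntegral.integral_mono_on_of_le_Ioo hst h.integrable.intervalIntegrable
      intervalIntegrable_const hc
  simpa [mul_comm] using h1

/-- A concave profile of positive area is positive between its endpoints. -/
lemma IsProfile.pos_of_antitoneOn (h : IsProfile ψ b j T₀ T₁) (hb : AntitoneOn b (Ioo T₀ T₁))
    (hz : ∫ s in T₀..T₁, ψ s ≠ 0) : ∀ t ∈ Ioo T₀ T₁, 0 < ψ t := by
  intro t ht
  have h01 : ∀ s ∈ Icc T₀ T₁, s ∈ Icc (0 : ℝ) 1 := fun s hs =>
    ⟨h.T₀_nonneg.trans hs.1, hs.2.trans h.T₁_le_one⟩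
  refine (h.nonneg t (h01 t ⟨ht.1.le, ht.2.le⟩)).lt_of_ne' fun h0 => hz ?_
  have ht1 := ht.2.le.trans h.T₁_le_one
  have hleft : ∀ u ∈ Ioo T₀ t, b t ≤ b u := fun u hu => hb ⟨hu.1, hu.2.trans ht.2⟩ ht hu.2.le
  have hright : ∀ u ∈ Ioo t T₁, b u ≤ b t := fun u hu => hb ht ⟨ht.1.trans hu.1, hu.2⟩ hu.1.le
  have hbt : b t = 0 := by
    -- A positive slope at an interior zero t would, by concavity, make the path negative at T₀; a
    -- negative one would make it negative at T₁.
    apply le_antisymm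
    · have h1 := h.le_sub le_rfl ht.1.le ht1 hleft
      have h2 := h.nonneg T₀ (h01 T₀ ⟨le_rfl, h.lt.le⟩)
      by_contra! hlt
      nlinarith [mul_pos hlt (sub_pos.2 ht.1)]
    · have h1 := h.sub_le ht.1.le ht.2.le h.T₁_le_one hright
      have h2 := h.nonneg T₁ (h01 T₁ ⟨h.lt.le, le_rfl⟩)
      by_contra! hlt
      nlinarith [mul_neg_of_neg_of_pos hlt (sub_pos.2 ht.2)]
  have hz' : ∀ s ∈ Icc T₀ T₁, ψ s = 0 := by
    intro s hs
    refine le_antisymm ?_ (h.nonneg s (h01 s hs))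
    rcases le_total s t with hst | hst
    · have := h.le_sub hs.1 hst ht1 (fun u hu => hleft u ⟨hs.1.trans_lt hu.1, hu.2⟩)
      rw [hbt, zero_mul] at this
      linarith
    · have := h.sub_le ht.1.le hst (hs.2.trans h.T₁_le_one)
        (fun u hu => hright u ⟨hu.1, hu.2.trans_le hs.2⟩)
      rw [hbt, zero_mul] at this
      linarith
  rw [intervalIntegral.integral_congr (g := fun _ => 0)
    fun s hs => hz' s (by rwa [uIcc_of_le h.lt.le] at hs)]
  simp

namespace IsPotentialSolution

lemma eq_T₀_of_discontinuity (h : IsPotentialSolution I δ z ψ T₀ T₀₀ T₁)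
    (ht : IsDiscontinuity ψ t) : t = T₀ := by
  by_cases hc : NonCoercive I
  · exact absurd ht ((h.nonCoercive hc).2 t)
  · by_cases htop : thetaUp I = ⊤
    · exact absurd ht ((h.coercive_noJump hc htop).2 t)
    · exact (h.coercive_jump hc (lt_top_iff_ne_top.2 htop)).2 t ht

lemma nonCoercive_of_lt (h : IsPotentialSolution I δ z ψ T₀ T₀₀ T₁) (hlt : T₀ < T₀₀) :
    NonCoercive I := by
  by_contra hc
  by_cases htop : thetaUp I = ⊤
  · exact hlt.ne' (h.coercive_noJump hc htop).1
  · exact hlt.ne' (h.coercive_jump hc (lt_top_iff_ne_top.2 htop)).1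

lemma apply_T₀_eq_zero (h : IsPotentialSolution I δ z ψ T₀ T₀₀ T₁) (htop : thetaUp I = ⊤) :
    ψ T₀ = 0 := by
  have hmem : T₀ ∈ Icc (0 : ℝ) 1 := ⟨h.T₀_nonneg, h.T₀_lt_T₁.le.trans h.T₁_le_one⟩
  have hd : ¬ IsDiscontinuity ψ T₀ := by
    by_cases hc : NonCoercive I
    · exact (h.nonCoercive hc).2 T₀
    · exact (h.coercive_noJump hc htop).2 T₀
  have hcont : ContinuousAt (extendPath ψ) T₀ := by
    by_contra hcont
    exact hd ⟨hmem, hcont⟩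
  rw [← extendPath_of_mem (ψ := ψ) hmem]
  refine tendsto_nhds_unique (hcont.tendsto.mono_left (nhdsWithin_le_nhds (s := Iio T₀)))
    (tendsto_const_nhds.congr' ?_)
  filter_upwards [self_mem_nhdsWithin] with s hs
  rcases lt_or_ge s 0 with h0 | h0
  · exact (extendPath_of_neg h0).symm
  · rw [extendPath_of_mem ⟨h0, (le_of_lt hs).trans hmem.2⟩, h.support s (Or.inl ⟨h0, hs⟩)]

lemma continuousOn (h : IsPotentialSolution I δ z ψ T₀ T₀₀ T₁) :
    ContinuousOn ψ (Icc T₀ T₁) := by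
  have h01 : ∀ s ∈ Icc T₀ T₁, s ∈ Icc (0 : ℝ) 1 := fun s hs =>
    ⟨h.T₀_nonneg.trans hs.1, hs.2.trans h.T₁_le_one⟩
  have h1 : ContinuousOn (extendPath ψ) (Icc T₀ T₁) := by
    intro t ht
    rcases ht.1.eq_or_lt with h0 | h0
    · rw [← h0]
      exact (h.path.continuousWithinAt_Ici T₀).mono Icc_subset_Ici_self
    · refine ContinuousAt.continuousWithinAt ?_
      by_contra hc
      exact h0.ne' (h.eq_T₀_of_discontinuity ⟨h01 t ht, hc⟩)
  exact h1.congr fun s hs => (extendPath_of_mem (h01 s hs)).symm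

/-- A potential solution is a concave profile whose slopes solve the optimality condition. -/
lemma exists_profile (h : IsPotentialSolution I δ z ψ T₀ T₀₀ T₁) (hI : IsGoodConvexRate I)
    (hzero : I (-δ) = 0) : ∃ b lam : ℝ → ℝ, IsProfile ψ b (ψ T₀) T₀ T₁ ∧
      AntitoneOn b (Ioo T₀ T₁) ∧ (∀ s ∈ Ioc T₀ T₀₀, s < T₁ → b s = (rbar I).toReal) ∧
      (∃ c, ∀ s ∈ Ioo T₀₀ T₁, lam s ≤ c ∧ 0 < lam s ∧ Supports I (lam s) (b s)) := by
  obtain ⟨lam, hlam, hgrad⟩ := h.gradient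
  choose! v w hv using hgrad
  have hT0 : T₀ ≤ T₀₀ := h.T₀₀_mem.1
  have hT1 : T₀₀ ≤ T₁ := h.T₀₀_mem.2
  have h01 : ∀ s ∈ Icc T₀ T₁, s ∈ Icc (0 : ℝ) 1 := fun s hs =>
    ⟨h.T₀_nonneg.trans hs.1, hs.2.trans h.T₁_le_one⟩
  have hpos : ∀ s ∈ Ioo T₀₀ T₁, 0 < lam * (T₁ - s) := fun s hs =>
    mul_pos hlam (sub_pos.2 hs.2)
  have hw : ∀ s ∈ Ioo T₀₀ T₁, Supports I (lam * (T₁ - s)) (w s) := fun s hs =>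
    (hv s hs).2.2.2.supports hI
  -- The density is taken to be the right derivative, the form needed by the one-sided fundamental
  -- theorem of calculus; at corners it may differ from the left one.
  set b : ℝ → ℝ := fun s => if s ∈ Ioo T₀₀ T₁ then w s else
    if s ∈ Ioc T₀ T₀₀ then (rbar I).toReal else 0 with hbdef
  have hb1 : ∀ s ∈ Ioo T₀₀ T₁, b s = w s := fun s hs => if_pos hs
  have hb2 : ∀ s ∈ Ioc T₀ T₀₀, b s = (rbar I).toReal := fun s hs => by
    rw [hbdef]
    dsimp only
    rw [if_neg (fun hs' => not_lt.2 hs.2 hs'.1), if_pos hs]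
  have hb0 : ∀ s, s ∉ Ioc T₀ T₁ → b s = 0 := fun s hs => by
    rw [hbdef]
    dsimp only
    rw [if_neg (fun hs' => hs ⟨hT0.trans_lt hs'.1, hs'.2.le⟩),
      if_neg (fun hs' => hs ⟨hs'.1, hs'.2.trans hT1⟩)]
  have hwle : ∀ s ∈ Ioo T₀₀ T₁, T₀ < T₀₀ → w s ≤ (rbar I).toReal := by
    intro s hs hlt
    obtain ⟨r, hr, -⟩ := (h.nonCoercive_of_lt hlt).exists_rbar hI
    have := coe_le_rbar (hw s hs).1
    rw [hr] at this ⊢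
    exact_mod_cast this
  have hanti : AntitoneOn b (Ioo T₀ T₁) := by
    intro s hs t ht hst
    rcases hst.eq_or_lt with rfl | hst
    · exact le_rfl
    rcases lt_or_ge T₀₀ s with h1 | h1
    · rw [hb1 s ⟨h1, hs.2⟩, hb1 t ⟨h1.trans hst, ht.2⟩]
      refine (hw t ⟨h1.trans hst, ht.2⟩).le_of_lt (hw s ⟨h1, hs.2⟩) ?_
      exact mul_lt_mul_of_pos_left (by linarith) hlam
    · rw [hb2 s ⟨hs.1, h1⟩]
      rcases lt_or_ge T₀₀ t with h2 | h2
      · rw [hb1 t ⟨h2, ht.2⟩]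
        exact hwle t ⟨h2, ht.2⟩ (hs.1.trans_le h1)
      · rw [hb2 t ⟨ht.1, h2⟩]
  have hcont := h.continuousOn
  have hcont1 : ContinuousOn ψ (Icc T₀₀ T₁) := hcont.mono (Icc_subset_Icc_left hT0)
  have hcont0 : ContinuousOn ψ (Icc T₀ T₀₀) := hcont.mono (Icc_subset_Icc_right hT1)
  have hder1 : ∀ s ∈ Ioo T₀₀ T₁, HasDerivWithinAt ψ (b s) (Ioi s) s := fun s hs => by
    rw [hb1 s hs]
    exact (hv s hs).2.1.mono Ioi_subset_Ici_self
  have hint1 : IntegrableOn b (Ioc T₀₀ T₁) := by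
    -- Positive multipliers give slopes at least −δ, so ψ + δs has non-negative right derivative,
    -- which is automatically integrable.
    have h1 : IntegrableOn (fun s => b s + δ) (Ioc T₀₀ T₁) := by
      refine intervalIntegral.integrableOn_deriv_right_of_nonneg
        (g := fun s => ψ s + δ * s) (hcont1.add (by fun_prop)) (fun s hs => ?_) fun s hs => ?_
      · simpa using (hder1 s hs).fun_add (((hasDerivAt_id s).const_mul δ).hasDerivWithinAt)
      · rw [hb1 s hs]
        linarith [(hw s hs).neg_le hzero (hpos s hs)]
    have h2 := h1.sub (integrableOn_const (C := δ) measure_Ioc_lt_top.ne)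
    refine h2.congr (Eventually.of_forall fun s => ?_)
    simp
  have hint0 : IntegrableOn b (Ioc T₀ T₀₀) :=
    (integrableOn_const (C := (rbar I).toReal) measure_Ioc_lt_top.ne).congr_fun
      (fun s hs => (hb2 s hs).symm) measurableSet_Ioc
  have hint : Integrable b := by
    have h1 : IntegrableOn b (Ioc T₀ T₁) := by
      rw [← Ioc_union_Ioc_eq_Ioc hT0 hT1]
      exact hint0.union hint1
    exact (integrableOn_iff_integrable_of_support_subset fun s hs => by
      by_contra h2
      exact hs (hb0 s h2)).1 h1
  have hftc0 : ∀ t ∈ Icc T₀ T₀₀, ψ t - ψ T₀ = ∫ s in T₀..t, b s := by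
    intro t ht
    refine (intervalIntegral.integral_eq_sub_of_hasDeriv_right_of_le ht.1
      (hcont0.mono (Icc_subset_Icc_right ht.2)) (fun s hs => ?_) hint.intervalIntegrable).symm
    have hlt : s < T₀₀ := hs.2.trans_le ht.2
    rw [hb2 s ⟨hs.1, hlt.le⟩]
    have h1 := (h.nonCoercive (h.nonCoercive_of_lt (hs.1.trans hlt))).1 s ⟨hs.1.le, hlt⟩
    exact h1.mono_of_mem_nhdsWithin (mem_of_superset (Ioo_mem_nhdsGT hlt)
      fun x hx => ⟨hs.1.le.trans hx.1.le, hx.2.le⟩)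
  have hftc1 : ∀ t ∈ Icc T₀₀ T₁, ψ t - ψ T₀₀ = ∫ s in T₀₀..t, b s := fun t ht =>
    (intervalIntegral.integral_eq_sub_of_hasDeriv_right_of_le ht.1
      (hcont1.mono (Icc_subset_Icc_right ht.2))
      (fun s hs => hder1 s ⟨hs.1, hs.2.trans_le ht.2⟩) hint.intervalIntegrable).symm
  have hftc : ∀ t ∈ Icc T₀ T₁, ψ t = ψ T₀ + ∫ s in T₀..t, b s := by
    intro t ht
    rcases le_total t T₀₀ with h1 | h1
    · linarith [hftc0 t ⟨ht.1, h1⟩]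
    · rw [← intervalIntegral.integral_add_adjacent_intervals (b := T₀₀)
        hint.intervalIntegrable hint.intervalIntegrable]
      linarith [hftc0 T₀₀ ⟨hT0, le_rfl⟩, hftc1 t ⟨h1, ht.2⟩]
  have hafter : ∀ t, T₁ ≤ t → ∫ s in T₀..t, b s = ∫ s in T₀..T₁, b s := by
    intro t ht
    rw [← intervalIntegral.integral_add_adjacent_intervals (b := T₁) hint.intervalIntegrable
      hint.intervalIntegrable, intervalIntegral.integral_of_le ht,
      setIntegral_eq_zero_of_forall_eq_zero (t := Ioc T₁ t), add_zero]
    exact fun s hs => hb0 s fun hs' => not_lt.2 hs'.2 hs.1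
  have heq : ∀ t, t ≤ 1 → extendPath ψ t = if t < T₀ then 0 else ψ T₀ + ∫ s in T₀..t, b s := by
    intro t ht1
    split_ifs with ht
    · rcases lt_or_ge t 0 with h0 | h0
      · exact extendPath_of_neg h0
      · rw [extendPath_of_mem ⟨h0, ht1⟩, h.support t (Or.inl ⟨h0, ht⟩)]
    · push Not at ht
      rw [extendPath_of_mem ⟨h.T₀_nonneg.trans ht, ht1⟩]
      rcases le_or_gt t T₁ with h1 | h1
      · exact hftc t ⟨ht, h1⟩
      · rw [hafter t h1.le, ← hftc T₁ ⟨h.T₀_lt_T₁.le, le_rfl⟩,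
          h.final_value (h1.trans_le ht1), h.support t (Or.inr ⟨h1, ht1⟩)]
  refine ⟨b, fun s => lam * (T₁ - s), ⟨h.T₀_nonneg, h.T₀_lt_T₁, h.T₁_le_one,
    h.path.nonneg _ (h01 _ ⟨le_rfl, h.T₀_lt_T₁.le⟩), hint, hb0, fun t => ?_, h.path.nonneg⟩,
    hanti, fun s hs _ => hb2 s hs, lam * (T₁ - T₀₀), fun s hs => ⟨?_, hpos s hs, ?_⟩⟩
  · rcases le_total t 1 with ht | ht
    · exact heq t ht
    · have h1 := heq 1 le_rfl
      rw [if_neg (not_lt.2 (h.T₀_lt_T₁.le.trans h.T₁_le_one)), hafter 1 h.T₁_le_one] at h1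
      rw [extendPath_of_one_le ht, ← extendPath_of_one_le (ψ := ψ) (le_refl (1 : ℝ)), h1,
        if_neg (not_lt.2 ((h.T₀_lt_T₁.le.trans h.T₁_le_one).trans ht)),
        hafter t (h.T₁_le_one.trans ht)]
  · exact mul_le_mul_of_nonneg_left (by linarith [hs.1]) hlam.le
  · rw [hb1 s hs]
    exact hw s hs

/-- A concave profile of positive area is positive inside (T₀,T₁), so J charges exactly that
interval and the jump. The cost is finite because the supporting line evaluated at −δ gives I(b) ≤
λ*(T₁ − s)(b + δ), an integrable bound. -/
theorem feasible_and_cost (h : IsPotentialSolution I δ z ψ T₀ T₀₀ T₁) (hI : IsGoodConvexRate I)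
    (hδ : 0 < δ) (hzero : I (-δ) = 0) (hz : 0 < z) :
    Feasible z ψ ∧ J I ψ = reducedCost I ψ T₀ T₀₀ T₁ ∧ J I ψ < ⊤ := by
  obtain ⟨b, lam, hb, hanti, hbr, c, hsup⟩ := h.exists_profile hI hzero
  have hT0 : T₀ ≤ T₀₀ := h.T₀₀_mem.1
  have hT1 : T₀₀ ≤ T₁ := h.T₀₀_mem.2
  have hne : ∀ c : ℝ, ∀ᵐ x : ℝ, x ≠ c := fun c => by simp [ae_iff]
  have hJ := hb.J_eq hδ hzero h.final_value
    (hb.pos_of_antitoneOn hanti (by rw [h.area]; exact hz.ne'))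
  have hsplit : ∫⁻ s in Ioc T₀ T₁, I (b s) =
      (∫⁻ s in Ioc T₀ T₀₀, I (b s)) + ∫⁻ s in Ioc T₀₀ T₁, I (b s) := by
    rw [← Ioc_union_Ioc_eq_Ioc hT0 hT1, lintegral_union measurableSet_Ioc]
    exact Set.disjoint_left.2 fun s hs hs' => not_lt.2 hs.2 hs'.1
  have h1 : ∫⁻ s in Ioc T₀ T₀₀, I (b s) =
      I (rbar I).toReal * ENNReal.ofReal (T₀₀ - T₀) := by
    rw [← Real.volume_Ioc, ← setLIntegral_const]
    refine setLIntegral_congr_fun_ae measurableSet_Ioc ?_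
    filter_upwards [hne T₁] with s hs1 hs
    rw [hbr s hs ((hs.2.trans hT1).lt_of_ne hs1)]
  have h2 : ∫⁻ s in Ioc T₀₀ T₁, I (b s) = ∫⁻ s in Ioc T₀₀ T₁, I (deriv ψ s) := by
    refine setLIntegral_congr_fun_ae measurableSet_Ioc ?_
    filter_upwards [hne T₁, hb.deriv_ae_eq] with s hs1 hs hs2
    rw [hs ⟨hT0.trans_lt hs2.1, hs2.2.lt_of_ne hs1⟩]
  have h3 : ∫⁻ s in Ioc T₀₀ T₁, I (b s) < ⊤ := by
    have h4 : ∀ᵐ s ∂(volume.restrict (Ioc T₀₀ T₁)), I (b s) ≤ ENNReal.ofReal (c * (b s + δ)) := by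
      rw [ae_restrict_iff' measurableSet_Ioc]
      filter_upwards [hne T₁] with s hs1 hs
      obtain ⟨hc, hl, hs'⟩ := hsup s ⟨hs.1, hs.2.lt_of_ne hs1⟩
      rw [← ENNReal.ofReal_toReal hs'.1.ne]
      refine ENNReal.ofReal_le_ofReal ((hs'.toReal_le hzero).trans ?_)
      exact mul_le_mul_of_nonneg_right hc (by linarith [hs'.neg_le hzero hl])
    refine (lintegral_mono_ae h4).trans_lt ?_
    have h5 : IntegrableOn (fun s => c * (b s + δ)) (Ioc T₀₀ T₁) :=
      (hb.integrable.integrableOn.add (integrableOn_const measure_Ioc_lt_top.ne)).const_mul c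
    exact h5.lintegral_lt_top
  have h4 : I (rbar I).toReal * ENNReal.ofReal (T₀₀ - T₀) < ⊤ := by
    rcases hT0.eq_or_lt with h5 | h5
    · simp [h5]
    · obtain ⟨r, hr, hr'⟩ := (h.nonCoercive_of_lt h5).exists_rbar hI
      rw [hr]
      exact ENNReal.mul_lt_top hr' ENNReal.ofReal_lt_top
  have h5 : thetaUp I * ENNReal.ofReal (ψ T₀) < ⊤ := by
    by_cases htop : thetaUp I = ⊤
    · simp [h.apply_T₀_eq_zero htop]
    · exact ENNReal.mul_lt_top (lt_top_iff_ne_top.2 htop) ENNReal.ofReal_lt_top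
  have hcost : J I ψ = reducedCost I ψ T₀ T₀₀ T₁ := by
    rw [hJ, hsplit, h1, h2, reducedCost, upPart_eq, hb.upMeasure_Icc le_rfl, mul_comm (thetaUp I)]
  refine ⟨⟨h.path, ?_⟩, hcost, ?_⟩
  · rw [hb.integral_eq h.final_value, h.area]
  · rw [hJ, hsplit, h1]
    exact ENNReal.add_lt_top.2 ⟨ENNReal.add_lt_top.2 ⟨h4, h3⟩, h5⟩

end IsPotentialSolution

end RRW

/-! ### From optimal slopes to potential solutions -/

namespace RRW

variable {I : ℝ → ℝ≥0∞} {δ z j T₀ T₁ t lam c : ℝ} {ψ b : ℝ → ℝ}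

lemma IsProfile.hasDerivWithinAt_left (h : IsProfile ψ b j T₀ T₁) (ht : t ∈ Ioc T₀ T₁)
    (hb : Tendsto b (𝓝[<] t) (𝓝 c)) : HasDerivWithinAt ψ c (Iic t) t := by
  have h1 : Tendsto b (𝓝[≤] t ⊓ ae volume) (𝓝 c) := by
    -- Deleting the null set {t} turns 𝓝[≤] into 𝓝[<], so the value of b at t itself is irrelevant.
    refine hb.mono_left ?_
    have h2 : ae (volume : Measure ℝ) ≤ 𝓟 {t}ᶜ := by
      rw [le_principal_iff, mem_ae_iff, compl_compl]
      exact measure_singleton t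
    refine (inf_le_inf_left _ h2).trans ?_
    rw [nhdsWithin, inf_assoc, inf_principal]
    refine inf_le_inf_left _ (principal_mono.2 ?_)
    rintro s ⟨hs1, hs2⟩
    exact lt_of_le_of_ne hs1 hs2
  have h3 : HasDerivWithinAt (fun u => ∫ s in T₀..u, b s) c (Iic t) t :=
    intervalIntegral.integral_hasDerivWithinAt_of_tendsto_ae_right
      h.integrable.intervalIntegrable
      h.integrable.aestronglyMeasurable.stronglyMeasurableAtFilter h1
  refine (h3.const_add j).congr_of_eventuallyEq ?_
    (h.apply_of_mem ⟨ht.1.le, ht.2.trans h.T₁_le_one⟩)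
  filter_upwards [Ioc_mem_nhdsLE ht.1] with s hs
  exact h.apply_of_mem ⟨hs.1.le, (hs.2.trans ht.2).trans h.T₁_le_one⟩

lemma IsProfile.hasDerivWithinAt_right (h : IsProfile ψ b j T₀ T₁) (ht : t ∈ Ico T₀ T₁)
    (hb : Tendsto b (𝓝[>] t) (𝓝 c)) : HasDerivWithinAt ψ c (Ici t) t := by
  have h3 : HasDerivWithinAt (fun u => ∫ s in T₀..u, b s) c (Ici t) t :=
    intervalIntegral.integral_hasDerivWithinAt_of_tendsto_ae_right
      h.integrable.intervalIntegrable
      h.integrable.aestronglyMeasurable.stronglyMeasurableAtFilter (hb.mono_left inf_le_left)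
  refine (h3.const_add j).congr_of_eventuallyEq ?_
    (h.apply_of_mem ⟨ht.1, ht.2.le.trans h.T₁_le_one⟩)
  filter_upwards [Ico_mem_nhdsGE ht.2] with s hs
  exact h.apply_of_mem ⟨ht.1.trans hs.1, hs.2.le.trans h.T₁_le_one⟩

lemma tendsto_reverse_left (hlam : 0 < lam) (t : ℝ) :
    Tendsto (fun s => lam * (T₁ - s)) (𝓝[<] t) (𝓝[>] (lam * (T₁ - t))) := by
  refine tendsto_nhdsWithin_iff.2 ⟨?_, ?_⟩
  · have : Continuous fun s => lam * (T₁ - s) := by fun_prop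
    exact (this.tendsto t).mono_left nhdsWithin_le_nhds
  · filter_upwards [self_mem_nhdsWithin] with s hs
    have hs : s < t := hs
    exact mul_lt_mul_of_pos_left (by linarith) hlam

lemma tendsto_reverse_right (hlam : 0 < lam) (t : ℝ) :
    Tendsto (fun s => lam * (T₁ - s)) (𝓝[>] t) (𝓝[<] (lam * (T₁ - t))) := by
  refine tendsto_nhdsWithin_iff.2 ⟨?_, ?_⟩
  · have : Continuous fun s => lam * (T₁ - s) := by fun_prop
    exact (this.tendsto t).mono_left nhdsWithin_le_nhds
  · filter_upwards [self_mem_nhdsWithin] with s hs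
    have hs : t < s := hs
    exact mul_lt_mul_of_pos_left (by linarith) hlam

/-- A profile whose slope at time `s` is the maximiser at `λ (T₁ - s)` is a potential solution. -/
theorem IsProfile.exists_isPotentialSolution (h : IsProfile ψ b j T₀ T₁)
    (hI : IsGoodConvexRate I) (hδ : 0 < δ) (hzero : I (-δ) = 0)
    (hpos : ∀ y : ℝ, -δ < y → 0 < I y)
    (hgrad : ∀ y : ℝ, -δ ≤ y → (y : EReal) < rbar I → ∃ g : ℝ, HasGradAt I y g)
    (hlam : 0 < lam) (hup : ENNReal.ofReal (lam * (T₁ - T₀)) ≤ thetaUp I)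
    (hb : ∀ s ∈ Ioo T₀ T₁, b s = tilt I δ (lam * (T₁ - s)))
    (hend : T₁ < 1 → ψ T₁ = 0) (harea : ∫ s in (0 : ℝ)..1, ψ s = z)
    (hj : thetaUp I = ⊤ → j = 0) :
    ∃ T₀₀, IsPotentialSolution I δ z ψ T₀ T₀₀ T₁ := by
  have hdom : ∀ s ∈ Ioo T₀ T₁, lam * (T₁ - s) ∈ tiltDomain I := fun s hs =>
    mem_tiltDomain_of_lt hup (mul_nonneg hlam.le (by linarith [hs.2]))
      (mul_lt_mul_of_pos_left (by linarith [hs.1]) hlam)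
  have hlpos : ∀ s ∈ Ioo T₀ T₁, 0 < lam * (T₁ - s) := fun s hs =>
    mul_pos hlam (by linarith [hs.2])
  have hsup : ∀ s ∈ Ioo T₀ T₁, Supports I (lam * (T₁ - s)) (b s) := fun s hs => by
    rw [hb s hs]
    exact hI.supports_tilt hzero (hdom s hs)
  -- Otherwise every finite slope is at most −δ, so θ↑ = ∞ and there is no jump: a path starting at
  -- 0 would become negative.
  have hrbar : ((-δ : ℝ) : EReal) < rbar I := by
    by_contra! hle
    have h1 : ∀ y, I y < ⊤ → y ≤ -δ := fun y hy => by
      exact_mod_cast (coe_le_rbar hy).trans hle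
    have h2 := h.sub_le le_rfl h.lt.le h.T₁_le_one fun u hu => h1 _ (hsup u hu).1
    have h3 : ψ T₀ = 0 := by
      rw [h.apply_of_mem ⟨le_rfl, h.lt.le.trans h.T₁_le_one⟩, h.integral_of_le le_rfl,
        hj (thetaUp_eq_top_of_forall_le (-δ) h1), add_zero]
    have h4 := h.nonneg T₁ ⟨h.T₀_nonneg.trans h.lt.le, h.T₁_le_one⟩
    nlinarith [mul_pos hδ (sub_pos.2 h.lt)]
  have hle_r : ∀ r : ℝ, rbar I = r → ∀ s ∈ Ioo T₀ T₁, b s ≤ r := fun r hr s hs => by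
    have := coe_le_rbar (hsup s hs).1
    rw [hr] at this
    exact_mod_cast this
  -- T₀⁰ is the last time at which the slope is r̄, or T₀ if there is none. Slopes decrease and
  -- never exceed r̄, so all earlier slopes are r̄ too. In the coercive case I is infinite at r̄, so
  -- the value is never attained.
  obtain ⟨T₀₀, hT₀₀, hcoer, hlt, heq⟩ : ∃ T₀₀ ∈ Icc T₀ T₁, (Coercive I → T₀₀ = T₀) ∧
      (∀ s ∈ Ioo T₀₀ T₁, (b s : EReal) < rbar I) ∧
      ∀ s ∈ Ioo T₀ T₀₀, b s = (rbar I).toReal := by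
    by_cases hc : NonCoercive I
    · obtain ⟨r, hr, -⟩ := hc.exists_rbar hI
      set S : Set ℝ := insert T₀ {s | s ∈ Ioo T₀ T₁ ∧ b s = r} with hS
      have hSne : S.Nonempty := ⟨T₀, mem_insert _ _⟩
      have hSub : ∀ s ∈ S, s ≤ T₁ := by
        rintro s (rfl | hs)
        · exact h.lt.le
        · exact hs.1.2.le
      have hSbdd : BddAbove S := ⟨T₁, hSub⟩
      refine ⟨sSup S, ⟨le_csSup hSbdd (mem_insert _ _), csSup_le hSne hSub⟩,
        fun hc' => absurd hc hc', fun s hs => ?_, fun s hs => ?_⟩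
      · have hs' : s ∈ Ioo T₀ T₁ := ⟨(le_csSup hSbdd (mem_insert _ _)).trans_lt hs.1, hs.2⟩
        rw [hr]
        refine EReal.coe_lt_coe_iff.2 ((hle_r r hr s hs').lt_of_ne fun h1 => ?_)
        exact not_lt.2 (le_csSup hSbdd (mem_insert_of_mem _ ⟨hs', h1⟩)) hs.1
      · have hs' : s ∈ Ioo T₀ T₁ := ⟨hs.1, hs.2.trans_le (csSup_le hSne hSub)⟩
        obtain ⟨u, hu, hsu⟩ := exists_lt_of_lt_csSup hSne hs.2
        rcases hu with rfl | ⟨hu, hur⟩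
        · exact absurd hs.1 (not_lt.2 hsu.le)
        · rw [hr, EReal.toReal_coe]
          refine le_antisymm (hle_r r hr s hs') (hur ▸ ?_)
          exact (hsup u hu).le_of_lt (hsup s hs') (mul_lt_mul_of_pos_left (by linarith) hlam)
    · refine ⟨T₀, ⟨le_rfl, h.lt.le⟩, fun _ => rfl, fun s hs => ?_, fun s hs => ?_⟩
      · exact Coercive.lt_rbar hc hI hzero hrbar (hsup s hs).1
      · exact absurd (hs.1.trans hs.2) (lt_irrefl _)
  have hmono : ∀ s ∈ Ioo T₀₀ T₁, s ∈ Ioo T₀ T₁ := fun s hs => ⟨hT₀₀.1.trans_lt hs.1, hs.2⟩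
  have hgr : ∀ s ∈ Ioo T₀₀ T₁, ∀ v, Supports I (lam * (T₁ - s)) v →
      HasGradAt I v (lam * (T₁ - s)) := by
    intro s hs v hv
    -- Differentiability is known only below r̄. A maximiser at s is at most the slope at any
    -- earlier u in (T₀⁰, s), and that slope is below r̄.
    have h1 : (v : EReal) < rbar I := by
      obtain ⟨u, hu⟩ := exists_between hs.1
      have hu' : u ∈ Ioo T₀₀ T₁ := ⟨hu.1, hu.2.trans hs.2⟩
      refine lt_of_le_of_lt (EReal.coe_le_coe_iff.2 ?_) (hlt u hu')
      exact hv.le_of_lt (hsup u (hmono u hu'))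
        (mul_lt_mul_of_pos_left (by linarith [hu.2]) hlam)
    obtain ⟨g, hg⟩ := hgrad v (hv.neg_le hzero (hlpos s (hmono s hs))) h1
    exact hv.hasGradAt hg
  refine ⟨T₀₀, ⟨h.isPath, h.T₀_nonneg, h.lt, h.T₁_le_one, hT₀₀, ?_, hend, ?_, fun hlt1 => ?_,
    ⟨lam, hlam, fun s hs => ?_⟩, ?_, ?_, ?_⟩⟩
  · rintro s (hs | hs)
    · exact h.apply_of_lt hs
    · exact h.apply_of_gt hend hs
  · rw [← h.integral_eq hend, harea]
  · refine h.hasDerivWithinAt_left ⟨h.lt, le_rfl⟩ ?_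
    have h1 := tendsto_reverse_left (T₁ := T₁) hlam T₁
    rw [sub_self, mul_zero] at h1
    refine ((hI.tendsto_tilt_zero hzero hpos).comp h1).congr' ?_
    filter_upwards [Ioo_mem_nhdsLT h.lt] with s hs using (hb s hs).symm
  · have hs' := hmono s hs
    -- The multiplier λ(T₁ − s) decreases in time, so left derivatives of the path come from right
    -- limits of the subgradient, and conversely. Both limits still support I at the same
    -- multiplier.
    obtain ⟨v, hv1, hv2⟩ := hI.exists_tendsto_tilt_right hzero (hdom s hs')
    obtain ⟨w, hw1, hw2⟩ := hI.exists_tendsto_tilt_left hzero (hdom s hs') (hlpos s hs')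
    refine ⟨v, w, h.hasDerivWithinAt_left ⟨hs'.1, hs'.2.le⟩ ?_,
      h.hasDerivWithinAt_right ⟨hs'.1.le, hs'.2⟩ ?_, hgr s hs v hv2, hgr s hs w hw2⟩
    · refine (hv1.comp (tendsto_reverse_left hlam s)).congr' ?_
      filter_upwards [Ioo_mem_nhdsLT hs'.1] with u hu using (hb u ⟨hu.1, hu.2.trans hs'.2⟩).symm
    · refine (hw1.comp (tendsto_reverse_right hlam s)).congr' ?_
      filter_upwards [Ioo_mem_nhdsGT hs'.2] with u hu using (hb u ⟨hs'.1.trans hu.1, hu.2⟩).symm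
  · exact fun hc htop => ⟨hcoer hc, fun s hs => (h.discontinuity hs).2 (hj htop)⟩
  · exact fun hc _ => ⟨hcoer hc, fun s hs => (h.discontinuity hs).1⟩
  · intro hc
    refine ⟨fun s hs => ?_, fun s hs => (h.discontinuity hs).2 (hj hc.thetaUp_eq_top)⟩
    have h1 : ∀ u ∈ Icc T₀ T₀₀, ψ u = (rbar I).toReal * (u - T₀) := by
      intro u hu
      have hu1 := (hu.2.trans hT₀₀.2).trans h.T₁_le_one
      have h2 := h.sub_eq_integral le_rfl hu.1 hu1
      have h3 : ψ T₀ = 0 := by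
        rw [h.apply_of_mem ⟨le_rfl, hu.1.trans hu1⟩, h.integral_of_le le_rfl,
          hj hc.thetaUp_eq_top, add_zero]
      rw [h3, sub_zero] at h2
      have h4 := h.le_sub le_rfl hu.1 hu1 (c := (rbar I).toReal)
        fun v hv => (heq v ⟨hv.1, hv.2.trans_le hu.2⟩).ge
      have h5 := h.sub_le le_rfl hu.1 hu1 (c := (rbar I).toReal)
        fun v hv => (heq v ⟨hv.1, hv.2.trans_le hu.2⟩).le
      linarith
    have h2 : HasDerivAt (fun u => (rbar I).toReal * (u - T₀)) (rbar I).toReal s := by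
      simpa using ((hasDerivAt_id s).sub_const T₀).const_mul (rbar I).toReal
    exact h2.hasDerivWithinAt.congr h1 (h1 s ⟨hs.1, hs.2.le⟩)

end RRW

/-! ### Complementary slackness forces a single excursion -/

namespace RRW

variable {I : ℝ → ℝ≥0∞} {δ z Θ t lam : ℝ} {ψ : ℝ → ℝ}

lemma ae_ne_real (c : ℝ) : ∀ᵐ x : ℝ, x ≠ c := by simp [ae_iff]

lemma IsPath.eq_zero_of_notMem (h : IsPath ψ) (ht : t ∈ Icc (0 : ℝ) 1) (hE : t ∉ positiveSet ψ) :
    ψ t = 0 := by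
  by_contra hne
  exact hE ⟨ht, (h.nonneg t ht).lt_of_ne' hne⟩

lemma IsPath.exists_Ico_subset_positiveSet (h : IsPath ψ) (ht : t ∈ positiveSet ψ) (h1 : t < 1) :
    ∃ u > t, Ico t u ⊆ positiveSet ψ := by
  have h2 : ∀ᶠ s in 𝓝[≥] t, 0 < ψ s :=
    (h.cadlag.1 t ⟨ht.1.1, h1⟩).eventually (lt_mem_nhds ht.2)
  obtain ⟨u, hu, hsub⟩ := (mem_nhdsGE_iff_exists_Ico_subset' h1).1
    (inter_mem h2 (Icc_mem_nhdsGE h1))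
  exact ⟨u, hu, fun s hs => ⟨⟨ht.1.1.trans hs.1, (hsub hs).2.2⟩, (hsub hs).1⟩⟩

/-- By right-continuity a positive path stays positive for a while, so E has positive measure just
after s. -/
lemma IsPath.remaining_lt (h : IsPath ψ) {s u : ℝ} (hs : s ∈ positiveSet ψ) (hsu : s < u)
    (hu : u ≤ 1) : remaining (positiveSet ψ) u < remaining (positiveSet ψ) s := by
  obtain ⟨v, hv, hsub⟩ := h.exists_Ico_subset_positiveSet hs (hsu.trans_le hu)
  have h1 : Ico s (min u v) ∪ positiveSet ψ ∩ Icc u 1 ⊆ positiveSet ψ ∩ Icc s 1 := by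
    rintro x (hx | hx)
    · exact ⟨hsub ⟨hx.1, hx.2.trans_le (min_le_right _ _)⟩, hx.1,
        (hx.2.le.trans (min_le_left _ _)).trans hu⟩
    · exact ⟨hx.1, hsu.le.trans hx.2.1, hx.2.2⟩
  have h2 := measureReal_mono (μ := volume) h1 volume_inter_Icc_ne_top
  rw [measureReal_union (disjoint_left.2 fun x hx hx' =>
      not_lt.2 hx'.2.1 (hx.2.trans_le (min_le_left _ _)))
    (h.measurableSet_positiveSet.inter measurableSet_Icc) measure_Ico_lt_top.ne
    volume_inter_Icc_ne_top, Real.volume_real_Ico_of_le (lt_min hsu hv).le] at h2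
  unfold remaining
  linarith [lt_min hsu hv]

/-- A path satisfying the complementary slackness conditions has a single excursion, along which
its slope is determined. -/
theorem Feasible.exists_profile_of_slackness (hI : IsGoodConvexRate I) (hzero : I (-δ) = 0)
    (hz : 0 < z) (h : Feasible z ψ) (hlam : 0 < lam)
    (hup : ENNReal.ofReal (lam * volume.real (positiveSet ψ)) ≤ thetaUp I)
    (hsup : ∀ᵐ s ∂(volume.restrict (positiveSet ψ)),
      Supports I (lam * remaining (positiveSet ψ) s) (acSlope ψ s))
    (hP : upMeasure ψ
      (Icc 0 1 ∩ {s | remaining (positiveSet ψ) s < volume.real (positiveSet ψ)}) = 0)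
    (hN : downMeasure ψ (Icc 0 1) = 0) :
    ∃ b T₀ T₁, IsProfile ψ b (ψ T₀) T₀ T₁ ∧ T₁ - T₀ = volume.real (positiveSet ψ) ∧
      (∀ s ∈ Ioo T₀ T₁, b s = tilt I δ (lam * (T₁ - s))) ∧ (T₁ < 1 → ψ T₁ = 0) := by
  have hL := h.volume_positiveSet_pos hz
  have hψ := h.1
  set E := positiveSet ψ with hE
  have hEm : MeasurableSet E := hψ.measurableSet_positiveSet
  have hEne : E.Nonempty := by
    by_contra hne
    rw [not_nonempty_iff_eq_empty.1 hne] at hL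
    simp at hL
  have hbelow : BddBelow E := ⟨0, fun s hs => hs.1.1⟩
  have habove : BddAbove E := ⟨1, fun s hs => hs.1.2⟩
  set T₀ := sInf E with hT₀
  set T₁ := sSup E with hT₁
  have hEI : E ⊆ Icc T₀ T₁ := fun s hs => ⟨csInf_le hbelow hs, le_csSup habove hs⟩
  have h0T₀ : 0 ≤ T₀ := le_csInf hEne fun s hs => hs.1.1
  have hT₁1 : T₁ ≤ 1 := csSup_le hEne fun s hs => hs.1.2
  have hlt : T₀ < T₁ := by
    by_contra! hle
    have h1 := measureReal_mono (μ := volume) hEI measure_Icc_lt_top.ne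
    rw [measureReal_def (μ := volume) (s := Icc T₀ T₁), Real.volume_Icc,
      ENNReal.ofReal_of_nonpos (by linarith), ENNReal.toReal_zero] at h1
    linarith
  -- After T₀ some of E has already been used up, so slackness confines any upward singular mass to
  -- times up to T₀; the path is absolutely continuous from T₀ on.
  have hm_lt : ∀ u, T₀ < u → u ≤ 1 → remaining E u < volume.real E := fun u hu hu1 => by
    obtain ⟨e, he, heu⟩ := exists_lt_of_csInf_lt hEne hu
    exact (hψ.remaining_lt he heu hu1).trans_le (remaining_le positiveSet_subset)
  have hP' : ∀ s t, T₀ ≤ s → t ≤ 1 → (upMeasure ψ).real (Ioc s t) = 0 := fun s t hs ht => by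
    rw [measureReal_def, measure_mono_null _ hP, ENNReal.toReal_zero]
    exact fun x hx => ⟨⟨(h0T₀.trans hs).trans hx.1.le, hx.2.trans ht⟩,
      hm_lt x (hs.trans_lt hx.1) (hx.2.trans ht)⟩
  have hN' : ∀ s t, T₀ ≤ s → t ≤ 1 → (downMeasure ψ).real (Ioc s t) = 0 := fun s t hs ht => by
    rw [measureReal_def, measure_mono_null _ hN, ENNReal.toReal_zero]
    exact fun x hx => ⟨(h0T₀.trans hs).trans hx.1.le, hx.2.trans ht⟩
  have hsub : ∀ s t, T₀ ≤ s → s ≤ t → t ≤ 1 → ψ t - ψ s = ∫ u in Ioc s t, acSlope ψ u := by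
    intro s t hs hst ht
    rw [hψ.sub_eq_integral_add (h0T₀.trans hs) hst ht, hP' s t hs ht, hN' s t hs ht]
    ring
  have hzeroSlope : ∀ᵐ t, t ∈ Icc (0 : ℝ) 1 → t ∉ E → acSlope ψ t = 0 := by
    filter_upwards [hψ.acSlope_eq_zero, ae_ne_real 0, ae_ne_real 1] with t ht h0 h1 htm htE
    exact ht ⟨htm.1.lt_of_ne' h0, htm.2.lt_of_ne h1⟩ (hψ.eq_zero_of_notMem htm htE)
  have hsup' : ∀ᵐ s, s ∈ E → Supports I (lam * remaining E s) (acSlope ψ s) :=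
    (ae_restrict_iff' hEm).1 hsup
  have hneg : ∀ s t, T₀ ≤ s → s ≤ t → t ≤ 1 → ψ t < ψ s →
      ∃ u ∈ E, u ∈ Ioc s t ∧ acSlope ψ u < 0 ∧
        Supports I (lam * remaining E u) (acSlope ψ u) := by
    intro s t hs hst ht hlt
    by_contra! hno
    have h1 : 0 ≤ ∫ u in Ioc s t, acSlope ψ u := by
      refine setIntegral_nonneg_of_ae_restrict ((ae_restrict_iff' measurableSet_Ioc).2 ?_)
      filter_upwards [hzeroSlope, hsup'] with u hu1 hu2 hu
      by_cases huE : u ∈ E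
      · show (0 : ℝ) ≤ acSlope ψ u
        by_contra! hneg
        exact hno u huE hu hneg (hu2 huE)
      · exact (hu1 ⟨(h0T₀.trans hs).trans hu.1.le, hu.2.trans ht⟩ huE).ge
    linarith [hsub s t hs hst ht]
  have hposs : ∀ s t, T₀ ≤ s → s ≤ t → t ≤ 1 → ψ s < ψ t →
      ∃ u ∈ E, u ∈ Ioc s t ∧ 0 < acSlope ψ u ∧
        Supports I (lam * remaining E u) (acSlope ψ u) := by
    intro s t hs hst ht hlt
    by_contra! hno
    have h1 : ∫ u in Ioc s t, acSlope ψ u ≤ 0 := by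
      refine integral_nonpos_of_ae ((ae_restrict_iff' measurableSet_Ioc).2 ?_)
      filter_upwards [hzeroSlope, hsup'] with u hu1 hu2 hu
      by_cases huE : u ∈ E
      · show acSlope ψ u ≤ (0 : ℝ)
        by_contra! hneg
        exact hno u huE hu hneg (hu2 huE)
      · exact (hu1 ⟨(h0T₀.trans hs).trans hu.1.le, hu.2.trans ht⟩ huE).le
    linarith [hsub s t hs hst ht]
  -- A zero at an intermediate time t would require a descent before t and an ascent after it: a
  -- negative optimal slope at u ≤ t and a positive one at v > t. Less time remains at v than at u,
  -- and optimal slopes are monotone in the time remaining.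
  have hIoo : Ioo T₀ T₁ ⊆ E := by
    intro t ht
    have ht01 : t ∈ Icc (0 : ℝ) 1 := ⟨h0T₀.trans ht.1.le, ht.2.le.trans hT₁1⟩
    by_contra htE
    have h0 := hψ.eq_zero_of_notMem ht01 htE
    obtain ⟨s₁, hs₁, hs₁t⟩ := exists_lt_of_csInf_lt hEne ht.1
    obtain ⟨s₂, hs₂, hts₂⟩ := exists_lt_of_lt_csSup hEne ht.2
    obtain ⟨u, huE, hu, hu0, hus⟩ := hneg s₁ t (hEI hs₁).1 hs₁t.le ht01.2 (by
      rw [h0]; exact hs₁.2)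
    obtain ⟨v, hvE, hv, hv0, hvs⟩ := hposs t s₂ ht.1.le hts₂.le hs₂.1.2 (by
      rw [h0]; exact hs₂.2)
    have h1 := hψ.remaining_lt huE (hu.2.trans_lt hv.1) hvE.1.2
    have h2 := hvs.le_of_lt hus (mul_lt_mul_of_pos_left h1 hlam)
    linarith
  have hm : ∀ s ∈ Icc T₀ T₁, remaining E s = T₁ - s := by
    intro s hs
    apply le_antisymm
    · have h1 : E ∩ Icc s 1 ⊆ Icc s T₁ := fun x hx => ⟨hx.2.1, (hEI hx.1).2⟩
      have h2 := measureReal_mono (μ := volume) h1 measure_Icc_lt_top.ne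
      rwa [Real.volume_real_Icc_of_le hs.2] at h2
    · have h1 : Ioo s T₁ ⊆ E ∩ Icc s 1 := fun x hx =>
        ⟨hIoo ⟨hs.1.trans_lt hx.1, hx.2⟩, hx.1.le, hx.2.le.trans hT₁1⟩
      have h2 := measureReal_mono (μ := volume) h1 volume_inter_Icc_ne_top
      rwa [Real.volume_real_Ioo_of_le hs.2] at h2
  have hLen : T₁ - T₀ = volume.real E := by
    have hE1 : E ⊆ Icc T₀ 1 := fun x hx => ⟨(hEI hx).1, hx.1.2⟩
    rw [← hm T₀ ⟨le_rfl, hlt.le⟩, remaining, inter_eq_left.2 hE1]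
  set b : ℝ → ℝ := (Ioo T₀ T₁).indicator fun s => tilt I δ (lam * (T₁ - s)) with hb
  have hb1 : ∀ s ∈ Ioo T₀ T₁, b s = tilt I δ (lam * (T₁ - s)) := fun s hs =>
    indicator_of_mem hs _
  have hb0 : ∀ s, s ∉ Ioo T₀ T₁ → b s = 0 := fun s hs => indicator_of_notMem hs _
  have hslope : ∀ᵐ s, s ∈ Ioc T₀ 1 → acSlope ψ s = b s := by
    -- The exceptional multipliers with a non-unique maximiser are countable, and time ↦ multiplier
    -- is injective.
    have hcount : {s | lam * (T₁ - s) ∈ {θ | θ ∈ tiltDomain I ∧ 0 < θ ∧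
        ∃ y, Supports I θ y ∧ y ≠ tilt I δ θ}}.Countable := by
      refine (Supports.eq_tilt_ae hI hzero).preimage (f := fun s => lam * (T₁ - s)) ?_
      intro x y hxy
      have := mul_left_cancel₀ hlam.ne' hxy
      linarith
    have hae := hcount.ae_notMem volume
    filter_upwards [hae, hzeroSlope, hsup', ae_ne_real T₁] with s hs1 hs2 hs3 hs4 hs
    rcases lt_or_gt_of_ne hs4 with h1 | h1
    · have hs' : s ∈ Ioo T₀ T₁ := ⟨hs.1, h1⟩
      rw [hb1 s hs']
      have h2 := hs3 (hIoo hs')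
      rw [hm s ⟨hs.1.le, h1.le⟩] at h2
      by_contra hne
      refine hs1 ⟨mem_tiltDomain_of_lt hup (mul_nonneg hlam.le (by linarith)) ?_,
        mul_pos hlam (by linarith), _, h2, hne⟩
      exact mul_lt_mul_of_pos_left (by linarith [hs.1]) hlam
    · rw [hb0 s fun hs' => lt_asymm hs'.2 h1]
      exact hs2 ⟨h0T₀.trans hs.1.le, hs.2⟩ fun hsE => not_lt.2 (hEI hsE).2 h1
  have hbint : Integrable b := by
    refine ((integrable_acSlope (ψ := ψ)).indicator (measurableSet_Ioo (a := T₀) (b := T₁))).congr ?_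
    filter_upwards [hslope] with s hs
    by_cases hs' : s ∈ Ioo T₀ T₁
    · rw [indicator_of_mem hs', hs ⟨hs'.1, hs'.2.le.trans hT₁1⟩]
    · rw [indicator_of_notMem hs', hb0 s hs']
  have hmain : ∀ t, T₀ ≤ t → t ≤ 1 → ψ t = ψ T₀ + ∫ s in T₀..t, b s := by
    intro t ht ht1
    have h1 := hsub T₀ t le_rfl ht ht1
    rw [intervalIntegral.integral_of_le ht]
    rw [setIntegral_congr_ae (g := b) measurableSet_Ioc (by
      filter_upwards [hslope] with s hs hs' using hs ⟨hs'.1, hs'.2.trans ht1⟩)] at h1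
    linarith
  have hT₀1 : T₀ ≤ 1 := hlt.le.trans hT₁1
  refine ⟨b, T₀, T₁, ⟨h0T₀, hlt, hT₁1, hψ.nonneg _ ⟨h0T₀, hT₀1⟩, hbint,
    fun s hs => hb0 s fun hs' => hs ⟨hs'.1, hs'.2.le⟩, fun t => ?_, hψ.nonneg⟩, hLen, hb1,
    fun hT => ?_⟩
  · split_ifs with ht
    · rcases lt_or_ge t 0 with h0 | h0
      · exact extendPath_of_neg h0
      · rw [extendPath_of_mem ⟨h0, ht.le.trans hT₀1⟩]
        exact hψ.eq_zero_of_notMem ⟨h0, ht.le.trans hT₀1⟩ fun htE => not_lt.2 (hEI htE).1 ht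
    · push Not at ht
      rcases le_total t 1 with h1 | h1
      · rw [extendPath_of_mem ⟨h0T₀.trans ht, h1⟩, hmain t ht h1]
      · rw [extendPath_of_one_le h1, hmain 1 hT₀1 le_rfl,
          ← intervalIntegral.integral_add_adjacent_intervals (a := T₀) (b := 1) (c := t)
            hbint.intervalIntegrable hbint.intervalIntegrable, intervalIntegral.integral_of_le h1,
          setIntegral_eq_zero_of_forall_eq_zero (t := Ioc 1 t), add_zero]
        exact fun s hs => hb0 s fun hs' => not_lt.2 hT₁1 (hs.1.trans hs'.2)
  · have hmem : T₁ ∈ Icc (0 : ℝ) 1 := ⟨h0T₀.trans hlt.le, hT₁1⟩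
    refine hψ.eq_zero_of_notMem hmem fun hTE => ?_
    -- If the path were positive at T₁ < 1, right-continuity would put points of E beyond its
    -- supremum.
    obtain ⟨u, hu, hsubE⟩ := hψ.exists_Ico_subset_positiveSet hTE hT
    obtain ⟨v, hv1, hv2⟩ := exists_between hu
    exact not_lt.2 (hEI (hsubE ⟨le_of_lt hv1, hv2⟩)).2 hv1

end RRW

/-! ### Candidates and their optimality -/

namespace RRW

variable {I : ℝ → ℝ≥0∞} {δ z Θ T j : ℝ} {ψ : ℝ → ℝ}

lemma IsGoodConvexRate.integral_tilt_eq_legendre (hI : IsGoodConvexRate I) (hzero : I (-δ) = 0)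
    (hup : ENNReal.ofReal Θ ≤ thetaUp I) :
    ∀ θ ∈ Ico 0 Θ, legendre I δ θ = ∫ u in (0 : ℝ)..θ, tilt I δ u := fun _ hθ =>
  (hI.integral_tilt hzero (mem_tiltDomain_of_lt hup hθ.1 hθ.2)).symm

/-- Covers Θ = θ↑, where the selection at the endpoint itself is uncontrolled; everything is
therefore expressed through integrals of the subgradient. -/
lemma IsGoodConvexRate.intervalIntegrable_legendre (hI : IsGoodConvexRate I)
    (hzero : I (-δ) = 0) (hΘ : 0 ≤ Θ) (hup : ENNReal.ofReal Θ ≤ thetaUp I)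
    (hint : IntervalIntegrable (tilt I δ) volume 0 Θ) :
    IntervalIntegrable (legendre I δ) volume 0 Θ := by
  have hcont : ContinuousOn (fun θ => ∫ u in (0 : ℝ)..θ, tilt I δ u) (uIcc 0 Θ) :=
    intervalIntegral.continuousOn_primitive_interval
      ((intervalIntegrable_iff' (by simp)).1 hint)
  refine hcont.intervalIntegrable.congr_ae ?_
  rw [uIoc_of_le hΘ, EventuallyEq, ae_restrict_iff' measurableSet_Ioc]
  filter_upwards [ae_ne_real Θ] with θ h1 hθ
  exact (hI.integral_tilt_eq_legendre hzero hup θ ⟨hθ.1.le, hθ.2.lt_of_ne h1⟩).symm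

/-- Integration by parts of Λ = ∫ ∇Λ against the identity. It links the dual value to the area and
end value of a candidate. -/
lemma IsGoodConvexRate.integral_legendre (hI : IsGoodConvexRate I) (hzero : I (-δ) = 0)
    (hΘ : 0 ≤ Θ) (hup : ENNReal.ofReal Θ ≤ thetaUp I)
    (hint : IntervalIntegrable (tilt I δ) volume 0 Θ) :
    ∫ θ in (0 : ℝ)..Θ, legendre I δ θ =
      Θ * (∫ θ in (0 : ℝ)..Θ, tilt I δ θ) - ∫ θ in (0 : ℝ)..Θ, θ * tilt I δ θ := by
  have h1 : ∫ θ in (0 : ℝ)..Θ, legendre I δ θ =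
      ∫ θ in (0 : ℝ)..Θ, ∫ u in (0 : ℝ)..θ, tilt I δ u := by
    rw [intervalIntegral.integral_of_le hΘ, intervalIntegral.integral_of_le hΘ]
    refine setIntegral_congr_ae measurableSet_Ioc ?_
    filter_upwards [ae_ne_real Θ] with θ h1 hθ
    exact hI.integral_tilt_eq_legendre hzero hup θ ⟨hθ.1.le, hθ.2.lt_of_ne h1⟩
  have hac : AbsolutelyContinuousOnInterval (fun θ => ∫ u in (0 : ℝ)..θ, tilt I δ u) 0 Θ :=
    hint.absolutelyContinuousOnInterval_intervalIntegral left_mem_uIcc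
  have hid : AbsolutelyContinuousOnInterval (fun θ : ℝ => θ) 0 Θ :=
    LipschitzOnWith.absolutelyContinuousOnInterval (K := 1) (LipschitzWith.id.lipschitzOnWith)
  have h2 := hac.integral_mul_deriv_eq_deriv_mul hid
  have h3 : ∫ θ in (0 : ℝ)..Θ, deriv (fun θ => ∫ u in (0 : ℝ)..θ, tilt I δ u) θ * θ =
      ∫ θ in (0 : ℝ)..Θ, θ * tilt I δ θ := by
    refine intervalIntegral.integral_congr_ae ?_
    filter_upwards [hint.ae_hasDerivAt_integral] with θ h hθ
    rw [(h (uIoc_subset_uIcc hθ) 0 left_mem_uIcc).deriv, mul_comm]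
  simp only [deriv_id'', mul_one, mul_zero, sub_zero] at h2
  rw [h1, h2, h3]
  ring

/-- The area of a profile starting at time `0`. -/
lemma IsProfile.area_eq {b : ℝ → ℝ} (h : IsProfile ψ b j 0 T) :
    ∫ s in (0 : ℝ)..T, ψ s = j * T + ∫ s in (0 : ℝ)..T, (T - s) * b s := by
  have hT : Icc 0 T ⊆ Icc (0 : ℝ) 1 := Icc_subset_Icc_right h.T₁_le_one
  obtain ⟨h1, h2, h3⟩ := integral_integral_Icc (Q := volume) (f := b) h.integrable.integrableOn
    hT measurableSet_Icc
  have h4 : ∀ s ∈ Icc 0 T, ψ s = j + ∫ u in Icc 0 s, b u := fun s hs => by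
    rw [h.apply_of_mem ⟨hs.1, hs.2.trans h.T₁_le_one⟩, intervalIntegral.integral_of_le hs.1,
      integral_Icc_eq_integral_Ioc]
  have h5 : ∫ u in Icc 0 1, b u * remaining (Icc 0 T) u = ∫ u in Icc 0 T, (T - u) * b u := by
    have h6 : ∀ u ∈ Icc (0 : ℝ) 1, b u * remaining (Icc 0 T) u =
        (Icc 0 T).indicator (fun u => (T - u) * b u) u := by
      intro u hu
      by_cases hm : u ∈ Icc 0 T
      · have h7 : Icc 0 T ∩ Icc u 1 = Icc u T := by
          rw [Icc_inter_Icc, max_eq_right hm.1, min_eq_left h.T₁_le_one]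
        rw [indicator_of_mem hm, remaining, h7, Real.volume_real_Icc_of_le hm.2, mul_comm]
      · rw [indicator_of_notMem hm, h.eq_zero u fun hu' => hm ⟨hu'.1.le, hu'.2⟩, zero_mul]
    rw [setIntegral_congr_fun measurableSet_Icc h6, setIntegral_indicator measurableSet_Icc,
      inter_eq_right.2 hT]
  rw [intervalIntegral.integral_of_le h.lt.le, intervalIntegral.integral_of_le h.lt.le,
    ← integral_Icc_eq_integral_Ioc, ← integral_Icc_eq_integral_Ioc,
    setIntegral_congr_fun measurableSet_Icc h4, integral_add
      (integrableOn_const (μ := volume) (s := Icc 0 T) (C := j) measure_Icc_lt_top.ne) h1, h3, h5, setIntegral_const,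
    Real.volume_real_Icc_of_le h.lt.le, smul_eq_mul, sub_zero, mul_comm T]

/-- Parameters of a solution of the optimality conditions: `Θ = λ T` is the initial gradient,
`T` the length of the excursion, `j` the initial jump. -/
structure IsCandidate (I : ℝ → ℝ≥0∞) (δ z Θ T j : ℝ) : Prop where
  Θ_pos : 0 < Θ
  Θ_le : ENNReal.ofReal Θ ≤ thetaUp I
  T_pos : 0 < T
  T_le_one : T ≤ 1
  jump_nonneg : 0 ≤ j
  jump : j ≠ 0 → ENNReal.ofReal Θ = thetaUp I
  integrable : IntervalIntegrable (tilt I δ) volume 0 Θ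
  area : z = (T / Θ) ^ 2 * (∫ θ in (0 : ℝ)..Θ, θ * tilt I δ θ) + T * j
  end_nonneg : 0 ≤ j + T / Θ * ∫ θ in (0 : ℝ)..Θ, tilt I δ θ
  end_eq_zero : T < 1 → j + T / Θ * ∫ θ in (0 : ℝ)..Θ, tilt I δ θ = 0

namespace IsCandidate

lemma integral_reverse (h : IsCandidate I δ z Θ T j) (f : ℝ → ℝ) :
    ∫ s in (0 : ℝ)..T, f (Θ / T * (T - s)) = T / Θ * ∫ θ in (0 : ℝ)..Θ, f θ := by
  have h1 : Θ / T ≠ 0 := (div_pos h.Θ_pos h.T_pos).ne'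
  have h2 := intervalIntegral.integral_comp_sub_left (a := 0) (b := T) (fun s => f (Θ / T * s)) T
  rw [h2, sub_self, sub_zero, intervalIntegral.integral_comp_mul_left _ h1, mul_zero,
    div_mul_cancel₀ _ h.T_pos.ne', smul_eq_mul, inv_div]

lemma intervalIntegrable_reverse (h : IsCandidate I δ z Θ T j) {f : ℝ → ℝ}
    (hf : IntervalIntegrable f volume 0 Θ) :
    IntervalIntegrable (fun s => f (Θ / T * (T - s))) volume 0 T := by
  have h1 := hf.comp_mul_left (c := Θ / T)
  rw [zero_div, div_div_cancel₀ h.Θ_pos.ne'] at h1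
  have h2 := (h1.comp_sub_left T).symm
  rwa [sub_self, sub_zero] at h2

/-- The profile of a candidate. -/
lemma exists_profile (h : IsCandidate I δ z Θ T j) (hI : IsGoodConvexRate I)
    (hzero : I (-δ) = 0) :
    ∃ ψ b, IsProfile ψ b j 0 T ∧ (∀ s ∈ Ioo 0 T, b s = tilt I δ (Θ / T * (T - s))) ∧
      (T < 1 → ψ T = 0) ∧ ∫ s in (0 : ℝ)..1, ψ s = z := by
  have hT := h.T_pos
  set b : ℝ → ℝ := (Ioo 0 T).indicator fun s => tilt I δ (Θ / T * (T - s)) with hb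
  have hb1 : ∀ s ∈ Ioo 0 T, b s = tilt I δ (Θ / T * (T - s)) := fun s hs => indicator_of_mem hs _
  have hb0 : ∀ s, s ∉ Ioo 0 T → b s = 0 := fun s hs => indicator_of_notMem hs _
  have hae : ∀ᵐ s, s ∈ Ioc 0 T → b s = tilt I δ (Θ / T * (T - s)) := by
    filter_upwards [ae_ne_real T] with s hs hs'
    exact hb1 s ⟨hs'.1, hs'.2.lt_of_ne hs⟩
  have hbint : Integrable b := by
    rw [hb, integrable_indicator_iff measurableSet_Ioo]
    exact ((intervalIntegrable_iff_integrableOn_Ioc_of_le hT.le).1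
      (h.intervalIntegrable_reverse h.integrable)).mono_set Ioo_subset_Ioc_self
  have hbT : ∫ s in (0 : ℝ)..T, b s = T / Θ * ∫ θ in (0 : ℝ)..Θ, tilt I δ θ := by
    rw [← h.integral_reverse]
    refine intervalIntegral.integral_congr_ae ?_
    rwa [uIoc_of_le hT.le]
  have hdom : ∀ s ∈ Ioo 0 T, Θ / T * (T - s) ∈ tiltDomain I := fun s hs =>
    mem_tiltDomain_of_lt h.Θ_le (mul_nonneg (div_pos h.Θ_pos hT).le (by linarith [hs.2])) (by
      rw [div_mul_eq_mul_div, div_lt_iff₀ hT]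
      exact mul_lt_mul_of_pos_left (by linarith [hs.1]) h.Θ_pos)
  have hanti : AntitoneOn b (Ioo 0 T) := by
    intro s hs t ht hst
    rw [hb1 s hs, hb1 t ht]
    refine hI.monotoneOn_tilt hzero (hdom t ht) (hdom s hs) ?_
    exact mul_le_mul_of_nonneg_left (by linarith) (div_pos h.Θ_pos hT).le
  have hafter : ∀ t, T ≤ t → ∫ s in (0 : ℝ)..t, b s = ∫ s in (0 : ℝ)..T, b s := by
    intro t ht
    rw [← intervalIntegral.integral_add_adjacent_intervals (b := T) hbint.intervalIntegrable
      hbint.intervalIntegrable, intervalIntegral.integral_of_le ht,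
      setIntegral_eq_zero_of_forall_eq_zero (t := Ioc T t), add_zero]
    exact fun s hs => hb0 s fun hs' => lt_asymm hs'.2 hs.1
  -- A concave function that is non-negative at both ends is non-negative between: the sign of the
  -- slope at t decides which end to compare with.
  have hnonneg' : ∀ t ∈ Icc 0 T, 0 ≤ j + ∫ s in (0 : ℝ)..t, b s := by
    intro t ht
    rcases ht.1.eq_or_lt with h0 | h0
    · simpa [← h0] using h.jump_nonneg
    rcases ht.2.eq_or_lt with h1 | h1
    · rw [h1, hbT]
      exact h.end_nonneg
    have htm : t ∈ Ioo 0 T := ⟨h0, h1⟩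
    rcases le_total 0 (b t) with h2 | h2
    · refine add_nonneg h.jump_nonneg ?_
      have h3 : ∫ s in (0 : ℝ)..t, (0 : ℝ) ≤ ∫ s in (0 : ℝ)..t, b s :=
        intervalIntegral.integral_mono_on_of_le_Ioo h0.le intervalIntegrable_const
          hbint.intervalIntegrable fun s hs => h2.trans (hanti ⟨hs.1, hs.2.trans h1⟩ htm hs.2.le)
      simpa using h3
    · have h3 : ∫ s in t..T, b s ≤ ∫ s in t..T, (0 : ℝ) :=
        intervalIntegral.integral_mono_on_of_le_Ioo h1.le hbint.intervalIntegrable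
          intervalIntegrable_const fun s hs =>
            (hanti htm ⟨h0.trans hs.1, hs.2⟩ hs.1.le).trans h2
      rw [intervalIntegral.integral_zero] at h3
      have h4 := h.end_nonneg
      rw [← hbT, ← intervalIntegral.integral_add_adjacent_intervals (b := t)
        hbint.intervalIntegrable hbint.intervalIntegrable] at h4
      linarith
  set ψ : ℝ → ℝ := fun t => j + ∫ s in (0 : ℝ)..t, b s with hψ
  have hprof : IsProfile ψ b j 0 T := by
    refine ⟨le_rfl, hT, h.T_le_one, h.jump_nonneg, hbint,
      fun s hs => hb0 s fun hs' => hs ⟨hs'.1, hs'.2.le⟩, fun t => ?_, fun t ht => ?_⟩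
    · unfold extendPath
      split_ifs with h0
      · rfl
      · rcases le_total t 1 with h1 | h1
        · rw [min_eq_left h1]
        · rw [min_eq_right h1, hψ]
          dsimp only
          rw [hafter 1 h.T_le_one, hafter t (h.T_le_one.trans h1)]
    · rcases le_total t T with h1 | h1
      · exact hnonneg' t ⟨ht.1, h1⟩
      · rw [hψ]
        dsimp only
        rw [hafter t h1]
        exact hnonneg' T ⟨hT.le, le_rfl⟩
  have hend : T < 1 → ψ T = 0 := fun h1 => by
    rw [hψ]
    dsimp only
    rw [hbT]
    exact h.end_eq_zero h1
  refine ⟨ψ, b, hprof, hb1, hend, ?_⟩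
  have h1 : ∫ s in (0 : ℝ)..T, (T - s) * b s =
      (T / Θ) ^ 2 * ∫ θ in (0 : ℝ)..Θ, θ * tilt I δ θ := by
    have h2 : ∫ s in (0 : ℝ)..T, (T - s) * b s =
        ∫ s in (0 : ℝ)..T, T / Θ * ((Θ / T * (T - s)) * tilt I δ (Θ / T * (T - s))) := by
      refine intervalIntegral.integral_congr_ae ?_
      rw [uIoc_of_le hT.le]
      filter_upwards [hae] with s hs hs'
      rw [hs hs', ← mul_assoc, ← mul_assoc, div_mul_div_comm, mul_comm T Θ,
        div_self (mul_pos h.Θ_pos hT).ne', one_mul]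
    rw [h2, intervalIntegral.integral_const_mul, h.integral_reverse (fun θ => θ * tilt I δ θ)]
    ring
  rw [hprof.integral_eq hend, hprof.area_eq, h1, h.area]
  ring

/-- The cost of the profile of a candidate. -/
lemma J_toReal (h : IsCandidate I δ z Θ T j) (hI : IsGoodConvexRate I) (hδ : 0 < δ)
    (hzero : I (-δ) = 0) (hz : 0 < z) {b : ℝ → ℝ} (hprof : IsProfile ψ b j 0 T)
    (hb : ∀ s ∈ Ioo 0 T, b s = tilt I δ (Θ / T * (T - s))) (hend : T < 1 → ψ T = 0)
    (harea : ∫ s in (0 : ℝ)..1, ψ s = z) (hJ : J I ψ < ⊤) :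
    (J I ψ).toReal = Θ / T * z - T / Θ * ∫ θ in (0 : ℝ)..Θ, legendre I δ θ := by
  have hT := h.T_pos
  have hdom : ∀ s ∈ Ioo 0 T, Θ / T * (T - s) ∈ tiltDomain I := fun s hs =>
    mem_tiltDomain_of_lt h.Θ_le (mul_nonneg (div_pos h.Θ_pos hT).le (by linarith [hs.2])) (by
      rw [div_mul_eq_mul_div, div_lt_iff₀ hT]
      exact mul_lt_mul_of_pos_left (by linarith [hs.1]) h.Θ_pos)
  have hanti : AntitoneOn b (Ioo 0 T) := by
    intro s hs t ht hst
    rw [hb s hs, hb t ht]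
    refine hI.monotoneOn_tilt hzero (hdom t ht) (hdom s hs) ?_
    exact mul_le_mul_of_nonneg_left (by linarith) (div_pos h.Θ_pos hT).le
  have hJeq := hprof.J_eq hδ hzero hend (hprof.pos_of_antitoneOn hanti (by
    rw [← hprof.integral_eq hend, harea]; exact hz.ne'))
  rw [hJeq] at hJ ⊢
  obtain ⟨hJ1, hJ2⟩ := ENNReal.add_lt_top.1 hJ
  have hmeas : AEMeasurable (fun s => I (b s)) (volume.restrict (Ioc 0 T)) :=
    hI.measurable.comp_aemeasurable hprof.integrable.aemeasurable.restrict
  have h1 : (∫⁻ s in Ioc 0 T, I (b s)).toReal = ∫ s in (0 : ℝ)..T, (I (b s)).toReal := by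
    rw [intervalIntegral.integral_of_le hT.le,
      integral_toReal hmeas (ae_lt_top' hmeas hJ1.ne)]
  have h2 : ∫ s in (0 : ℝ)..T, (I (b s)).toReal =
      ∫ s in (0 : ℝ)..T, (Θ / T * ((T - s) * b s) - legendre I δ (Θ / T * (T - s))) := by
    refine intervalIntegral.integral_congr_ae ?_
    rw [uIoc_of_le hT.le]
    filter_upwards [ae_ne_real T] with s hs hs'
    rw [legendre, hb s ⟨hs'.1, hs'.2.lt_of_ne hs⟩]
    ring
  have h3 : IntervalIntegrable (fun s => (T - s) * b s) volume 0 T :=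
    hprof.integrable.intervalIntegrable.continuousOn_mul (by fun_prop)
  have h4 : ∫ s in (0 : ℝ)..T, (T - s) * b s = z - j * T := by
    rw [← harea, hprof.integral_eq hend, hprof.area_eq]
    ring
  have h5 : (thetaUp I * ENNReal.ofReal j).toReal = Θ * j := by
    by_cases hj : j = 0
    · simp [hj]
    · rw [← h.jump hj, ENNReal.toReal_mul, ENNReal.toReal_ofReal h.Θ_pos.le,
        ENNReal.toReal_ofReal h.jump_nonneg]
  rw [ENNReal.toReal_add hJ1.ne hJ2.ne, h1, h2, h5, intervalIntegral.integral_sub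
    (h3.const_mul _) (h.intervalIntegrable_reverse
      (hI.intervalIntegrable_legendre hzero h.Θ_pos.le h.Θ_le h.integrable)),
    intervalIntegral.integral_const_mul, h4, h.integral_reverse]
  have hT' := hT.ne'
  field_simp
  ring

/-- A candidate yields an optimal potential solution, and then every optimal path is a
potential solution. -/
theorem exists_optimal (h : IsCandidate I δ z Θ T j) (hI : IsGoodConvexRate I) (hδ : 0 < δ)
    (hzero : I (-δ) = 0) (hpos : ∀ y : ℝ, -δ < y → 0 < I y)
    (hgrad : ∀ y : ℝ, -δ ≤ y → (y : EReal) < rbar I → ∃ g : ℝ, HasGradAt I y g)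
    (hz : 0 < z) :
    ∃ ψ T₀ T₀₀ T₁, IsPotentialSolution I δ z ψ T₀ T₀₀ T₁ ∧
      ∀ φ, Feasible z φ → J I φ < ⊤ → J I ψ ≤ J I φ ∧
        (J I φ ≤ J I ψ → ∃ S₀ S₀₀ S₁, IsPotentialSolution I δ z φ S₀ S₀₀ S₁) := by
  have hT := h.T_pos
  have hΘ := h.Θ_pos
  obtain ⟨ψ, b, hprof, hb, hend, harea⟩ := h.exists_profile hI hzero
  have hjtop : thetaUp I = ⊤ → j = 0 := fun htop => by
    by_contra hj
    exact ENNReal.ofReal_ne_top ((h.jump hj).trans htop)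
  obtain ⟨T₀₀, hpot⟩ := hprof.exists_isPotentialSolution hI hδ hzero hpos hgrad
    (div_pos hΘ hT) (by rw [sub_zero, div_mul_cancel₀ _ hT.ne']; exact h.Θ_le) hb hend harea hjtop
  obtain ⟨-, -, hJψ⟩ := hpot.feasible_and_cost hI hδ hzero hz
  have hcost := h.J_toReal hI hδ hzero hz hprof hb hend harea hJψ
  refine ⟨ψ, 0, T₀₀, T, hpot, fun φ hφ hJφ => ?_⟩
  have hint := hI.intervalIntegrable_legendre hzero hΘ.le h.Θ_le h.integrable
  obtain ⟨hdual, heq⟩ := hφ.dual_bound hI hδ hzero hz hΘ h.Θ_le hint hJφ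
  have hL := hφ.volume_positiveSet_pos hz
  have hL1 := volume_positiveSet_le_one (ψ := φ)
  have hparts := hI.integral_legendre hzero hΘ.le h.Θ_le h.integrable
  set L := volume.real (positiveSet φ)
  set S := ∫ θ in (0 : ℝ)..Θ, legendre I δ θ
  -- p is the candidate's value at its end time T, and D'(T) = −Θp/T: ending at 0 is stationarity in
  -- the length, while p ≥ 0 is the boundary condition at the maximal length T = 1.
  set p := j + T / Θ * ∫ θ in (0 : ℝ)..Θ, tilt I δ θ with hp
  have hS : S = Θ ^ 2 / T ^ 2 * (T * p - z) := by
    rw [hparts, hp, h.area]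
    field_simp
    ring
  have hpT : 0 ≤ p * (T - L) := by
    rcases h.T_le_one.eq_or_lt with h1 | h1
    · exact mul_nonneg h.end_nonneg (by linarith)
    · rw [hp, h.end_eq_zero h1, zero_mul]
  -- D(L) − D(T) as the strictly convex excess plus the first-order term, both non-negative. If the
  -- excess vanishes then L = T.
  have hdiff : (Θ / L * z - L / Θ * S) - (Θ / T * z - T / Θ * S) =
      Θ * z * (T - L) ^ 2 / (L * T ^ 2) + Θ / T * (p * (T - L)) := by
    rw [hS]
    field_simp
    ring
  have hsq : 0 ≤ Θ * z * (T - L) ^ 2 / (L * T ^ 2) := by positivity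
  have hlin : 0 ≤ Θ / T * (p * (T - L)) := mul_nonneg (div_pos hΘ hT).le hpT
  refine ⟨(ENNReal.toReal_le_toReal hJψ.ne hJφ.ne).1 (by linarith), fun hle => ?_⟩
  have hle' := (ENNReal.toReal_le_toReal hJφ.ne hJψ.ne).2 hle
  have hsq0 : Θ * z * (T - L) ^ 2 / (L * T ^ 2) = 0 := by linarith
  have hLT : L = T := by
    have h1 : Θ * z * (T - L) ^ 2 = 0 := by
      rwa [div_eq_zero_iff, or_iff_left (by positivity)] at hsq0
    have h2 : (T - L) ^ 2 = 0 := (mul_eq_zero.1 h1).resolve_left (by positivity)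
    linarith [pow_eq_zero_iff (two_ne_zero) |>.1 h2]
  obtain ⟨hs1, hs2, hs3⟩ := heq (by linarith)
  obtain ⟨b', S₀, S₁, hprof', hlen, hb', hend'⟩ := hφ.exists_profile_of_slackness hI hzero hz
    (div_pos hΘ hL) (by rw [div_mul_cancel₀ _ hL.ne']; exact h.Θ_le) hs1 hs2 hs3
  refine ⟨S₀, ?_⟩
  obtain ⟨S₀₀, hS⟩ := hprof'.exists_isPotentialSolution hI hδ hzero hpos hgrad
    (div_pos hΘ hL) (by rw [hlen, div_mul_cancel₀ _ hL.ne']; exact h.Θ_le) hb' hend' hφ.2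
    -- With θ↑ = ∞ finite cost rules out upward singular mass, in particular a jump.
    (fun htop => by
      have h1 : upMeasure φ (Icc 0 1) = 0 := by
        by_contra hne
        rw [hφ.1.J_eq hδ hzero, htop, ENNReal.top_mul hne] at hJφ
        simp at hJφ
      rw [hprof'.upMeasure_Icc (hprof'.lt.le.trans hprof'.T₁_le_one)] at h1
      exact le_antisymm (ENNReal.ofReal_eq_zero.1 h1) hprof'.jump_nonneg)
  exact ⟨S₀₀, S₁, hS⟩

end IsCandidate

end RRW

/-! ### Existence of a candidate -/

namespace RRW

variable {I : ℝ → ℝ≥0∞} {δ z Θ Θ' θ : ℝ}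

lemma continuousOn_integral_of_intervalIntegrable {f : ℝ → ℝ} {a b : ℝ}
    (h : IntervalIntegrable f volume a b) :
    ContinuousOn (fun x => ∫ u in a..x, f u) (uIcc a b) :=
  intervalIntegral.continuousOn_primitive_interval ((intervalIntegrable_iff' (by simp)).1 h)

lemma nonpos_right_end {f : ℝ → ℝ} {a b c : ℝ} (hab : a ≤ b) (hbc : b < c)
    (hf : ContinuousOn f (Icc a c)) (h : ∀ x ∈ Ioo b c, f x ≤ 0) : f c ≤ 0 := by
  have h1 : Tendsto f (𝓝[<] c) (𝓝 (f c)) := by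
    refine (hf c ⟨hab.trans hbc.le, le_rfl⟩).tendsto.mono_left ?_
    exact nhdsWithin_le_of_mem (mem_of_superset (Ioo_mem_nhdsLT hbc)
      fun x hx => ⟨hab.trans hx.1.le, hx.2.le⟩)
  refine le_of_tendsto h1 ?_
  filter_upwards [Ioo_mem_nhdsLT hbc] with x hx using h x hx

lemma intervalIntegrable_mul_tilt {a b : ℝ} (h : IntervalIntegrable (tilt I δ) volume a b) :
    IntervalIntegrable (fun θ => θ * tilt I δ θ) volume a b :=
  h.continuousOn_mul (by fun_prop)

lemma IsGoodConvexRate.legendre_le (θ : ℝ) : legendre I δ θ ≤ θ * tilt I δ θ := by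
  unfold legendre
  linarith [ENNReal.toReal_nonneg (a := I (tilt I δ θ))]

lemma intervalIntegrable_of_subset {a b : ℝ} (h : IntervalIntegrable (tilt I δ) volume 0 Θ)
    (ha : 0 ≤ a) (hab : a ≤ b) (hb : b ≤ Θ) : IntervalIntegrable (tilt I δ) volume a b :=
  h.mono_set (by
    rw [uIcc_of_le hab, uIcc_of_le (ha.trans (hab.trans hb))]
    exact Icc_subset_Icc ha hb)

/-- The integral is Λ(θ), and Λ(θ) ≤ θ∇Λ(θ) because I ≥ 0. -/
lemma IsGoodConvexRate.tilt_pos_of_integral_pos (hI : IsGoodConvexRate I) (hzero : I (-δ) = 0)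
    (hθ : θ ∈ tiltDomain I) (h : 0 ≤ ∫ u in (0 : ℝ)..θ, tilt I δ u) (h0 : 0 < θ) :
    0 ≤ tilt I δ θ := by
  rw [hI.integral_tilt hzero hθ] at h
  have h1 := h.trans (IsGoodConvexRate.legendre_le θ)
  exact nonneg_of_mul_nonneg_right h1 h0

/-- `Λ` increases after a point where it is nonnegative. -/
lemma IsGoodConvexRate.integral_tilt_le (hI : IsGoodConvexRate I) (hzero : I (-δ) = 0)
    (hθ : θ ∈ tiltDomain I) (h0 : 0 < θ) (h : 0 ≤ ∫ u in (0 : ℝ)..θ, tilt I δ u)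
    (hle : θ ≤ Θ) (hup : ENNReal.ofReal Θ ≤ thetaUp I)
    (hint : IntervalIntegrable (tilt I δ) volume 0 Θ) :
    ∫ u in (0 : ℝ)..θ, tilt I δ u ≤ ∫ u in (0 : ℝ)..Θ, tilt I δ u := by
  have h1 := hI.tilt_pos_of_integral_pos hzero hθ h h0
  have hi1 := intervalIntegrable_of_subset hint le_rfl h0.le hle
  have hi2 := intervalIntegrable_of_subset hint h0.le hle le_rfl
  rw [← intervalIntegral.integral_add_adjacent_intervals hi1 hi2]
  have h2 : ∫ u in θ..Θ, (0 : ℝ) ≤ ∫ u in θ..Θ, tilt I δ u :=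
    intervalIntegral.integral_mono_on_of_le_Ioo hle intervalIntegrable_const hi2 fun u hu =>
      h1.trans (hI.monotoneOn_tilt hzero hθ
        (mem_tiltDomain_of_lt hup (h0.le.trans hu.1.le) hu.2) hu.1.le)
  simp only [intervalIntegral.integral_zero] at h2
  linarith

lemma IsGoodConvexRate.exists_legendre_neg (hI : IsGoodConvexRate I) (hδ : 0 < δ)
    (hzero : I (-δ) = 0) (hpos : ∀ y : ℝ, -δ < y → 0 < I y) (hΘ : 0 < Θ) :
    ∃ ε ∈ Ioo 0 Θ, legendre I δ ε < 0 := by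
  have h1 : ∀ᶠ θ in 𝓝[>] (0 : ℝ), tilt I δ θ < 0 :=
    (hI.tendsto_tilt_zero hzero hpos).eventually (gt_mem_nhds (by linarith))
  obtain ⟨ε, h2, hε⟩ := (h1.and (Ioo_mem_nhdsGT hΘ)).exists
  refine ⟨ε, hε, (IsGoodConvexRate.legendre_le ε).trans_lt ?_⟩
  exact mul_neg_of_pos_of_neg hε.1 h2

/-- Λ is negative just after 0, where its slope is near −δ. Once non-negative it never decreases
again, so Λ ≤ 0 at the end of the interval forces Λ ≤ 0 throughout. -/
lemma IsGoodConvexRate.integral_legendre_neg (hI : IsGoodConvexRate I) (hδ : 0 < δ)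
    (hzero : I (-δ) = 0) (hpos : ∀ y : ℝ, -δ < y → 0 < I y) (hΘ : 0 < Θ)
    (hup : ENNReal.ofReal Θ ≤ thetaUp I) (hint : IntervalIntegrable (tilt I δ) volume 0 Θ)
    (hK : ∫ u in (0 : ℝ)..Θ, tilt I δ u ≤ 0) :
    ∫ θ in (0 : ℝ)..Θ, legendre I δ θ < 0 := by
  have h1 : ∫ θ in (0 : ℝ)..Θ, legendre I δ θ =
      ∫ θ in (0 : ℝ)..Θ, ∫ u in (0 : ℝ)..θ, tilt I δ u := by
    rw [intervalIntegral.integral_of_le hΘ.le, intervalIntegral.integral_of_le hΘ.le]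
    refine setIntegral_congr_ae measurableSet_Ioc ?_
    filter_upwards [ae_ne_real Θ] with θ h1 hθ
    exact hI.integral_tilt_eq_legendre hzero hup θ ⟨hθ.1.le, hθ.2.lt_of_ne h1⟩
  have hcont := continuousOn_integral_of_intervalIntegrable hint
  rw [uIcc_of_le hΘ.le] at hcont
  obtain ⟨ε, hε, hneg⟩ := hI.exists_legendre_neg hδ hzero hpos hΘ
  have h2 := intervalIntegral.integral_lt_integral_of_continuousOn_of_le_of_exists_lt hΘ hcont
    (continuousOn_const (c := (0 : ℝ))) (fun θ hθ => ?_) ⟨ε, ⟨hε.1.le, hε.2.le⟩, ?_⟩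
  · rw [h1]
    simpa using h2
  · rcases hθ.2.eq_or_lt with h | h
    · rw [h]
      exact hK
    · by_contra! hlt
      have h3 := hI.integral_tilt_le hzero (mem_tiltDomain_of_lt hup hθ.1.le h) hθ.1 hlt.le hθ.2
        hup hint
      linarith
  · rwa [hI.integral_tilt hzero (mem_tiltDomain_of_lt hup hε.1.le hε.2)]

/-- Short excursions, ending at `0`. -/
lemma isCandidate_of_le (hI : IsGoodConvexRate I) (hδ : 0 < δ)
    (hzero : I (-δ) = 0) (hpos : ∀ y : ℝ, -δ < y → 0 < I y) (hz : 0 < z) (hΘ : 0 < Θ)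
    (hup : ENNReal.ofReal Θ ≤ thetaUp I) (hint : IntervalIntegrable (tilt I δ) volume 0 Θ)
    (hK : ∫ u in (0 : ℝ)..Θ, tilt I δ u ≤ 0)
    (hjump : ∫ u in (0 : ℝ)..Θ, tilt I δ u ≠ 0 → ENNReal.ofReal Θ = thetaUp I)
    (hle : Θ ^ 2 * z ≤ -∫ θ in (0 : ℝ)..Θ, legendre I δ θ) :
    ∃ T j, IsCandidate I δ z Θ T j := by
  have hS := hI.integral_legendre_neg hδ hzero hpos hΘ hup hint hK
  have hparts := hI.integral_legendre hzero hΘ.le hup hint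
  set S := ∫ θ in (0 : ℝ)..Θ, legendre I δ θ
  set K := ∫ u in (0 : ℝ)..Θ, tilt I δ u with hKdef
  have hq : 0 < z / -S := div_pos hz (neg_pos.2 hS)
  have hsq : √(z / -S) ^ 2 = z / -S := Real.sq_sqrt hq.le
  have hr : 0 < √(z / -S) := Real.sqrt_pos.2 hq
  have hTΘ : Θ * √(z / -S) / Θ = √(z / -S) := by field_simp
  -- The jump cancels the net drift (T/Θ)K so that the path ends at 0. The area is then (T/Θ)²(−S),
  -- which fixes T, and T ≤ 1 is the assumed inequality.
  refine ⟨Θ * √(z / -S), -(√(z / -S) * K), hΘ, hup, mul_pos hΘ hr, ?_, ?_, ?_, hint, ?_, ?_, ?_⟩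
  · have h1 : (Θ * √(z / -S)) ^ 2 ≤ 1 := by
      rw [mul_pow, hsq, ← mul_div_assoc, div_le_one (neg_pos.2 hS)]
      exact hle
    exact (sq_le_one_iff₀ (mul_pos hΘ hr).le).1 h1
  · rw [← mul_neg]
    exact mul_nonneg hr.le (neg_nonneg.2 hK)
  · intro h1
    refine hjump fun h2 => h1 ?_
    rw [h2, mul_zero, neg_zero]
  · have h1 : √(z / -S) ^ 2 * (-S) = z := by
      rw [hsq]
      exact div_mul_cancel₀ _ (neg_pos.2 hS).ne'
    rw [hTΘ]
    linear_combination -h1 - √(z / -S) ^ 2 * hparts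
  · rw [hTΘ, ← hKdef]
    linarith
  · intro _
    rw [hTΘ, ← hKdef]
    ring

/-- Excursions of full length with an initial jump. -/
lemma isCandidate_jump (hΘ : 0 < Θ) (hup : ENNReal.ofReal Θ = thetaUp I)
    (hint : IntervalIntegrable (tilt I δ) volume 0 Θ)
    (hM : ∫ θ in (0 : ℝ)..Θ, θ * tilt I δ θ ≤ z * Θ ^ 2)
    (hend : 0 ≤ z * Θ ^ 2 - (∫ θ in (0 : ℝ)..Θ, θ * tilt I δ θ) +
      Θ * ∫ θ in (0 : ℝ)..Θ, tilt I δ θ) :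
    ∃ T j, IsCandidate I δ z Θ T j := by
  set M := ∫ θ in (0 : ℝ)..Θ, θ * tilt I δ θ with hMdef
  set K := ∫ θ in (0 : ℝ)..Θ, tilt I δ θ with hKdef
  -- With T = 1 and Θ = θ↑ fixed, the jump supplies whatever area the slopes leave missing.
  refine ⟨1, z - M / Θ ^ 2, hΘ, hup.le, one_pos, le_rfl, ?_, fun _ => hup, hint, ?_, ?_,
    fun h => absurd h (lt_irrefl _)⟩
  · rw [sub_nonneg, div_le_iff₀ (by positivity)]
    exact hM
  · rw [← hMdef]
    ring
  · rw [← hKdef]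
    have h1 : z - M / Θ ^ 2 + 1 / Θ * K = (z * Θ ^ 2 - M + Θ * K) / Θ ^ 2 := by
      field_simp
    rw [h1]
    positivity

/-- Integrability of the slopes up to `θ↑`. -/
lemma IsGoodConvexRate.intervalIntegrable_of_bound (hI : IsGoodConvexRate I)
    (hzero : I (-δ) = 0) (hup : ENNReal.ofReal Θ ≤ thetaUp I) {a C : ℝ} (ha : 0 ≤ a)
    (haΘ : a < Θ) (hC : ∀ θ ∈ Ioo a Θ, ∫ u in (0 : ℝ)..θ, tilt I δ u ≤ C) :
    IntervalIntegrable (tilt I δ) volume 0 Θ := by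
  obtain ⟨u, -, hu, hut⟩ := exists_seq_strictMono_tendsto' haΘ
  have hu0 : ∀ n, 0 ≤ u n := fun n => ha.trans (hu n).1.le
  have hdom : ∀ n, u n ∈ tiltDomain I := fun n => mem_tiltDomain_of_lt hup (hu0 n) (hu n).2
  have h1 : ∀ n, IntervalIntegrable (fun θ => tilt I δ θ + δ) volume 0 (u n) := fun n =>
    (hI.intervalIntegrable_tilt hzero (hdom n)).add intervalIntegrable_const
  have h2 : IntegrableOn (fun θ => tilt I δ θ + δ) (Ioc 0 Θ) := by
    refine integrableOn_Ioc_of_intervalIntegral_norm_bounded_right (I := C + |δ| * Θ)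
      (fun n => (intervalIntegrable_iff_integrableOn_Ioc_of_le (hu0 n)).1 (h1 n)) hut
      (Eventually.of_forall fun n => ?_)
    have h3 : ∫ θ in Ioc 0 (u n), ‖tilt I δ θ + δ‖ = ∫ θ in (0 : ℝ)..u n, (tilt I δ θ + δ) := by
      rw [intervalIntegral.integral_of_le (hu0 n)]
      refine integral_congr_ae (Eventually.of_forall fun θ => ?_)
      exact Real.norm_of_nonneg (by linarith [neg_le_tilt hzero (θ := θ)])
    rw [h3, intervalIntegral.integral_add (hI.intervalIntegrable_tilt hzero (hdom n))
      intervalIntegrable_const, intervalIntegral.integral_const, smul_eq_mul, sub_zero]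
    have h4 := hC (u n) (hu n)
    have h5 : u n * δ ≤ |δ| * Θ := by
      calc u n * δ ≤ u n * |δ| := mul_le_mul_of_nonneg_left (le_abs_self δ) (hu0 n)
        _ ≤ Θ * |δ| := mul_le_mul_of_nonneg_right (hu n).2.le (abs_nonneg δ)
        _ = |δ| * Θ := mul_comm _ _
    linarith
  rw [intervalIntegrable_iff_integrableOn_Ioc_of_le (ha.trans haΘ.le)]
  refine (h2.sub (integrableOn_const (C := δ) measure_Ioc_lt_top.ne)).congr
    (Eventually.of_forall fun θ => ?_)
  simp

/-- Bounded subgradients give Λ(θ) ≤ θr; letting θ grow in Young's inequality makes any finite-cost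
slope above r impossible. -/
lemma IsGoodConvexRate.le_of_tilt_le (hI : IsGoodConvexRate I) (hzero : I (-δ) = 0)
    (htop : thetaUp I = ⊤) {r : ℝ} (h : ∀ θ, 0 < θ → tilt I δ θ ≤ r) {y : ℝ} (hy : I y < ⊤) :
    y ≤ r := by
  by_contra! hlt
  have hd : 0 < y - r := sub_pos.2 hlt
  set θ := ((I y).toReal + 1) / (y - r) with hθ
  have hθ0 : 0 < θ := div_pos (by positivity) hd
  have h1 := hI.young hzero (θ := θ) ⟨hθ0.le, by simp [htop]⟩ hy
  have h2 := IsGoodConvexRate.legendre_le (I := I) (δ := δ) θ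
  have h3 := mul_le_mul_of_nonneg_left (h θ hθ0) hθ0.le
  have h4 : θ * (y - r) = (I y).toReal + 1 := div_mul_cancel₀ _ hd.ne'
  linarith

/-- Either the optimality conditions can be solved, or slopes are bounded by `2 z`. -/
theorem exists_isCandidate (hI : IsGoodConvexRate I) (hδ : 0 < δ)
    (hzero : I (-δ) = 0) (hpos : ∀ y : ℝ, -δ < y → 0 < I y) (hz : 0 < z) :
    (∃ Θ T j, IsCandidate I δ z Θ T j) ∨ (thetaUp I = ⊤ ∧ ∀ y, I y < ⊤ → y ≤ 2 * z) := by
  have hDint : ∀ θ ∈ tiltDomain I, IntervalIntegrable (tilt I δ) volume 0 θ := fun θ hθ =>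
    hI.intervalIntegrable_tilt hzero hθ
  -- The question is whether Λ, initially negative, returns to 0 before θ↑. At such a zero c an
  -- excursion without a jump comes back exactly to 0.
  by_cases hcase : ∃ Θ₁ ∈ tiltDomain I, 0 < Θ₁ ∧ 0 ≤ ∫ u in (0 : ℝ)..Θ₁, tilt I δ u
  · obtain ⟨Θ₁, hΘ₁, hΘ₁0, hK₁⟩ := hcase
    obtain ⟨c, hcD, hc0, hKc⟩ : ∃ c ∈ tiltDomain I, 0 < c ∧ ∫ u in (0 : ℝ)..c, tilt I δ u = 0 := by
      obtain ⟨ε, hε, hneg⟩ := hI.exists_legendre_neg hδ hzero hpos hΘ₁0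
      have hcont := continuousOn_integral_of_intervalIntegrable (hDint Θ₁ hΘ₁)
      rw [uIcc_of_le hΘ₁0.le] at hcont
      rw [← hI.integral_tilt hzero (mem_tiltDomain_of_le hΘ₁ hε.1.le hε.2.le)] at hneg
      obtain ⟨c, hc, hKc⟩ := intermediate_value_Icc hε.2.le
        (hcont.mono (Icc_subset_Icc_left hε.1.le)) ⟨hneg.le, hK₁⟩
      exact ⟨c, mem_tiltDomain_of_le hΘ₁ (hε.1.le.trans hc.1) hc.2, hε.1.trans_le hc.1, hKc⟩
    have hpartsc := hI.integral_legendre hzero hc0.le hcD.2.le (hDint c hcD)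
    rw [hKc, mul_zero, zero_sub] at hpartsc
    -- If the excursion returning to 0 with initial multiplier c reaches area z within unit time, it
    -- is the candidate.
    by_cases hA : c ^ 2 * z ≤ -∫ θ in (0 : ℝ)..c, legendre I δ θ
    · exact Or.inl ⟨c, isCandidate_of_le hI hδ hzero hpos hz hc0 hcD.2.le (hDint c hcD) hKc.le
        (fun h => absurd hKc h) hA⟩
    push Not at hA
    rw [hpartsc, neg_neg] at hA
    have htc := hI.tilt_pos_of_integral_pos hzero hcD hKc.ge hc0
    -- Otherwise take T = 1 and raise Θ beyond c: with no jump the area is Θ⁻²∫₀^Θ θ∇Λ. If it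
    -- reaches z, intermediate values give Θ, and Λ(Θ) ≥ 0 makes the end value non-negative.
    by_cases hB : ∃ Θ₂ ∈ tiltDomain I, c ≤ Θ₂ ∧
        z * Θ₂ ^ 2 ≤ ∫ θ in (0 : ℝ)..Θ₂, θ * tilt I δ θ
    · obtain ⟨Θ₂, hΘ₂, hcΘ₂, hM₂⟩ := hB
      have hcont := continuousOn_integral_of_intervalIntegrable
        (intervalIntegrable_mul_tilt (hDint Θ₂ hΘ₂))
      rw [uIcc_of_le hΘ₂.1] at hcont
      have hcont' : ContinuousOn (fun Θ => (∫ θ in (0 : ℝ)..Θ, θ * tilt I δ θ) - z * Θ ^ 2)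
          (Icc c Θ₂) := (hcont.mono (Icc_subset_Icc_left hc0.le)).sub (by fun_prop)
      obtain ⟨Θ, hΘ, hMΘ⟩ := intermediate_value_Icc hcΘ₂ hcont'
        (show (0 : ℝ) ∈ Icc _ _ from ⟨by linarith, by linarith⟩)
      have hΘ0 : 0 < Θ := hc0.trans_le hΘ.1
      have hΘD := mem_tiltDomain_of_le hΘ₂ hΘ0.le hΘ.2
      have hKΘ := hI.integral_tilt_le hzero hcD hc0 hKc.ge hΘ.1 hΘD.2.le (hDint Θ hΘD)
      rw [hKc] at hKΘ
      dsimp only at hMΘ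
      refine Or.inl ⟨Θ, 1, 0, hΘ0, hΘD.2.le, one_pos, le_rfl, le_rfl,
        fun h => absurd rfl h, hDint Θ hΘD, ?_, ?_, fun h => absurd h (lt_irrefl _)⟩
      · rw [sub_eq_zero.1 hMΘ]
        field_simp
        ring
      · rw [zero_add]
        exact mul_nonneg (by positivity) hKΘ
    push Not at hB
    by_cases htop : thetaUp I = ⊤
    · have hD : ∀ θ, 0 ≤ θ → θ ∈ tiltDomain I := fun θ hθ => ⟨hθ, by simp [htop]⟩
      refine Or.inr ⟨htop, fun y hy => hI.le_of_tilt_le hzero htop (fun θ₀ hθ₀ => ?_) hy⟩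
      by_contra! hlt
      set M₀ := ∫ θ in (0 : ℝ)..θ₀, θ * tilt I δ θ with hM₀
      set r := tilt I δ θ₀ with hr
      -- A slope r at θ₀ persists for larger θ, so the area moment grows at least like rΘ²/2. It
      -- stays below zΘ², hence r ≤ 2z.
      have hge : ∀ Θ, max c θ₀ ≤ Θ → M₀ + r * (Θ ^ 2 - θ₀ ^ 2) / 2 < z * Θ ^ 2 := by
        intro Θ hΘ
        have hcΘ := (le_max_left _ _).trans hΘ
        have hθΘ := (le_max_right _ _).trans hΘ
        have hΘ0 := hθ₀.le.trans hθΘ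
        refine lt_of_le_of_lt ?_ (hB Θ (hD Θ hΘ0) hcΘ)
        have hi := intervalIntegrable_mul_tilt (hDint Θ (hD Θ hΘ0))
        have hi1 := intervalIntegrable_mul_tilt (hDint θ₀ (hD θ₀ hθ₀.le))
        have hi2 := intervalIntegrable_mul_tilt
          (intervalIntegrable_of_subset (hDint Θ (hD Θ hΘ0)) hθ₀.le hθΘ le_rfl)
        rw [← intervalIntegral.integral_add_adjacent_intervals hi1 hi2]
        have h1 : ∫ θ in θ₀..Θ, θ * r ≤ ∫ θ in θ₀..Θ, θ * tilt I δ θ := by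
          refine intervalIntegral.integral_mono_on_of_le_Ioo hθΘ
            (Continuous.intervalIntegrable (by fun_prop) _ _) hi2 fun u hu => ?_
          exact mul_le_mul_of_nonneg_left (hI.monotoneOn_tilt hzero (hD _ hθ₀.le)
            (hD u (hθ₀.le.trans hu.1.le)) hu.1.le) (hθ₀.le.trans hu.1.le)
        rw [intervalIntegral.integral_mul_const, integral_id] at h1
        linarith
      have h2 : Tendsto (fun Θ : ℝ => (r / 2 - z) * Θ ^ 2) atTop atTop :=
        (tendsto_pow_atTop two_ne_zero).const_mul_atTop (by linarith)
      obtain ⟨Θ, hΘ1, hΘ2⟩ := ((h2.eventually_gt_atTop (r * θ₀ ^ 2 / 2 - M₀)).and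
        (eventually_ge_atTop (max c θ₀))).exists
      linarith [hge Θ hΘ2]
    · set Θ := (thetaUp I).toReal with hΘ
      have hofΘ : ENNReal.ofReal Θ = thetaUp I := ENNReal.ofReal_toReal htop
      have hcΘ : c < Θ := (ENNReal.ofReal_lt_iff_lt_toReal hc0.le htop).1 hcD.2
      have hΘ0 := hc0.trans hcΘ
      have hint : IntervalIntegrable (tilt I δ) volume 0 Θ := by
        refine hI.intervalIntegrable_of_bound hzero hofΘ.le hc0.le hcΘ
          -- The area stays below z for all θ < θ↑, and on (c, θ) the slopes are non-negative with
          -- weight at least c, so the bounded moment bounds the integral of the slopes.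
          (C := (z * Θ ^ 2 - ∫ θ in (0 : ℝ)..c, θ * tilt I δ θ) / c) fun θ hθ => ?_
        have hθD := mem_tiltDomain_of_lt hofΘ.le (hc0.le.trans hθ.1.le) hθ.2
        have hi2 := intervalIntegrable_of_subset (hDint θ hθD) hc0.le hθ.1.le le_rfl
        rw [← intervalIntegral.integral_add_adjacent_intervals (hDint c hcD) hi2, hKc, zero_add,
          le_div_iff₀ hc0]
        have h1 : ∫ u in c..θ, c * tilt I δ u ≤ ∫ u in c..θ, u * tilt I δ u :=
          intervalIntegral.integral_mono_on_of_le_Ioo hθ.1.le (hi2.const_mul c)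
            (intervalIntegrable_mul_tilt hi2) fun u hu =>
              mul_le_mul_of_nonneg_right hu.1.le (htc.trans (hI.monotoneOn_tilt hzero hcD
                (mem_tiltDomain_of_le hθD (hc0.le.trans hu.1.le) hu.2.le) hu.1.le))
        rw [intervalIntegral.integral_const_mul] at h1
        have h2 := hB θ hθD hθ.1.le
        rw [← intervalIntegral.integral_add_adjacent_intervals
          (intervalIntegrable_mul_tilt (hDint c hcD)) (intervalIntegrable_mul_tilt hi2)] at h2
        have h3 : z * θ ^ 2 ≤ z * Θ ^ 2 :=
          mul_le_mul_of_nonneg_left (pow_le_pow_left₀ (hc0.le.trans hθ.1.le) hθ.2.le 2) hz.le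
        linarith
      have hcont := continuousOn_integral_of_intervalIntegrable (intervalIntegrable_mul_tilt hint)
      rw [uIcc_of_le hΘ0.le] at hcont
      have hM : (∫ θ in (0 : ℝ)..Θ, θ * tilt I δ θ) - z * Θ ^ 2 ≤ 0 :=
        nonpos_right_end (f := fun Θ => (∫ θ in (0 : ℝ)..Θ, θ * tilt I δ θ) - z * Θ ^ 2)
          hc0.le hcΘ (hcont.sub (by fun_prop)) fun θ hθ => by
            linarith [hB θ (mem_tiltDomain_of_lt hofΘ.le (hc0.le.trans hθ.1.le) hθ.2) hθ.1.le]
      have hK := hI.integral_tilt_le hzero hcD hc0 hKc.ge hcΘ.le hofΘ.le hint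
      rw [hKc] at hK
      exact Or.inl ⟨Θ, isCandidate_jump hΘ0 hofΘ hint (by linarith)
        (by linarith [mul_nonneg hΘ0.le hK])⟩
  · push Not at hcase
    by_cases htop : thetaUp I = ⊤
    · have hD : ∀ θ, 0 ≤ θ → θ ∈ tiltDomain I := fun θ hθ => ⟨hθ, by simp [htop]⟩
      refine Or.inr ⟨htop, fun y hy => hI.le_of_tilt_le hzero htop (fun θ₀ hθ₀ => ?_) hy⟩
      by_contra! hlt
      have hr : 0 < tilt I δ θ₀ := by linarith
      set K₀ := ∫ u in (0 : ℝ)..θ₀, tilt I δ u with hK₀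
      -- Far enough for a positive slope at θ₀ to make Λ non-negative, contrary to the case
      -- assumption.
      set Θ := θ₀ + |K₀| / tilt I δ θ₀ with hΘ
      have hθΘ : θ₀ ≤ Θ := le_add_of_nonneg_right (by positivity)
      have hΘ0 := hθ₀.trans_le hθΘ
      have hi2 := intervalIntegrable_of_subset (hDint Θ (hD Θ hΘ0.le)) hθ₀.le hθΘ le_rfl
      have h1 := hcase Θ (hD Θ hΘ0.le) hΘ0
      rw [← intervalIntegral.integral_add_adjacent_intervals (hDint θ₀ (hD θ₀ hθ₀.le)) hi2] at h1
      have h2 : ∫ u in θ₀..Θ, tilt I δ θ₀ ≤ ∫ u in θ₀..Θ, tilt I δ u :=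
        intervalIntegral.integral_mono_on_of_le_Ioo hθΘ intervalIntegrable_const hi2 fun u hu =>
          hI.monotoneOn_tilt hzero (hD _ hθ₀.le) (hD u (hθ₀.le.trans hu.1.le)) hu.1.le
      rw [intervalIntegral.integral_const, smul_eq_mul, hΘ, add_sub_cancel_left,
        div_mul_cancel₀ _ hr.ne'] at h2
      linarith [neg_abs_le K₀]
    · set Θ := (thetaUp I).toReal with hΘ
      have hofΘ : ENNReal.ofReal Θ = thetaUp I := ENNReal.ofReal_toReal htop
      have hΘ0 : 0 < Θ := ENNReal.toReal_pos (hI.thetaUp_pos hzero).ne' htop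
      have hneg : ∀ θ ∈ Ioo 0 Θ, ∫ u in (0 : ℝ)..θ, tilt I δ u ≤ 0 := fun θ hθ =>
        (hcase θ (mem_tiltDomain_of_lt hofΘ.le hθ.1.le hθ.2) hθ.1).le
      have hint := hI.intervalIntegrable_of_bound hzero hofΘ.le le_rfl hΘ0 hneg
      have hcont := continuousOn_integral_of_intervalIntegrable hint
      rw [uIcc_of_le hΘ0.le] at hcont
      have hK := nonpos_right_end le_rfl hΘ0 hcont hneg
      have hparts := hI.integral_legendre hzero hΘ0.le hofΘ.le hint
      -- Here Λ ≤ 0 up to θ↑ < ∞, so Θ = θ↑. Either a jump followed by a return to 0 fits into unit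
      -- time, or the jump is larger and T = 1.
      by_cases hA : Θ ^ 2 * z ≤ -∫ θ in (0 : ℝ)..Θ, legendre I δ θ
      · exact Or.inl ⟨Θ, isCandidate_of_le hI hδ hzero hpos hz hΘ0 hofΘ.le hint hK
          (fun _ => hofΘ) hA⟩
      · push Not at hA
        rw [hparts] at hA
        have h1 := mul_nonneg_of_nonpos_of_nonpos (neg_nonpos.2 hΘ0.le) hK
        exact Or.inl ⟨Θ, isCandidate_jump hΘ0 hofΘ hint (by linarith) (by linarith)⟩

end RRW

/-! ### The degenerate case of slopes bounded by 2z -/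

namespace RRW

variable {I : ℝ → ℝ≥0∞} {δ z : ℝ} {ψ φ : ℝ → ℝ}

lemma isProfile_of_linear (hz : 0 < z) (h : ∀ t ∈ Icc (0 : ℝ) 1, ψ t = 2 * z * t) :
    IsProfile ψ ((Ioc (0 : ℝ) 1).indicator fun _ => 2 * z) 0 0 1 where
  T₀_nonneg := le_rfl
  lt := one_pos
  T₁_le_one := le_rfl
  jump_nonneg := le_rfl
  integrable := by
    rw [integrable_indicator_iff measurableSet_Ioc]
    exact integrableOn_const (measure_Ioc_lt_top.ne)
  eq_zero t ht := indicator_of_notMem ht _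
  eq_integral t := by
    rcases lt_or_ge t 0 with h0 | h0
    · rw [extendPath_of_neg h0, if_pos h0]
    · rw [if_neg (not_lt.2 h0), zero_add, intervalIntegral.integral_of_le h0,
        setIntegral_indicator measurableSet_Ioc, Ioc_inter_Ioc, max_self, setIntegral_const,
        measureReal_def, Real.volume_Ioc, sub_zero,
        ENNReal.toReal_ofReal (le_min h0 zero_le_one), extendPath, if_neg (not_lt.2 h0),
        h _ ⟨le_min h0 zero_le_one, min_le_right _ _⟩, smul_eq_mul, mul_comm]
  nonneg t ht := by
    rw [h t ht]
    have := ht.1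
    positivity

lemma J_of_linear (hδ : 0 < δ) (hzero : I (-δ) = 0) (hz : 0 < z)
    (h : ∀ t ∈ Icc (0 : ℝ) 1, ψ t = 2 * z * t) : J I ψ = I (2 * z) := by
  rw [(isProfile_of_linear hz h).J_eq hδ hzero (fun h1 => absurd h1 (lt_irrefl _)) fun t ht => by
      rw [h t ⟨ht.1.le, ht.2.le⟩]
      exact mul_pos (by positivity) ht.1,
    setLIntegral_congr_fun measurableSet_Ioc (g := fun _ => I (2 * z)) fun s hs => by
      simp only [indicator_of_mem hs]]
  simp

lemma isPotentialSolution_of_linear (hI : IsGoodConvexRate I) (hδ : 0 < δ) (hzero : I (-δ) = 0)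
    (hz : 0 < z) (hle : ∀ y, I y < ⊤ → y ≤ 2 * z) (hfin : I (2 * z) < ⊤)
    (h : ∀ t ∈ Icc (0 : ℝ) 1, ψ t = 2 * z * t) : IsPotentialSolution I δ z ψ 0 1 1 := by
  have hp := isProfile_of_linear hz h
  have hr : rbar I = ((2 * z : ℝ) : EReal) := by
    refine le_antisymm (sSup_le ?_) (coe_le_rbar hfin)
    rintro _ ⟨y, hy, rfl⟩
    exact EReal.coe_le_coe_iff.2 (hle y hy)
  have hnc : NonCoercive I :=
    ⟨2 * z, hr, I (2 * z), hfin,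
      hI.tendsto_left (x := -δ) (by linarith) (by simp [hzero]) hfin⟩
  -- Since T₀⁰ = T₁ = 1 the whole path runs at slope r̄ = 2z; the gradient and final-slope
  -- conditions are vacuous and λ* = 1 is arbitrary.
  refine ⟨hp.isPath, le_rfl, one_pos, le_rfl, ⟨zero_le_one, le_rfl⟩, ?_, fun h => ?_, ?_,
    fun h => ?_, ⟨1, one_pos, fun t ht => ?_⟩, fun hc => absurd hnc hc, fun hc => absurd hnc hc,
    fun _ => ⟨fun t ht => ?_, fun t ht => (hp.discontinuity ht).2 rfl⟩⟩
  · rintro t (ht | ht)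
    · exact absurd ht.2 (not_lt.2 ht.1)
    · exact absurd ht.1 (not_lt.2 ht.2)
  · exact absurd h (lt_irrefl _)
  · rw [intervalIntegral.integral_congr (g := fun t => 2 * z * t) fun t ht => h t (by
      rwa [uIcc_of_le zero_le_one] at ht), intervalIntegral.integral_const_mul, integral_id]
    ring
  · exact absurd h (lt_irrefl _)
  · exact absurd (ht.1.trans ht.2) (lt_irrefl _)
  · have h1 : HasDerivWithinAt (fun s => 2 * z * s) (rbar I).toReal (Icc 0 1) t := by
      rw [hr, EReal.toReal_coe]
      simpa using ((hasDerivAt_id t).const_mul (2 * z)).hasDerivWithinAt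
    exact h1.congr h (h t ⟨ht.1, ht.2.le⟩)

/-- If the slope is at most `2 z`, then paths of area `z` without upward singular part are linear,
up to a downward jump at time `1`. -/
lemma Feasible.J_eq_of_forall_le (h : Feasible z φ) (hδ : 0 < δ) (hzero : I (-δ) = 0) (hz : 0 < z)
    (htop : thetaUp I = ⊤) (hle : ∀ y, I y < ⊤ → y ≤ 2 * z) (hJ : J I φ < ⊤)
    (hI : IsGoodConvexRate I) :
    J I φ = I (2 * z) + thetaDown I * downMeasure φ (Icc 0 1) ∧
      (downMeasure φ (Icc 0 1) = 0 → ∀ t ∈ Icc (0 : ℝ) 1, φ t = 2 * z * t) := by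
  obtain ⟨hφ, harea⟩ := h
  have hJeq := hφ.J_eq (I := I) hδ hzero
  rw [hJeq, ENNReal.add_lt_top, ENNReal.add_lt_top] at hJ
  obtain ⟨⟨hJ1, -⟩, hJ3⟩ := hJ
  have hup : upMeasure φ (Icc 0 1) = 0 := by
    by_contra hne
    rw [htop, ENNReal.top_mul hne] at hJ3
    exact lt_irrefl _ hJ3
  have hslope : ∀ᵐ s, s ∈ Icc (0 : ℝ) 1 → acSlope φ s ≤ 2 * z := by
    have h1 : ∀ᵐ s ∂(volume.restrict (positiveSet φ)), I (acSlope φ s) < ⊤ :=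
      ae_lt_top (hI.measurable.comp measurable_acSlope) hJ1.ne
    rw [ae_restrict_iff' hφ.measurableSet_positiveSet] at h1
    filter_upwards [h1, hφ.acSlope_eq_zero, ae_ne_real 0, ae_ne_real 1] with s h1 h2 h3 h4 hs
    by_cases hE : s ∈ positiveSet φ
    · exact hle _ (h1 hE)
    · rw [h2 ⟨hs.1.lt_of_ne' h3, hs.2.lt_of_ne h4⟩ (hφ.eq_zero_of_notMem hs hE)]
      positivity
  set F := fun t : ℝ => ∫ s in (0 : ℝ)..t, (2 * z - acSlope φ s) with hF
  have hint : ∀ a b : ℝ, IntervalIntegrable (fun s => 2 * z - acSlope φ s) volume a b :=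
    fun a b => intervalIntegrable_const.sub integrable_acSlope.intervalIntegrable
  -- The gap to the line 2zt is non-negative and nondecreasing, yet has zero integral because ∫₀¹
  -- 2zt = z. It therefore vanishes on [0,1), and only a downward jump at time 1 can remain.
  have hgap : ∀ t ∈ Icc (0 : ℝ) 1, 2 * z * t - φ t = F t + (downMeasure φ).real (Icc 0 t) := by
    intro t ht
    have h1 : (upMeasure φ).real (Icc 0 t) = 0 := by
      rw [measureReal_def, measure_mono_null (Icc_subset_Icc_right ht.2) hup,
        ENNReal.toReal_zero]
    rw [hφ.eq_integral_add ht, h1, hF]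
    simp only
    rw [intervalIntegral.integral_sub intervalIntegrable_const
      integrable_acSlope.intervalIntegrable, intervalIntegral.integral_const,
      intervalIntegral.integral_of_le ht.1, integral_Icc_eq_integral_Ioc, smul_eq_mul]
    ring
  have hFmono : MonotoneOn F (Icc 0 1) := by
    intro s hs t ht hst
    have h1 : F t - F s = ∫ u in s..t, (2 * z - acSlope φ u) :=
      intervalIntegral.integral_interval_sub_left (hint _ _) (hint _ _)
    have h2 : 0 ≤ ∫ u in s..t, (2 * z - acSlope φ u) := by
      rw [intervalIntegral.integral_of_le hst]
      refine setIntegral_nonneg_of_ae_restrict ?_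
      rw [EventuallyLE, ae_restrict_iff' measurableSet_Ioc]
      filter_upwards [hslope] with u hu hus
      exact sub_nonneg.2 (hu ⟨hs.1.trans hus.1.le, hus.2.trans ht.2⟩)
    linarith
  have hgmono : MonotoneOn (fun t => 2 * z * t - φ t) (Icc 0 1) := by
    intro s hs t ht hst
    simp only
    rw [hgap s hs, hgap t ht]
    exact add_le_add (hFmono hs ht hst)
      (measureReal_mono (Icc_subset_Icc_right hst) (measure_ne_top _ _))
  have hF0 : F 0 = 0 := by simp [hF]
  have hFnonneg : ∀ t ∈ Icc (0 : ℝ) 1, 0 ≤ F t := fun t ht =>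
    hF0 ▸ hFmono ⟨le_rfl, zero_le_one⟩ ht ht.1
  have hgnonneg : ∀ t ∈ Icc (0 : ℝ) 1, 0 ≤ 2 * z * t - φ t := fun t ht => by
    rw [hgap t ht]
    exact add_nonneg (hFnonneg t ht) measureReal_nonneg
  have hgint : ∀ a b : ℝ, a ∈ Icc (0 : ℝ) 1 → b ∈ Icc (0 : ℝ) 1 →
      IntervalIntegrable (fun t => 2 * z * t - φ t) volume a b := fun a b ha hb =>
    (hgmono.mono (uIcc_subset_Icc ha hb)).intervalIntegrable
  have h0 : (0 : ℝ) ∈ Icc (0 : ℝ) 1 := ⟨le_rfl, zero_le_one⟩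
  have h1 : (1 : ℝ) ∈ Icc (0 : ℝ) 1 := ⟨zero_le_one, le_rfl⟩
  have hlinint : IntervalIntegrable (fun t : ℝ => 2 * z * t) volume 0 1 :=
    (continuous_const.mul continuous_id).intervalIntegrable _ _
  have htotal : ∫ t in (0 : ℝ)..1, (2 * z * t - φ t) = 0 := by
    have hφint : IntervalIntegrable φ volume 0 1 := by
      have := hlinint.sub (hgint 0 1 h0 h1)
      simpa using this
    rw [intervalIntegral.integral_sub hlinint hφint, harea,
      intervalIntegral.integral_const_mul, integral_id]
    ring
  have hgzero : ∀ t ∈ Ico (0 : ℝ) 1, 2 * z * t - φ t = 0 := by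
    intro t ht
    have ht' : t ∈ Icc (0 : ℝ) 1 := ⟨ht.1, ht.2.le⟩
    have e1 := intervalIntegral.integral_add_adjacent_intervals (hgint 0 t h0 ht') (hgint t 1 ht' h1)
    have e2 : 0 ≤ ∫ s in (0 : ℝ)..t, (2 * z * s - φ s) :=
      intervalIntegral.integral_nonneg ht.1 fun s hs => hgnonneg s ⟨hs.1, hs.2.trans ht.2.le⟩
    have e3 : ∫ s in t..1, (2 * z * t - φ t) ≤ ∫ s in t..1, (2 * z * s - φ s) :=
      intervalIntegral.integral_mono_on ht.2.le intervalIntegrable_const (hgint t 1 ht' h1)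
        fun s hs => hgmono ht' ⟨ht.1.trans hs.1, hs.2⟩ hs.1
    rw [intervalIntegral.integral_const, smul_eq_mul] at e3
    refine le_antisymm ?_ (hgnonneg t ht')
    by_contra! hlt
    have := mul_pos (sub_pos.2 ht.2) hlt
    linarith
  have hFzero : F 1 = 0 := by
    have hc : Continuous F := intervalIntegral.continuous_primitive hint 0
    refine tendsto_nhds_unique ((hc.tendsto 1).mono_left nhdsWithin_le_nhds)
      ((tendsto_const_nhds (x := (0 : ℝ))).congr' (f₁ := fun _ => 0) (l₁ := 𝓝[<] 1) ?_)
    filter_upwards [Ico_mem_nhdsLT (zero_lt_one' ℝ)] with t ht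
    have e1 := hgap t ⟨ht.1, ht.2.le⟩
    rw [hgzero t ht] at e1
    have e2 := hFnonneg t ⟨ht.1, ht.2.le⟩
    have e3 : 0 ≤ (downMeasure φ).real (Icc 0 t) := measureReal_nonneg
    linarith
  have hae : ∀ᵐ s, s ∈ Icc (0 : ℝ) 1 → acSlope φ s = 2 * z := by
    have e1 : 0 ≤ᵐ[volume.restrict (Icc 0 1)] fun s => 2 * z - acSlope φ s := by
      rw [EventuallyLE, ae_restrict_iff' measurableSet_Icc]
      filter_upwards [hslope] with s hs hs' using sub_nonneg.2 (hs hs')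
    have e2 : ∫ s in Icc (0 : ℝ) 1, (2 * z - acSlope φ s) = 0 := by
      rw [integral_Icc_eq_integral_Ioc, ← intervalIntegral.integral_of_le zero_le_one]
      exact hFzero
    have e3 := (integral_eq_zero_iff_of_nonneg_ae e1 ((integrable_const _).sub
      integrable_acSlope.integrableOn)).1 e2
    rw [EventuallyEq, ae_restrict_iff' measurableSet_Icc] at e3
    filter_upwards [e3] with s hs hs'
    have := hs hs'
    simp only [Pi.zero_apply] at this
    linarith
  refine ⟨?_, fun hdown t ht => ?_⟩
  · have hset : positiveSet φ =ᵐ[volume] Icc (0 : ℝ) 1 := by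
      refine eventuallyEq_set.2 ?_
      filter_upwards [ae_ne_real 0, ae_ne_real 1] with s e1 e2
      refine ⟨fun hs => hs.1, fun hs => ⟨hs, ?_⟩⟩
      have e3 := hgzero s ⟨hs.1, hs.2.lt_of_ne e2⟩
      have e4 : 0 < 2 * z * s := mul_pos (by positivity) (hs.1.lt_of_ne' e1)
      linarith
    have hconst : ∫⁻ s in Icc (0 : ℝ) 1, I (acSlope φ s) = ∫⁻ _ in Icc (0 : ℝ) 1, I (2 * z) := by
      refine setLIntegral_congr_fun_ae measurableSet_Icc ?_
      filter_upwards [hae] with s hs hs'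
      rw [hs hs']
    rw [hJeq, hup, mul_zero, add_zero, setLIntegral_congr hset, hconst]
    simp
  · rcases ht.2.lt_or_eq with h2 | h2
    · linarith [hgzero t ⟨ht.1, h2⟩]
    · subst h2
      have e1 := hgap 1 ht
      rw [hFzero, measureReal_def, hdown, ENNReal.toReal_zero] at e1
      linarith

/-- The main problem has a solution whenever it has a finite value, and all its solutions are
potential solutions. -/
theorem exists_isPotentialSolution_le (hI : IsGoodConvexRate I) (hδ : 0 < δ) (hzero : I (-δ) = 0)
    (hpos : ∀ y : ℝ, -δ < y → 0 < I y)
    (hgrad : ∀ y : ℝ, -δ ≤ y → (y : EReal) < rbar I → ∃ g : ℝ, HasGradAt I y g) (hz : 0 < z)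
    (hφ : Feasible z φ) (hJ : J I φ < ⊤) :
    ∃ ψ T₀ T₀₀ T₁, IsPotentialSolution I δ z ψ T₀ T₀₀ T₁ ∧
      ∀ φ, Feasible z φ → J I φ < ⊤ → J I ψ ≤ J I φ ∧
        (J I φ ≤ J I ψ → ∃ S₀ S₀₀ S₁, IsPotentialSolution I δ z φ S₀ S₀₀ S₁) := by
  rcases exists_isCandidate hI hδ hzero hpos hz with ⟨Θ, T, j, h⟩ | ⟨htop, hle⟩
  · exact h.exists_optimal hI hδ hzero hpos hgrad hz
  · have hfin : I (2 * z) < ⊤ := by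
      rw [(hφ.J_eq_of_forall_le hδ hzero hz htop hle hJ hI).1] at hJ
      exact le_self_add.trans_lt hJ
    refine ⟨fun t => 2 * z * t, 0, 1, 1,
      isPotentialSolution_of_linear hI hδ hzero hz hle hfin fun _ _ => rfl, fun φ hφ hJ => ?_⟩
    obtain ⟨h1, h2⟩ := hφ.J_eq_of_forall_le hδ hzero hz htop hle hJ hI
    rw [J_of_linear hδ hzero hz (ψ := fun t => 2 * z * t) fun _ _ => rfl, h1]
    refine ⟨le_self_add, fun h3 => ⟨0, 1, 1,
      isPotentialSolution_of_linear hI hδ hzero hz hle hfin (h2 ?_)⟩⟩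
    -- An optimal path cannot afford that final downward jump, as θ↓ > 0.
    have h4 : thetaDown I * downMeasure φ (Icc 0 1) = 0 := by
      by_contra hne
      exact absurd h3 (not_le.2 (ENNReal.lt_add_right hfin.ne hne))
    exact (mul_eq_zero.1 h4).resolve_left (hI.thetaDown_pos hzero).ne'

end RRW

end

theorem proposition3 (I : ℝ → ℝ≥0∞) (δ : ℝ)
    (hI : RRW.IsGoodConvexRate I)
    (hδ : 0 < δ) (hzero : I (-δ) = 0) (hpos : ∀ y : ℝ, -δ < y → 0 < I y)
    (hgrad : ∀ y : ℝ, -δ ≤ y → (y : EReal) < RRW.rbar I → ∃ g : ℝ, RRW.HasGradAt I y g)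
    (z : ℝ) (hz : 0 < z) :
    (∀ (ψ : ℝ → ℝ) (T₀ T₀₀ T₁ : ℝ), RRW.IsPotentialSolution I δ z ψ T₀ T₀₀ T₁ →
      RRW.Feasible z ψ ∧ RRW.J I ψ = RRW.reducedCost I ψ T₀ T₀₀ T₁) ∧
    (⨅ (ψ : ℝ → ℝ) (_ : RRW.Feasible z ψ), RRW.J I ψ) =
      (⨅ (ψ : ℝ → ℝ) (T₀ : ℝ) (T₀₀ : ℝ) (T₁ : ℝ)
        (_ : RRW.IsPotentialSolution I δ z ψ T₀ T₀₀ T₁), RRW.reducedCost I ψ T₀ T₀₀ T₁) ∧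
    (∀ ψ : ℝ → ℝ, RRW.IsOptimal I z ψ ↔
      ∃ T₀ T₀₀ T₁ : ℝ, RRW.IsReducedOptimal I δ z ψ T₀ T₀₀ T₁) := by
  have cost : ∀ {ψ : ℝ → ℝ} {T₀ T₀₀ T₁ : ℝ}, RRW.IsPotentialSolution I δ z ψ T₀ T₀₀ T₁ →
      RRW.Feasible z ψ ∧ RRW.J I ψ = RRW.reducedCost I ψ T₀ T₀₀ T₁ ∧ RRW.J I ψ < ⊤ :=
    fun h => h.feasible_and_cost hI hδ hzero hz
  -- One finite-cost path is enough to obtain a minimising potential solution. If there is none,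
  -- both infima are ∞, since potential solutions have finite cost.
  have best := fun {φ : ℝ → ℝ} (hφ : RRW.Feasible z φ) (hJ : RRW.J I φ < ⊤) =>
    RRW.exists_isPotentialSolution_le hI hδ hzero hpos hgrad hz hφ hJ
  refine ⟨fun ψ T₀ T₀₀ T₁ h => ⟨(cost h).1, (cost h).2.1⟩, le_antisymm ?_ ?_, fun ψ => ⟨?_, ?_⟩⟩
  · refine le_iInf fun ψ => le_iInf fun T₀ => le_iInf fun T₀₀ => le_iInf fun T₁ => le_iInf fun h => ?_
    exact (iInf₂_le ψ (cost h).1).trans (cost h).2.1.le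
  · refine le_iInf₂ fun φ hφ => ?_
    rcases eq_or_ne (RRW.J I φ) ⊤ with htop | htop
    · rw [htop]
      exact le_top
    · obtain ⟨ψ, T₀, T₀₀, T₁, h, hmin⟩ := best hφ htop.lt_top
      refine le_trans ?_ (hmin φ hφ htop.lt_top).1
      rw [(cost h).2.1]
      exact iInf_le_of_le ψ (iInf_le_of_le T₀ (iInf_le_of_le T₀₀ (iInf_le_of_le T₁
        (iInf_le_of_le h le_rfl))))
  · rintro ⟨hψ, hJ, hopt⟩
    obtain ⟨χ, R₀, R₀₀, R₁, hχ, hmin⟩ := best hψ hJ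
    obtain ⟨T₀, T₀₀, T₁, h⟩ := (hmin ψ hψ hJ).2 (hopt χ (cost hχ).1)
    refine ⟨T₀, T₀₀, T₁, h, fun φ S₀ S₀₀ S₁ hφ => ?_⟩
    rw [← (cost h).2.1, ← (cost hφ).2.1]
    exact hopt φ (cost hφ).1
  · rintro ⟨T₀, T₀₀, T₁, h, hopt⟩
    refine ⟨(cost h).1, (cost h).2.2, fun φ hφ => ?_⟩
    rcases eq_or_ne (RRW.J I φ) ⊤ with htop | htop
    · rw [htop]
      exact le_top
    · obtain ⟨χ, R₀, R₀₀, R₁, hχ, hmin⟩ := best hφ htop.lt_top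
      refine le_trans ?_ (hmin φ hφ htop.lt_top).1
      rw [(cost h).2.1, (cost hχ).2.1]
      exact hopt χ R₀ R₀₀ R₁ hχ
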